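/- **Model.** Let $0<\beta\le 2$, $L>0$, $\sigma>0$, $k=\lceil\beta\rceil-1\in\{0,1\}$ and $\varrho=\beta-\lceil\beta\rceil+1$. One observes $Y_i=f(i/n)+\varepsilon_i$, $i\in[n]=\{1,\dots,n\}$, with independent $\varepsilon_i\sim N(0,\sigma^2)$, where $f$ belongs to the Hölder class $$\Sigma(\beta,L)=\{f:[0,1]\to\mathbb R:\ |f^{(k)}(x)-f^{(k)}(y)|\le L|x-y|^{\varrho}\ \text{for all }x,y\}.$$ Let $K:\mathbb R\to[0,\infty)$ be a symmetric kernel that vanishes outside $[-1,1]$, with $\int K=1$, $K\le K_{\max}$, $K\ge K_{\min}>0$ on $[-\Delta,\Delta]$ for some $\Delta>0$, and Lipschitz constant $L_K\in(0,\infty)$. For $\delta>0$ let $\mathcal F_\beta(\delta)$ be the set of $f\in\Sigma(\beta,L)$ with $\max_{0\le a<b\le1}(f(a)-f(b))\ge\delta$ (if $\beta\le1$), respectively $\min_{[0,1]}f'\le-\delta$ (if $\beta>1$). For $\gamma>0$ define the $\gamma$-exceedance fractions ($\lambda$ is Lebesgue measure) $$\varepsilon_{0,\gamma}(f)=\min_{g\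 \text{increasing}}\lambda\{x\in[0,1]:|f(x)-g(x)|>\gamma\},\qquad \varepsilon_{1,\gamma}(f)=\lambda\{x\in[0,1]:f'(x)\le-\gamma\}.$$ **Local tests.** With $U(u)=(u^j/j!)_{0\le j\le k}$ and a bandwidth $h>0$ put $\mathcal B_{nx}=\frac1{nh}\sum_{i=1}^nU(\tfrac{i/n-x}h)U(\tfrac{i/n-x}h)^\top K(\tfrac{i/n-x}h)$ and let $\hat f_n(x)=U(0)^\top\mathcal B_{nx}^{-1}\frac1{nh}\sum_{i=1}^nU(\tfrac{i/n-x}h)K(\tfrac{i/n-x}h)Y_i$ be the local polynomial estimator of order $k$. Let $\lambda_0>0$ be any number such that, whenever $b_n\to0$ and $nb_n\to\infty$, one has $\lambda_{\min}(\mathcal B_{nx})\ge\lambda_0$ (with bandwidth $h=b_n$) for all large $n$ and all $x\in[0,1]$. Put $$C_*=\tfrac{8K_{\max}}{\lambda_0},\quad q_1=\tfrac{C_*L}{k!},\quad q_2=\tfrac{16\sigma^2\lceil\beta\rceil}{\lambda_0^2}\int K^2,\quad C_h=\Bigl(\tfrac{q_2}{4q_1^2\beta}\Bigr)^{\frac1{2\beta+1}},\quad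 h_n=C_h\Bigl(\tfrac{\log n}n\Bigr)^{\frac1{2\beta+1}},$$ $$L_1=\sqrt e(L_K+K_{\max}),\quad L_2=\lceil\beta\rceil(2K_{\max}+L_K),\quad W=4\max\Bigl\{C_*,\ \tfrac{L_1}{8L_2}+\tfrac{\sqrt eK_{\max}}{\lambda_0}\Bigr\}^2,\quad M=\max\{\tfrac{16K_{\max}}{\lambda_0},2\},$$ $$C_\beta=\begin{cases}(M+4)L+\sigma\bigl(\sqrt{4W/C_h^{2\beta+1}}+\sqrt{6W/C_h^{2\beta+1}}\bigr),&\beta\le1,\\ 4L+\frac{16L_2\sigma}{\lambda_0}\sqrt{4W/C_h^{2\beta+1}},&\beta>1,\end{cases}$$ $$\gamma_n=C_\beta h_n^{\varrho},\quad \Delta_{\beta,n}=\Bigl(\tfrac{\log n}n\Bigr)^{\frac{\varrho}{2\beta+1}},\quad C=(2C_\beta+2L)C_h^{\varrho},\quad C_n(\alpha)=-2\log(\tfrac\alpha2)\,h_n^{-1},\quad N_{\max}=\tfrac{40}{\log2}C_n(\alpha)\log^2n.$$ The local test $\Phi_{i,j}$ ($i<j$) rejects iff $\hat f_n(\frac in)-\hat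 f_n(\frac jn)\ge C_{n,\alpha,i,j}+D_{n,\beta,i,j}$, computed with bandwidth $h_n$, where $$C_{n,\alpha,i,j}=\sigma\sqrt{-2\log(\alpha/N_{\max})W}\;n^{-\frac12}h_n^{-\frac32}\min\{\tfrac{8L_2}{\lambda_0}\tfrac{|i-j|}n,h_n\},$$ and $D_{n,\beta,i,j}=0$ if $\frac in,\frac jn\in[h_n,1-h_n]$, $D_{n,\beta,i,j}=MLh_n^\beta$ otherwise. **FOMT.** Repeat $\lceil C_n(\alpha)\rceil$ times: draw $I\sim\mathrm{Unif}([n])$; if $I\le n-1$, then $\lceil20\log n\rceil$ times, for $r=0,\dots,\lceil\log_2(n-I)\rceil$, draw $J\sim\mathrm{Unif}([2^r\wedge(n-I)])$ and perform $\Phi_{I,I+J}$; then, if $I\ge2$, $\lceil20\log n\rceil$ times, for $r=0,\dots,\lceil\log_2(I-1)\rceil$, draw $J\sim\mathrm{Unif}([2^r\wedge(I-1)])$ and perform $\Phi_{I-J,I}$. As soon as a local test rejects, stop and output $1$ (a violation is detected); if none rejects, output $0$. All draws are independent of each other and of the data. FOMT is run on a randomised real RAM with unit costs: an elementary operation on reals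 or integers, an evaluation of $K$, a look-up of one $Y_i$, or the draw of a uniform integer is one step. The estimate $\hat f_n(i/n)$ is computed by summing over the design points in $[\frac in-h_n,\frac in+h_n]$ and solving the $(k+1)\times(k+1)$ normal equations. **Theorem (Computation).** Numbers $\lambda_0$ as above exist. For every such $\lambda_0$ and every $\alpha\in(0,1)$: 1. There is a constant $A$ such that for all $n\ge2$, all data (in particular for all $f\in\Sigma(\beta,L)$) and all outcomes of the random draws, FOMT halts after at most $A\,n(\log n)^2$ steps. 2. There is a constant $A$ (independent of $n$ and $f$) such that $$\liminf_{n\to\infty}\ \inf_{f\in\mathcal F_\beta(C\Delta_{\beta,n})}\mathbb P_f\Bigl(\text{FOMT outputs }1\text{ within at most }A\,\varepsilon_{\lceil\beta\rceil-1,\gamma_n}(f)^{-1}\,n^{\frac{2\beta}{2\beta+1}}(\log n)^{\frac{4\beta+3}{2\beta+1}}\text{ steps}\Bigr)\ \ge\ 1-\alpha .$$ -/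

import Mathlib

open MeasureTheory ProbabilityTheory Filter Topology
open scoped ENNReal Nat

namespace FOMT

/-! ## Function classes on the unit interval

A function on `[0,1]` is given by a function `ℝ → ℝ` of which only the values on `[0,1]` are used. -/

/-- The Hölder class `Σ(β, L)` on `[0,1]`. -/
def holderClass (β L : ℝ) : Set (ℝ → ℝ) :=
  {f | ContDiffOn ℝ ((⌈β⌉₊ - 1 : ℕ) : WithTop ℕ∞) f (Set.Icc 0 1) ∧
    ∀ x ∈ Set.Icc (0 : ℝ) 1, ∀ y ∈ Set.Icc (0 : ℝ) 1,
      |iteratedDerivWithin (⌈β⌉₊ - 1) f (Set.Icc 0 1) x -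
        iteratedDerivWithin (⌈β⌉₊ - 1) f (Set.Icc 0 1) y| ≤ L * |x - y| ^ (β + 1 - (⌈β⌉₊ : ℝ))}

/-- The class `F_β(δ)` of alternatives: functions in `Σ(β, L)` having a drop of size at least `δ`
(if `β ≤ 1`), or a derivative that is somewhere at most `-δ` (if `β > 1`). -/
def alternatives (β L δ : ℝ) : Set (ℝ → ℝ) :=
  {f | f ∈ holderClass β L ∧
    if β ≤ 1 then ∃ a b : ℝ, 0 ≤ a ∧ a < b ∧ b ≤ 1 ∧ δ ≤ f a - f b
    else ∃ x ∈ Set.Icc (0 : ℝ) 1, derivWithin f (Set.Icc 0 1) x ≤ -δ}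

/-- The `γ`-exceedance fraction of order zero: the least Lebesgue measure of
`{x ∈ [0,1] : |f x - g x| > γ}` over monotone increasing `g`. -/
noncomputable def exceedanceZero (γ : ℝ) (f : ℝ → ℝ) : ℝ≥0∞ :=
  ⨅ g : {g : ℝ → ℝ // MonotoneOn g (Set.Icc 0 1)},
    volume {x : ℝ | x ∈ Set.Icc (0 : ℝ) 1 ∧ γ < |f x - g.1 x|}

/-- The `γ`-exceedance fraction of order one: the measure of `{x ∈ [0,1] : f' x ≤ -γ}`. -/
noncomputable def exceedanceOne (γ : ℝ) (f : ℝ → ℝ) : ℝ≥0∞ :=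
  volume {x : ℝ | x ∈ Set.Icc (0 : ℝ) 1 ∧ derivWithin f (Set.Icc 0 1) x ≤ -γ}

/-- `ε_{k,γ}(f)` for `k ∈ {0, 1}`. -/
noncomputable def exceedance (k : ℕ) (γ : ℝ) (f : ℝ → ℝ) : ℝ :=
  if k = 0 then (exceedanceZero γ f).toReal else (exceedanceOne γ f).toReal

/-! ## Kernels and local polynomial estimators -/

/-- The assumptions on the kernel, together with the constants that occur in them. -/
structure IsKernel (K : ℝ → ℝ) (Kmin Kmax Δ LK : ℝ) : Prop where
  nonneg : ∀ u, 0 ≤ K u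
  integral_eq_one : ∫ u, K u = 1
  support : ∀ u, 1 < |u| → K u = 0
  Kmin_pos : 0 < Kmin
  Δ_pos : 0 < Δ
  lower : ∀ u, |u| ≤ Δ → Kmin ≤ K u
  upper : ∀ u, K u ≤ Kmax
  LK_pos : 0 < LK
  lipschitz : ∀ u v, |K u - K v| ≤ LK * |u - v|
  symm : ∀ u, K (-u) = K u

/-- The vector `U(u) = (1, u, u²/2!, …, uᵏ/k!)`. -/
noncomputable def basisVec (k : ℕ) (u : ℝ) : Fin (k + 1) → ℝ :=
  fun j => u ^ (j : ℕ) / ((j : ℕ)! : ℝ)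

/-- The matrix `B_{nx}` of the weighted least squares problem with design points `i/n`. -/
noncomputable def gram (K : ℝ → ℝ) (k n : ℕ) (h x : ℝ) : Matrix (Fin (k + 1)) (Fin (k + 1)) ℝ :=
  (1 / ((n : ℝ) * h)) • ∑ i ∈ Finset.Icc 1 n,
    K (((i : ℝ) / n - x) / h) •
      Matrix.vecMulVec (basisVec k (((i : ℝ) / n - x) / h)) (basisVec k (((i : ℝ) / n - x) / h))

/-- The vector `a_{nx}` of the weighted least squares problem. -/
noncomputable def momentVec (K : ℝ → ℝ) (k n : ℕ) (h : ℝ) (y : ℕ → ℝ) (x : ℝ) : Fin (k + 1) → ℝ :=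
  (1 / ((n : ℝ) * h)) • ∑ i ∈ Finset.Icc 1 n,
    (K (((i : ℝ) / n - x) / h) * y i) • basisVec k (((i : ℝ) / n - x) / h)

/-- The local polynomial estimator of order `k` with bandwidth `h` at `x`:
`⟨θ, U(0)⟩` with `θ = B_{nx}⁻¹ a_{nx}`. The data are `y 1, …, y n`. -/
noncomputable def lpe (K : ℝ → ℝ) (k n : ℕ) (h : ℝ) (y : ℕ → ℝ) (x : ℝ) : ℝ :=
  ((gram K k n h x)⁻¹.mulVec (momentVec K k n h y x)) ⬝ᵥ basisVec k 0

/-- `lam0` is an asymptotic uniform lower bound for the smallest eigenvalue of `B_{nx}`: whenever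
`h_n → 0` and `n h_n → ∞`, there is `n₀` with `λ_min(B_{nx}) ≥ lam0` for all `n ≥ n₀` and all
`x ∈ [0,1]`. -/
def IsEigenBound (K : ℝ → ℝ) (k : ℕ) (lam0 : ℝ) : Prop :=
  0 < lam0 ∧ ∀ h : ℕ → ℝ, Tendsto h atTop (𝓝 0) → Tendsto (fun n : ℕ => (n : ℝ) * h n) atTop atTop →
    ∃ n₀ : ℕ, ∀ n ≥ n₀, ∀ x ∈ Set.Icc (0 : ℝ) 1,
      (gram K k n (h n) x - lam0 • (1 : Matrix (Fin (k + 1)) (Fin (k + 1)) ℝ)).PosSemidef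

/-! ## Parameters of the test -/

/-- The known quantities on which the test depends: the kernel `K` with its constants `Kmax` and
`LK`, smoothness `β`, radius `L`, noise level `σ` and eigenvalue bound `lam0`. -/
structure Params where
  K : ℝ → ℝ
  Kmax : ℝ
  LK : ℝ
  β : ℝ
  L : ℝ
  σ : ℝ
  lam0 : ℝ

namespace Params

variable (P : Params)

/-- The order `⌈β⌉ - 1` of the local polynomial estimator. -/
noncomputable def order : ℕ := ⌈P.β⌉₊ - 1

/-- The exponent `β - ⌈β⌉ + 1`. -/
noncomputable def frac : ℝ := P.β - (⌈P.β⌉₊ : ℝ) + 1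

/-- `C_*` -/
noncomputable def Cstar : ℝ := 8 * P.Kmax / P.lam0

noncomputable def q1 : ℝ := P.Cstar * P.L / ((⌈P.β⌉₊ - 1)! : ℝ)

noncomputable def q2 : ℝ := P.σ ^ 2 * (16 * (⌈P.β⌉₊ : ℝ) / P.lam0 ^ 2) * ∫ u, P.K u ^ 2

noncomputable def Ch : ℝ := (P.q2 / (4 * P.q1 ^ 2 * P.β)) ^ (1 / (2 * P.β + 1))

noncomputable def L1 : ℝ := √(Real.exp 1) * P.LK + √(Real.exp 1) * P.Kmax

noncomputable def L2 : ℝ := 2 * (⌈P.β⌉₊ : ℝ) * P.Kmax + (⌈P.β⌉₊ : ℝ) * P.LK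

/-- `C̃_*` -/
noncomputable def Ctilde : ℝ := P.L1 / (8 * P.L2) + √(Real.exp 1) * P.Kmax / P.lam0

noncomputable def W : ℝ := max (4 * P.Cstar ^ 2) (4 * P.Ctilde ^ 2)

/-- The factor `(16 Kmax / λ₀ ∨ 2) L` of the bias bound. -/
noncomputable def biasConst : ℝ := max (16 * P.Kmax / P.lam0) 2 * P.L

/-- `C_β` -/
noncomputable def Cβ : ℝ :=
  if P.β ≤ 1 then
    (max (16 * P.Kmax / P.lam0) 2 + 4) * P.L +
      P.σ * (√(4 * P.W / P.Ch ^ (2 * P.β + 1)) + √(6 * P.W / P.Ch ^ (2 * P.β + 1)))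
  else
    4 * P.L + 16 * P.L2 * P.σ / P.lam0 * √(4 * P.W / P.Ch ^ (2 * P.β + 1))

/-- The constant `C` in the separation rate. -/
noncomputable def sepConst : ℝ := (2 * P.Cβ + 2 * P.L) * P.Ch ^ P.frac

/-- The bandwidth `h_n`. -/
noncomputable def bandwidth (n : ℕ) : ℝ :=
  P.Ch * (Real.log n / n) ^ (1 / (2 * P.β + 1))

/-- `γ_n` -/
noncomputable def γ (n : ℕ) : ℝ := P.Cβ * P.bandwidth n ^ P.frac

/-- The separation rate `Δ_{β,n}`. -/
noncomputable def sepRate (n : ℕ) : ℝ := (Real.log n / n) ^ (P.frac / (2 * P.β + 1))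

/-- `C_n(α)`, the number of repetitions (before rounding up). -/
noncomputable def numReps (n : ℕ) (α : ℝ) : ℝ := -2 * Real.log (α / 2) / P.bandwidth n

/-- `N_max` -/
noncomputable def Nmax (n : ℕ) (α : ℝ) : ℝ :=
  40 / Real.log 2 * P.numReps n α * (Real.log n * Real.log n)

/-- The factor of `C_{n,α,i,j}` that does not depend on `i` and `j`. -/
noncomputable def critScale (n : ℕ) (α : ℝ) : ℝ :=
  P.σ * √(-2 * Real.log (α / P.Nmax n α) * P.W) * (n : ℝ) ^ (-1 / 2 : ℝ) *
    P.bandwidth n ^ (-3 / 2 : ℝ)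

/-- `C_{n,α,i,j}` -/
noncomputable def critNoise (n : ℕ) (α : ℝ) (i j : ℕ) : ℝ :=
  P.critScale n α * min (8 * P.L2 / P.lam0 * |(i : ℝ) / n - (j : ℝ) / n|) (P.bandwidth n)

open Classical in
/-- `D_{n,β,i,j}` -/
noncomputable def critBias (n : ℕ) (i j : ℕ) : ℝ :=
  if (i : ℝ) / n ∈ Set.Icc (P.bandwidth n) (1 - P.bandwidth n) ∧
      (j : ℝ) / n ∈ Set.Icc (P.bandwidth n) (1 - P.bandwidth n) then 0
  else P.biasConst * P.bandwidth n ^ P.β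

/-- The critical value `q_{n,β,i,j}(α)`. -/
noncomputable def critValue (n : ℕ) (α : ℝ) (i j : ℕ) : ℝ :=
  P.critNoise n α i j + P.critBias n i j

/-- The statistic `T_{i,j}`. -/
noncomputable def statistic (n : ℕ) (y : ℕ → ℝ) (i j : ℕ) : ℝ :=
  lpe P.K P.order n (P.bandwidth n) y ((i : ℝ) / n) -
    lpe P.K P.order n (P.bandwidth n) y ((j : ℝ) / n)

/-- The local test `Φ_{i,j}` rejects. -/
def Rejects (n : ℕ) (α : ℝ) (y : ℕ → ℝ) (i j : ℕ) : Prop :=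
  P.critValue n α i j ≤ P.statistic n y i j

end Params

/-! ## A randomised real RAM with unit costs

A program is a (well-founded) tree of elementary instructions. The kernel, the data and the random
numbers are accessible only through instructions, and every executed instruction costs one step. -/

/-- Elementary instructions, indexed by the type of their result. -/
inductive Instr : Type → Type
  -- real arithmetic
  | add (x y : ℝ) : Instr ℝ
  | sub (x y : ℝ) : Instr ℝ
  | mul (x y : ℝ) : Instr ℝ
  | div (x y : ℝ) : Instr ℝ
  | abs (x : ℝ) : Instr ℝ
  | min (x y : ℝ) : Instr ℝ
  | sqrt (x : ℝ) : Instr ℝ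
  | log (x : ℝ) : Instr ℝ
  | pow (x y : ℝ) : Instr ℝ
  -- comparison and conversion
  | le (x y : ℝ) : Instr Bool
  | ofNat (m : ℕ) : Instr ℝ
  | floor (x : ℝ) : Instr ℕ
  | ceil (x : ℝ) : Instr ℕ
  -- integer arithmetic
  | natAdd (a b : ℕ) : Instr ℕ
  | natSub (a b : ℕ) : Instr ℕ
  | natMin (a b : ℕ) : Instr ℕ
  | natMax (a b : ℕ) : Instr ℕ
  | natLe (a b : ℕ) : Instr Bool
  | pow2 (a : ℕ) : Instr ℕ
  -- one evaluation of the kernel; access to one observation; one uniform number in `{1, …, m}`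
  | kernel (u : ℝ) : Instr ℝ
  | data (i : ℕ) : Instr ℝ
  | unif (m : ℕ) : Instr ℕ
  -- advance and test a loop counter
  | loop : Instr Unit

open Classical in
/-- The (random) result of an instruction. -/
noncomputable def Instr.result (K : ℝ → ℝ) (y : ℕ → ℝ) : {τ : Type} → Instr τ → PMF τ
  | _, .add a b => PMF.pure (a + b)
  | _, .sub a b => PMF.pure (a - b)
  | _, .mul a b => PMF.pure (a * b)
  | _, .div a b => PMF.pure (a / b)
  | _, .abs a => PMF.pure |a|
  | _, .min a b => PMF.pure (a ⊓ b)
  | _, .sqrt a => PMF.pure √a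
  | _, .log a => PMF.pure (Real.log a)
  | _, .pow a b => PMF.pure (a ^ b)
  | _, .le a b => PMF.pure (decide (a ≤ b))
  | _, .ofNat m => PMF.pure (m : ℝ)
  | _, .floor a => PMF.pure ⌊a⌋₊
  | _, .ceil a => PMF.pure ⌈a⌉₊
  | _, .natAdd a b => PMF.pure (a + b)
  | _, .natSub a b => PMF.pure (a - b)
  | _, .natMin a b => PMF.pure (a ⊓ b)
  | _, .natMax a b => PMF.pure (a ⊔ b)
  | _, .natLe a b => PMF.pure (decide (a ≤ b))
  | _, .pow2 a => PMF.pure (2 ^ a)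
  | _, .kernel u => PMF.pure (K u)
  | _, .data i => PMF.pure (y i)
  | _, .unif m =>
      if hm : (Finset.Icc 1 m).Nonempty then PMF.uniformOfFinset (Finset.Icc 1 m) hm else PMF.pure 0
  | _, .loop => PMF.pure ()

/-- Programs: `ret a` halts with output `a`; `step i k` executes `i` and continues with its
result. -/
inductive Prog (ω : Type) : Type 1
  | ret (a : ω) : Prog ω
  | step {τ : Type} (i : Instr τ) (k : τ → Prog ω) : Prog ω

/-- Sequential composition. -/
def Prog.bind {ω ω' : Type} : Prog ω → (ω → Prog ω') → Prog ω'
  | .ret a, q => q a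
  | .step i k, q => .step i fun r => (k r).bind q

instance : Monad Prog where
  pure := Prog.ret
  bind := Prog.bind

/-- The program consisting of one instruction. -/
def exec {τ : Type} (i : Instr τ) : Prog τ := .step i .ret

/-- The joint law of the output and of the number of executed instructions, for the kernel `K` and
fixed data `y`. -/
noncomputable def Prog.run (K : ℝ → ℝ) (y : ℕ → ℝ) {ω : Type} : Prog ω → PMF (ω × ℕ)
  | .ret a => PMF.pure (a, 0)
  | .step i k => (i.result K y).bind fun r => ((k r).run K y).map fun s => (s.1, s.2 + 1)

/-- `for k = start, …, start + c - 1`: update the state `s` by `body k s`. -/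
def foldLoop {ω : Type} (body : ℕ → ω → Prog ω) : (c start : ℕ) → ω → Prog ω
  | 0, _, s => do
      exec .loop
      return s
  | c + 1, k, s => do
      exec .loop
      let s' ← body k s
      foldLoop body c (k + 1) s'

/-- `for k = start, …, start + c - 1`: run `body k`, and stop with `true` as soon as it returns
`true`; return `false` if it never does. -/
def anyLoop (body : ℕ → Prog Bool) : (c start : ℕ) → Prog Bool
  | 0, _ => do
      exec .loop
      return false
  | c + 1, k => do
      exec .loop
      let b ← body k
      if b then return true else anyLoop body c (k + 1)

/-! ## The program FOMT -/

/-- Quantities that depend only on `n` and `α`, computed once at the beginning. -/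
structure Tuning where
  /-- bandwidth `h_n` -/
  h : ℝ
  /-- `⌊n h_n⌋`, the number of design points in a half window -/
  halfWidth : ℕ
  /-- number of repetitions of the outer loop -/
  outer : ℕ
  /-- number of repetitions of the inner loops -/
  inner : ℕ
  /-- factor of the stochastic part of the critical value -/
  scale : ℝ
  /-- bias part of the critical value near the boundary -/
  bias : ℝ

/-- Computation of the tuning quantities from `n`; fixed real constants are part of the program. -/
noncomputable def setupProg (P : Params) (α : ℝ) (n : ℕ) : Prog Tuning := do
  let nr ← exec (.ofNat n)
  let ln ← exec (.log nr)
  let r ← exec (.div ln nr)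
  let p ← exec (.pow r (1 / (2 * P.β + 1)))
  let h ← exec (.mul P.Ch p)
  let nh ← exec (.mul nr h)
  let hw ← exec (.floor nh)
  let c ← exec (.div (-2 * Real.log (α / 2)) h)
  let outer ← exec (.ceil c)
  let t ← exec (.mul 20 ln)
  let inner ← exec (.ceil t)
  let a ← exec (.mul (40 / Real.log 2) c)
  let ln2 ← exec (.mul ln ln)
  let nmax ← exec (.mul a ln2)
  let q ← exec (.div α nmax)
  let lq ← exec (.log q)
  let b ← exec (.mul (-2) lq)
  let bw ← exec (.mul b P.W)
  let s ← exec (.sqrt bw)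
  let ss ← exec (.mul P.σ s)
  let n1 ← exec (.pow nr (-1 / 2))
  let h1 ← exec (.pow h (-3 / 2))
  let d ← exec (.mul ss n1)
  let scale ← exec (.mul d h1)
  let hb ← exec (.pow h P.β)
  let bias ← exec (.mul P.biasConst hb)
  return { h := h, halfWidth := hw, outer := outer, inner := inner, scale := scale, bias := bias }

/-- Running sums: `∑ K(u_k) u_kʲ` for `j = 0, 1, 2` and `∑ K(u_k) u_kʲ Y_k` for `j = 0, 1`. -/
structure Moments where
  s0 : ℝ
  s1 : ℝ
  s2 : ℝ
  t0 : ℝ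
  t1 : ℝ

/-- Add the contribution of the design point with index `k` to the sums for the estimate at the
design point with index `i`. -/
def momentStep (n : ℕ) (h : ℝ) (i k : ℕ) (m : Moments) : Prog Moments := do
  let nr ← exec (.ofNat n)
  let kr ← exec (.ofNat k)
  let ir ← exec (.ofNat i)
  let xk ← exec (.div kr nr)
  let xi ← exec (.div ir nr)
  let d ← exec (.sub xk xi)
  let u ← exec (.div d h)
  let w ← exec (.kernel u)
  let yk ← exec (.data k)
  let wu ← exec (.mul w u)
  let wuu ← exec (.mul wu u)
  let wy ← exec (.mul w yk)
  let wuy ← exec (.mul wu yk)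
  let s0 ← exec (.add m.s0 w)
  let s1 ← exec (.add m.s1 wu)
  let s2 ← exec (.add m.s2 wuu)
  let t0 ← exec (.add m.t0 wy)
  let t1 ← exec (.add m.t1 wuy)
  return { s0 := s0, s1 := s1, s2 := s2, t0 := t0, t1 := t1 }

/-- The local polynomial estimator of order `k ∈ {0, 1}` at the design point with index `i`: sum over
the design points in the window, then solve the `1 × 1` or `2 × 2` normal equations. -/
noncomputable def lpeProg (k n : ℕ) (T : Tuning) (i : ℕ) : Prog ℝ := do
  let a ← exec (.natSub i T.halfWidth)
  let lo ← exec (.natMax 1 a)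
  let b ← exec (.natAdd i T.halfWidth)
  let hi ← exec (.natMin n b)
  let e ← exec (.natAdd hi 1)
  let c ← exec (.natSub e lo)
  let m ← foldLoop (momentStep n T.h i) c lo { s0 := 0, s1 := 0, s2 := 0, t0 := 0, t1 := 0 }
  if k = 0 then
    exec (.div m.t0 m.s0)
  else
    let p ← exec (.mul m.s2 m.t0)
    let q ← exec (.mul m.s1 m.t1)
    let num ← exec (.sub p q)
    let r ← exec (.mul m.s0 m.s2)
    let s ← exec (.mul m.s1 m.s1)
    let den ← exec (.sub r s)
    exec (.div num den)

/-- The critical value of the local test for the pair `(i, j)`. -/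
noncomputable def critProg (P : Params) (n : ℕ) (T : Tuning) (i j : ℕ) : Prog ℝ := do
  let nr ← exec (.ofNat n)
  let ir ← exec (.ofNat i)
  let jr ← exec (.ofNat j)
  let xi ← exec (.div ir nr)
  let xj ← exec (.div jr nr)
  let d ← exec (.sub xi xj)
  let ad ← exec (.abs d)
  let g ← exec (.mul (8 * P.L2 / P.lam0) ad)
  let m ← exec (.min g T.h)
  let c ← exec (.mul T.scale m)
  let r ← exec (.sub 1 T.h)
  let b1 ← exec (.le T.h xi)
  let b2 ← exec (.le xi r)
  let b3 ← exec (.le T.h xj)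
  let b4 ← exec (.le xj r)
  if b1 && b2 && b3 && b4 then return c
  else exec (.add c T.bias)

/-- The local test `Φ_{i,j}`. -/
noncomputable def localTestProg (P : Params) (n : ℕ) (T : Tuning) (i j : ℕ) : Prog Bool := do
  let fi ← lpeProg P.order n T i
  let fj ← lpeProg P.order n T j
  let t ← exec (.sub fi fj)
  let q ← critProg P n T i j
  exec (.le q t)

/-- Repeated search over dyadically growing ranges: `T.inner` times, for `0 ≤ k ≤ ⌈log₂ m⌉`, draw
`J ~ Unif({1, …, 2ᵏ ∧ m})` and run `test J`; stop at the first success. -/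
noncomputable def searchProg (T : Tuning) (m : ℕ) (test : ℕ → Prog Bool) : Prog Bool := do
  let mr ← exec (.ofNat m)
  let lm ← exec (.log mr)
  let l2 ← exec (.div lm (Real.log 2))
  let kmax ← exec (.ceil l2)
  let c ← exec (.natAdd kmax 1)
  anyLoop (fun _ => anyLoop (fun k => do
    let p ← exec (.pow2 k)
    let r ← exec (.natMin p m)
    let J ← exec (.unif r)
    test J) c 0) T.inner 0

/-- One pass of the outer loop: draw `I ~ Unif({1, …, n})`, search to the right of `I` and then to
the left of `I`. -/
noncomputable def roundProg (P : Params) (n : ℕ) (T : Tuning) : Prog Bool := do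
  let I ← exec (.unif n)
  let nm ← exec (.natSub n 1)
  let hasRight ← exec (.natLe I nm)
  let right ←
    if hasRight then do
      let m ← exec (.natSub n I)
      searchProg T m fun J => do
        let j ← exec (.natAdd I J)
        localTestProg P n T I j
    else return false
  if right then return true
  else do
    let hasLeft ← exec (.natLe 2 I)
    if hasLeft then do
      let m ← exec (.natSub I 1)
      searchProg T m fun J => do
        let i ← exec (.natSub I J)
        localTestProg P n T i I
    else return false

/-- FOMT with significance level `α` and sample size `n`; the output `true` means that a violation
of monotonicity has been detected. -/
noncomputable def fomt (P : Params) (α : ℝ) (n : ℕ) : Prog Bool := do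
  let T ← setupProg P α n
  anyLoop (fun _ => roundProg P n T) T.outer 0

/-! ## The regression model -/

/-- The law of `(Y_1, …, Y_n)`, where `Y_i = f(i/n) + ε_i` with independent `ε_i ~ N(0, σ²)`. -/
noncomputable def dataLaw (n : ℕ) (σ : ℝ) (f : ℝ → ℝ) : Measure (Finset.Icc 1 n → ℝ) :=
  Measure.pi fun i => gaussianReal (f ((i.1 : ℝ) / n)) (Real.toNNReal (σ ^ 2))

/-- The observation with index `i`. -/
def obs {n : ℕ} (y : Finset.Icc 1 n → ℝ) (i : ℕ) : ℝ :=
  if hi : i ∈ Finset.Icc 1 n then y ⟨i, hi⟩ else 0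

/-- Joint law of the output and of the number of steps of FOMT on the data `y`. -/
noncomputable def fomtLaw (P : Params) (α : ℝ) (n : ℕ) (y : Finset.Icc 1 n → ℝ) : PMF (Bool × ℕ) :=
  (fomt P α n).run P.K (obs y)

/-- The probability under `f`, over the data and the internal randomness of the algorithm, that FOMT
detects a violation and halts after at most `b` steps. -/
noncomputable def detectProb (P : Params) (α : ℝ) (n : ℕ) (f : ℝ → ℝ) (b : ℝ) : ℝ≥0∞ :=
  ∫⁻ y, (fomtLaw P α n y).toMeasure {r : Bool × ℕ | r.1 = true ∧ (r.2 : ℝ) ≤ b} ∂(dataLaw n P.σ f)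

/-! ## What the program computes

The deterministic parts of the program compute the quantities of the same name. -/

/-- On kernel `K` and data `y`, the program `p` halts with output `a`. -/
def Prog.Computes (K : ℝ → ℝ) (y : ℕ → ℝ) {ω : Type} (p : Prog ω) (a : ω) : Prop :=
  ∃ s : ℕ, p.run K y = PMF.pure (a, s)

theorem computes_pure {K : ℝ → ℝ} {y : ℕ → ℝ} {ω : Type} (a : ω) :
    (pure a : Prog ω).Computes K y a := ⟨0, rfl⟩

theorem computes_exec {K : ℝ → ℝ} {y : ℕ → ℝ} {τ : Type} {i : Instr τ} {a : τ}
    (hi : i.result K y = PMF.pure a) : (exec i).Computes K y a := by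
  refine ⟨1, ?_⟩
  simp [exec, Prog.run, hi, PMF.pure_bind, PMF.pure_map]

theorem run_bind (K : ℝ → ℝ) (y : ℕ → ℝ) {ω ω' : Type} (p : Prog ω) (q : ω → Prog ω') :
    (p >>= q).run K y =
      (p.run K y).bind fun r => ((q r.1).run K y).map fun s => (s.1, s.2 + r.2) := by
  change (Prog.bind p q).run K y = _
  induction p with
  | ret a => 
    simp only [Prog.bind, Prog.run, PMF.pure_bind]
    exact (PMF.map_id _).symm
  | step i k ih =>
    simp only [Prog.bind, Prog.run, PMF.bind_bind]
    congr 1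
    funext r
    rw [ih r]
    simp only [PMF.map_bind, PMF.bind_map, PMF.map_comp]
    congr 1

theorem computes_bind {K : ℝ → ℝ} {y : ℕ → ℝ} {ω ω' : Type} {p : Prog ω} {q : ω → Prog ω'} {a : ω}
    {b : ω'} (hp : p.Computes K y a) (hq : (q a).Computes K y b) : (p >>= q).Computes K y b := by
  obtain ⟨s, hs⟩ := hp
  obtain ⟨t, ht⟩ := hq
  exact ⟨t + s, by rw [run_bind, hs, PMF.pure_bind, ht, PMF.pure_map]⟩

theorem computes_foldLoop {K : ℝ → ℝ} {y : ℕ → ℝ} {ω : Type} {body : ℕ → ω → Prog ω}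
    {g : ℕ → ω → ω} (hb : ∀ k s, (body k s).Computes K y (g k s)) (c start : ℕ) (s : ω) :
    (foldLoop body c start s).Computes K y
      ((List.range' start c).foldl (fun s k => g k s) s) := by
  induction c generalizing start s with
  | zero =>
    exact computes_bind (computes_exec (a := ()) rfl) (computes_pure _)
  | succ c ih =>
    refine computes_bind (computes_exec (a := ()) rfl) (computes_bind (hb _ _) ?_)
    simpa [List.range'_succ] using ih (start + 1) (g start s)

theorem computes_setupProg (P : Params) (α : ℝ) (n : ℕ) (K : ℝ → ℝ) (y : ℕ → ℝ) :
    (setupProg P α n).Computes K y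
      { h := P.bandwidth n, halfWidth := ⌊(n : ℝ) * P.bandwidth n⌋₊, outer := ⌈P.numReps n α⌉₊,
        inner := ⌈20 * Real.log n⌉₊, scale := P.critScale n α,
        bias := P.biasConst * P.bandwidth n ^ P.β } := by
  unfold setupProg
  repeat refine computes_bind (computes_exec rfl) ?_
  exact computes_pure _

theorem computes_critProg (P : Params) (α : ℝ) (n : ℕ) (K : ℝ → ℝ) (y : ℕ → ℝ) (T : Tuning)
    (hh : T.h = P.bandwidth n) (hs : T.scale = P.critScale n α)
    (hb : T.bias = P.biasConst * P.bandwidth n ^ P.β) (i j : ℕ) :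
    (critProg P n T i j).Computes K y (P.critValue n α i j) := by
  unfold critProg
  repeat refine computes_bind (computes_exec rfl) ?_
  rw [hh, hs, hb]
  unfold Params.critValue Params.critNoise Params.critBias
  split_ifs with h1 h2 h2
  · simp only [add_zero]
    exact computes_pure _
  · exfalso
    apply h2
    simpa [Set.mem_Icc, and_assoc] using h1
  · exfalso
    apply h1
    simpa [Set.mem_Icc, and_assoc] using h2
  · exact computes_exec rfl

theorem computes_momentStep (K : ℝ → ℝ) (y : ℕ → ℝ) (n : ℕ) (h : ℝ) (i k : ℕ) (m : Moments) :
    (momentStep n h i k m).Computes K y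
      (let u := ((k : ℝ) / n - (i : ℝ) / n) / h
      { s0 := m.s0 + K u, s1 := m.s1 + K u * u, s2 := m.s2 + K u * u * u,
        t0 := m.t0 + K u * y k, t1 := m.t1 + K u * u * y k }) := by
  unfold momentStep
  repeat refine computes_bind (computes_exec rfl) ?_
  exact computes_pure _

theorem moments_foldl (K : ℝ → ℝ) (y : ℕ → ℝ) (u : ℕ → ℝ) (c start : ℕ) (m : Moments) :
    (List.range' start c).foldl (fun (m : Moments) k =>
      ({ s0 := m.s0 + K (u k), s1 := m.s1 + K (u k) * u k, s2 := m.s2 + K (u k) * u k * u k,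
         t0 := m.t0 + K (u k) * y k, t1 := m.t1 + K (u k) * u k * y k } : Moments)) m =
      { s0 := m.s0 + ∑ k ∈ Finset.Ico start (start + c), K (u k),
        s1 := m.s1 + ∑ k ∈ Finset.Ico start (start + c), K (u k) * u k,
        s2 := m.s2 + ∑ k ∈ Finset.Ico start (start + c), K (u k) * u k * u k,
        t0 := m.t0 + ∑ k ∈ Finset.Ico start (start + c), K (u k) * y k,
        t1 := m.t1 + ∑ k ∈ Finset.Ico start (start + c), K (u k) * u k * y k } := by
  induction c generalizing start m with
  | zero => simp
  | succ c ih =>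
    rw [List.range'_succ, List.foldl_cons, ih]
    have hlt : start < start + (c + 1) := by omega
    have e : start + 1 + c = start + (c + 1) := by omega
    simp only [Finset.sum_eq_sum_Ico_succ_bot hlt, e, add_assoc]

theorem sum_window {K : ℝ → ℝ} (hK : ∀ u, 1 < |u| → K u = 0) {n i : ℕ} {h : ℝ} (hn : 0 < n)
    (hh : 0 < h) (g : ℕ → ℝ) :
    ∑ k ∈ Finset.Ico (1 ⊔ (i - ⌊(n : ℝ) * h⌋₊)) ((1 ⊔ (i - ⌊(n : ℝ) * h⌋₊)) +
        ((n ⊓ (i + ⌊(n : ℝ) * h⌋₊)) + 1 - (1 ⊔ (i - ⌊(n : ℝ) * h⌋₊)))),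
      K (((k : ℝ) / n - (i : ℝ) / n) / h) * g k =
    ∑ k ∈ Finset.Icc 1 n, K (((k : ℝ) / n - (i : ℝ) / n) / h) * g k := by
  apply Finset.sum_subset
  · intro k hk
    simp only [Finset.mem_Ico, Finset.mem_Icc] at hk ⊢
    omega
  · intro k hk hk'
    simp only [Finset.mem_Ico, Finset.mem_Icc] at hk hk'
    have hn' : (0 : ℝ) < n := by exact_mod_cast hn
    rw [hK, zero_mul]
    have hout : ⌊(n : ℝ) * h⌋₊ + i < k ∨ k + ⌊(n : ℝ) * h⌋₊ < i := by omega
    have hfl := Nat.lt_floor_add_one ((n : ℝ) * h)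
    have hd : (n : ℝ) * h < |(k : ℝ) - i| := by
      rcases hout with h1 | h1
      · have : ((⌊(n : ℝ) * h⌋₊ : ℝ)) + i + 1 ≤ k := by exact_mod_cast h1
        exact lt_of_lt_of_le (by linarith) (le_abs_self _)
      · have : (k : ℝ) + ⌊(n : ℝ) * h⌋₊ + 1 ≤ i := by exact_mod_cast h1
        exact lt_of_lt_of_le (by linarith) (neg_le_abs _)
    rw [← sub_div, div_div, abs_div, abs_of_pos (mul_pos hn' hh), lt_div_iff₀ (mul_pos hn' hh)]
    linarith

theorem lpe_zero (K : ℝ → ℝ) (n : ℕ) (h x : ℝ) (y : ℕ → ℝ) (hn : (n : ℝ) * h ≠ 0) :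
    lpe K 0 n h y x =
      (∑ i ∈ Finset.Icc 1 n, K (((i : ℝ) / n - x) / h) * y i) /
        ∑ i ∈ Finset.Icc 1 n, K (((i : ℝ) / n - x) / h) := by
  simp only [lpe, gram, momentVec, Matrix.inv_def, Matrix.mulVec, dotProduct]
  simp [Matrix.sum_apply, Matrix.vecMulVec_apply, basisVec]
  field_simp
  rw [mul_div_mul_left _ _ hn]

theorem lpe_one (K : ℝ → ℝ) (n : ℕ) (h x : ℝ) (y : ℕ → ℝ) (hn : (n : ℝ) * h ≠ 0) :
    let u : ℕ → ℝ := fun i => ((i : ℝ) / n - x) / h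
    let s0 := ∑ i ∈ Finset.Icc 1 n, K (u i)
    let s1 := ∑ i ∈ Finset.Icc 1 n, K (u i) * u i
    let s2 := ∑ i ∈ Finset.Icc 1 n, K (u i) * u i * u i
    let t0 := ∑ i ∈ Finset.Icc 1 n, K (u i) * y i
    let t1 := ∑ i ∈ Finset.Icc 1 n, K (u i) * u i * y i
    lpe K 1 n h y x = (s2 * t0 - s1 * t1) / (s0 * s2 - s1 * s1) := by
  intro u s0 s1 s2 t0 t1
  set c : ℝ := 1 / ((n : ℝ) * h) with hc
  have hc0 : c ≠ 0 := one_div_ne_zero hn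
  have hG : gram K 1 n h x = !![c * s0, c * s1; c * s1, c * s2] := by
    ext a b
    fin_cases a <;> fin_cases b <;>
      simp [gram, Matrix.sum_apply, Matrix.vecMulVec_apply, basisVec, s0, s1, s2, u, c, mul_assoc]
  have hm : momentVec K 1 n h y x = ![c * t0, c * t1] := by
    ext a
    fin_cases a <;> simp [momentVec, basisVec, t0, t1, u, c, Finset.sum_apply]
    left
    exact Finset.sum_congr rfl fun _ _ => by ring
  have hb : basisVec 1 0 = ![1, 0] := by
    ext a
    fin_cases a <;> simp [basisVec]
  rw [lpe, hG, hm, hb, Matrix.inv_def, Matrix.adjugate_fin_two_of, Matrix.det_fin_two_of]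
  simp only [Ring.inverse_eq_inv', Matrix.smul_mulVec]
  simp [dotProduct, Fin.sum_univ_two]
  have : c * s0 * (c * s2) - c * s1 * (c * s1) = c ^ 2 * (s0 * s2 - s1 * s1) := by ring
  rw [this, mul_inv, div_eq_mul_inv]
  field_simp
  ring

theorem computes_lpeProg {K : ℝ → ℝ} (hK : ∀ u, 1 < |u| → K u = 0) (y : ℕ → ℝ) {k n i : ℕ}
    (T : Tuning) (hk : k = 0 ∨ k = 1) (hn : 0 < n) (hh : 0 < T.h)
    (hw : T.halfWidth = ⌊(n : ℝ) * T.h⌋₊) :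
    (lpeProg k n T i).Computes K y (lpe K k n T.h y ((i : ℝ) / n)) := by
  have hnh : (n : ℝ) * T.h ≠ 0 := (mul_pos (by exact_mod_cast hn) hh).ne'
  unfold lpeProg
  iterate 6 refine computes_bind (computes_exec rfl) ?_
  refine computes_bind (computes_foldLoop (computes_momentStep K y n T.h i) _ _ _) ?_
  dsimp only
  rw [moments_foldl K y (fun k => ((k : ℝ) / n - (i : ℝ) / n) / T.h), hw]
  have h0 := sum_window (i := i) hK hn hh (fun _ => 1)
  have h1 := sum_window (i := i) hK hn hh (fun k => ((k : ℝ) / n - (i : ℝ) / n) / T.h)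
  have h2 := sum_window (i := i) hK hn hh
    (fun k => ((k : ℝ) / n - (i : ℝ) / n) / T.h * (((k : ℝ) / n - (i : ℝ) / n) / T.h))
  have h3 := sum_window (i := i) hK hn hh y
  have h4 := sum_window (i := i) hK hn hh (fun k => ((k : ℝ) / n - (i : ℝ) / n) / T.h * y k)
  simp only [mul_one, ← mul_assoc] at h0 h1 h2 h3 h4
  simp only [zero_add]
  rw [h0, h1, h2, h3, h4]
  rcases hk with rfl | rfl
  · rw [lpe_zero K n T.h _ y hnh]
    exact computes_exec rfl
  · rw [lpe_one K n T.h _ y hnh]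
    simp only [one_ne_zero, if_false]
    iterate 6 refine computes_bind (computes_exec rfl) ?_
    exact computes_exec rfl

open Classical in
theorem computes_localTestProg (P : Params) (hK : ∀ u, 1 < |u| → P.K u = 0) (hβ2 : P.β ≤ 2)
    (α : ℝ) {n i j : ℕ} (y : ℕ → ℝ) (hn : 0 < n) (hh : 0 < P.bandwidth n) :
    (localTestProg P n
      { h := P.bandwidth n, halfWidth := ⌊(n : ℝ) * P.bandwidth n⌋₊, outer := ⌈P.numReps n α⌉₊,
        inner := ⌈20 * Real.log n⌉₊, scale := P.critScale n α,
        bias := P.biasConst * P.bandwidth n ^ P.β } i j).Computes P.K y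
      (decide (P.Rejects n α y i j)) := by
  have hk : P.order = 0 ∨ P.order = 1 := by
    have : ⌈P.β⌉₊ ≤ 2 := Nat.ceil_le.2 (by exact_mod_cast hβ2)
    unfold Params.order
    omega
  unfold localTestProg
  refine computes_bind (computes_lpeProg hK y _ hk hn hh rfl) ?_
  refine computes_bind (computes_lpeProg hK y _ hk hn hh rfl) ?_
  refine computes_bind (computes_exec rfl) ?_
  refine computes_bind (computes_critProg P α n P.K y _ rfl rfl rfl i j) ?_
  exact computes_exec rfl

/-- If `B_{nx}` is positive definite and `h > 0`, then `B_{nx}⁻¹ a_{nx}` is the unique minimiser of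
the weighted least squares criterion. -/
theorem lpe_isMinimizer (K : ℝ → ℝ) (k n : ℕ) (h x : ℝ) (y : ℕ → ℝ) (hn : 0 < n) (hh : 0 < h)
    (hB : (gram K k n h x).PosDef) (θ : Fin (k + 1) → ℝ)
    (hθ : θ ≠ (gram K k n h x)⁻¹.mulVec (momentVec K k n h y x)) :
    ∑ i ∈ Finset.Icc 1 n,
        (y i - ((gram K k n h x)⁻¹.mulVec (momentVec K k n h y x)) ⬝ᵥ
          basisVec k (((i : ℝ) / n - x) / h)) ^ 2 * K (((i : ℝ) / n - x) / h) <
      ∑ i ∈ Finset.Icc 1 n,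
        (y i - θ ⬝ᵥ basisVec k (((i : ℝ) / n - x) / h)) ^ 2 * K (((i : ℝ) / n - x) / h) := by
  set B := gram K k n h x with hBdef
  set a := momentVec K k n h y x with ha
  set θ₀ := B⁻¹.mulVec a with hθ₀
  set c : ℝ := (n : ℝ) * h with hc
  have hcpos : 0 < c := mul_pos (by exact_mod_cast hn) hh
  have hBθ : B.mulVec θ₀ = a := by
    rw [hθ₀, Matrix.mulVec_mulVec,
      Matrix.mul_nonsing_inv _ ((Matrix.isUnit_iff_isUnit_det _).1 hB.isUnit), Matrix.one_mulVec]
  have key : ∀ t : Fin (k + 1) → ℝ,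
      ∑ i ∈ Finset.Icc 1 n,
        (y i - t ⬝ᵥ basisVec k (((i : ℝ) / n - x) / h)) ^ 2 * K (((i : ℝ) / n - x) / h) =
      ∑ i ∈ Finset.Icc 1 n, y i ^ 2 * K (((i : ℝ) / n - x) / h) - 2 * c * (t ⬝ᵥ a) +
        c * (t ⬝ᵥ B.mulVec t) := by
    intro t
    have e1 : c * (t ⬝ᵥ a) = ∑ i ∈ Finset.Icc 1 n,
        K (((i : ℝ) / n - x) / h) * y i * (t ⬝ᵥ basisVec k (((i : ℝ) / n - x) / h)) := by
      rw [ha, momentVec, dotProduct_smul, dotProduct_sum, smul_eq_mul, ← mul_assoc,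
        mul_one_div_cancel hcpos.ne', one_mul]
      simp only [dotProduct_smul, smul_eq_mul]
    have e2 : c * (t ⬝ᵥ B.mulVec t) = ∑ i ∈ Finset.Icc 1 n,
        K (((i : ℝ) / n - x) / h) * (t ⬝ᵥ basisVec k (((i : ℝ) / n - x) / h)) ^ 2 := by
      rw [hBdef, gram, Matrix.smul_mulVec, dotProduct_smul, Matrix.sum_mulVec, dotProduct_sum,
        smul_eq_mul, ← mul_assoc, mul_one_div_cancel hcpos.ne', one_mul]
      refine Finset.sum_congr rfl fun i _ => ?_
      rw [Matrix.smul_mulVec, dotProduct_smul, Matrix.vecMulVec_mulVec, smul_eq_mul]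
      simp [dotProduct_comm t, pow_two]
    rw [mul_assoc, e1, e2, Finset.mul_sum, ← Finset.sum_sub_distrib, ← Finset.sum_add_distrib]
    exact Finset.sum_congr rfl fun i _ => by ring
  rw [key, key]
  have hpos : 0 < (θ - θ₀) ⬝ᵥ B.mulVec (θ - θ₀) := by
    simpa using hB.dotProduct_mulVec_pos (sub_ne_zero.2 hθ)
  have hsymm : θ₀ ⬝ᵥ B.mulVec θ = θ ⬝ᵥ a := by
    have hT : B.transpose = B := by simpa using hB.isHermitian.eq
    rw [Matrix.dotProduct_mulVec, ← Matrix.mulVec_transpose, hT, hBθ, dotProduct_comm]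
  rw [Matrix.mulVec_sub, hBθ, dotProduct_sub, sub_dotProduct, sub_dotProduct, hsymm] at hpos
  rw [hBθ]
  nlinarith

end FOMT

/-!
FOMT detects a violation of monotonicity because of three facts.

*Many design points are good.* Fix data whose noise is not exceptionally large. A local test then
rejects whenever the regression function drops by the detectable amount between its two design
points, and a design point is called good (`IsGood`) if one of the dyadic ranges searched around it
contains a quarter of rejecting partners. The proportion of good design points is at least a
constant times the exceedance fraction `ε`:

* For `β ≤ 1`, a drop from `i` to `j` of twice the detectable size splits at every index `k` in
  between into two drops, one of which is detectable. Hence `i` or `j` forms rejecting pairs with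
  half of the indices between them (`isHeavy_or_isHeavy`). The good points and the index `n`, which
  is never counted as good, thus meet every large drop; off their cells, `f` is within `γ_n` of its
  running maximum shifted by `γ_n`, and so `ε` is at most the proportion of these points
  (`exceedanceZero_le_of_hitting`).
* For `β > 1`, symmetry of the kernel makes the local linear estimator at interior design points a
  weighted mean with weights that do not depend on the point. The statistic for two neighbouring
  design points is then a mean of increments of `f`, without bias, and rejects next to every
  interior point where `f' ≤ -γ_n` (`rejects_of_slope`). The set of these points contains an
  interval of length `6 h_n`, so that most of it is away from the boundary.

*The noise is small.* The noise of the relevant statistics is a linear combination of independent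
Gaussian variables. By the choice of `W` and `C_h`, the sub-Gaussian tail bound gives a probability
of at most `n⁻²` for each of at most `2 n` exceptional events (`noise_le`, `diffNoise_le`).

*The rounds are independent given the data.* A search around a good point fails with probability at
most `(3/4) ^ (20 log n)`, so a round succeeds with probability at least `ε / 2`, and
`⌈2 log (2 / α) / ε⌉` rounds all fail with probability at most `α / 2` (`fomt_fail_le`,
`detectProb_ge`). As `ε ≥ h_n` on the alternative, this is at most the number of rounds that FOMT
performs. Every round takes `O(n h_n log² n)` steps (`exists_roundCost_le`), which yields both the
worst case and the detection bound.

The eigenvalue bound `λ₀` exists because on one side of `x` there are order `n h` pairs of design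
points in the window at distance of order `h`, and a polynomial of degree one is controlled by its
values at two distant points (`basisVec_two_points`).
-/

namespace FOMT

/-! ### Cost bounds for programs -/

/-- Every possible run of `p` on kernel `K` and data `y` ends with an output satisfying `Q`, after at
most `b` steps. -/
def Prog.Ensures (K : ℝ → ℝ) (y : ℕ → ℝ) {ω : Type} (p : Prog ω) (Q : ω → Prop) (b : ℕ) : Prop :=
  ∀ r ∈ (p.run K y).support, Q r.1 ∧ r.2 ≤ b

section Ensures

variable {K : ℝ → ℝ} {y : ℕ → ℝ} {ω ω' τ : Type}

theorem Prog.Ensures.mono {p : Prog ω} {Q R : ω → Prop} {a b : ℕ} (h : p.Ensures K y Q a)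
    (hQ : ∀ x, Q x → R x) (hab : a ≤ b) : p.Ensures K y R b :=
  fun r hr => ⟨hQ _ (h r hr).1, (h r hr).2.trans hab⟩

theorem ensures_pure {a : ω} {Q : ω → Prop} {b : ℕ} (h : Q a) :
    (pure a : Prog ω).Ensures K y Q b := by
  intro r hr
  change r ∈ (PMF.pure (a, 0)).support at hr
  rw [PMF.support_pure, Set.mem_singleton_iff] at hr
  subst hr
  exact ⟨h, Nat.zero_le _⟩

theorem ensures_exec {i : Instr τ} {Q : τ → Prop} (h : ∀ a ∈ (i.result K y).support, Q a) :
    (exec i).Ensures K y Q 1 := by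
  intro r hr
  simp only [exec, Prog.run, PMF.pure_map, zero_add, PMF.mem_support_bind_iff, PMF.support_pure,
    Set.mem_singleton_iff] at hr
  obtain ⟨a, ha, rfl⟩ := hr
  exact ⟨h a ha, le_rfl⟩

theorem ensures_exec_true (i : Instr τ) : (exec i).Ensures K y (fun _ => True) 1 :=
  ensures_exec fun _ _ => trivial

theorem ensures_bind {p : Prog ω} {q : ω → Prog ω'} {Q : ω → Prop} {R : ω' → Prop} {a b : ℕ}
    (hp : p.Ensures K y Q a) (hq : ∀ x, Q x → (q x).Ensures K y R b) :
    (p >>= q).Ensures K y R (b + a) := by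
  intro r hr
  rw [run_bind, PMF.mem_support_bind_iff] at hr
  obtain ⟨s, hs, hr⟩ := hr
  rw [PMF.mem_support_map_iff] at hr
  obtain ⟨t, ht, rfl⟩ := hr
  exact ⟨(hq _ (hp s hs).1 t ht).1, add_le_add (hq _ (hp s hs).1 t ht).2 (hp s hs).2⟩

/-- An instruction whose result is deterministic. -/
theorem ensures_step {i : Instr τ} {a : τ} (hi : i.result K y = PMF.pure a) {q : τ → Prog ω}
    {R : ω → Prop} {b : ℕ} (hq : (q a).Ensures K y R b) :
    (exec i >>= q).Ensures K y R (b + 1) :=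
  ensures_bind (ensures_exec (Q := fun x => x = a) (by rw [hi]; simp)) (by rintro x rfl; exact hq)

theorem ensures_foldLoop {body : ℕ → ω → Prog ω} {B : ℕ}
    (hb : ∀ k s, (body k s).Ensures K y (fun _ => True) B) (c start : ℕ) (s : ω) :
    (foldLoop body c start s).Ensures K y (fun _ => True) (c * (B + 1) + 1) := by
  induction c generalizing start s with
  | zero => exact ensures_bind (ensures_exec_true _) fun _ _ => ensures_pure trivial
  | succ c ih =>
    refine (ensures_bind (ensures_exec_true _) fun _ _ => ensures_bind (hb _ _)
      fun s' _ => ih (start + 1) s').mono (fun _ h => h) ?_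
    rw [Nat.succ_mul]; omega

theorem ensures_anyLoop {body : ℕ → Prog Bool} {B : ℕ}
    (hb : ∀ k, (body k).Ensures K y (fun _ => True) B) (c start : ℕ) :
    (anyLoop body c start).Ensures K y (fun _ => True) (c * (B + 1) + 1) := by
  induction c generalizing start with
  | zero => exact ensures_bind (ensures_exec_true _) fun _ _ => ensures_pure trivial
  | succ c ih =>
    refine (ensures_bind (ensures_exec_true _) fun _ _ => ensures_bind (b := c * (B + 1) + 1)
      (hb _) fun s' _ => ?_).mono (fun _ h => h) (b := (c + 1) * (B + 1) + 1) ?_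
    · cases s'
      · exact ih (start + 1)
      · exact ensures_pure trivial
    · rw [Nat.succ_mul]; omega

theorem ensures_momentStep (n : ℕ) (h : ℝ) (i k : ℕ) (m : Moments) :
    (momentStep n h i k m).Ensures K y (fun _ => True) 18 := by
  unfold momentStep
  repeat refine ensures_step rfl ?_
  exact ensures_pure trivial

theorem ensures_lpeProg (k n : ℕ) (T : Tuning) (i : ℕ) :
    (lpeProg k n T i).Ensures K y (fun _ => True) (38 * T.halfWidth + 33) := by
  unfold lpeProg
  have key : ∀ (c lo : ℕ) (q : Moments → Prog ℝ), c ≤ 2 * T.halfWidth + 1 →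
      (∀ m : Moments, (q m).Ensures K y (fun _ => True) 7) →
      (foldLoop (momentStep n T.h i) c lo { s0 := 0, s1 := 0, s2 := 0, t0 := 0, t1 := 0 } >>=
        q).Ensures K y (fun _ => True) (38 * T.halfWidth + 27) := by
    intro c lo q hc hq
    refine (ensures_bind (ensures_foldLoop (ensures_momentStep n T.h i) _ _ _)
      fun m _ => hq m).mono (fun _ h => h) ?_
    omega
  iterate 6 refine ensures_step rfl ?_
  refine key _ _ _ (by omega) fun m => ?_
  split_ifs
  · exact (ensures_exec_true _).mono (fun _ h => h) (by norm_num)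
  · iterate 6 refine ensures_step rfl ?_
    exact ensures_exec_true _

theorem ensures_critProg (P : Params) (n : ℕ) (T : Tuning) (i j : ℕ) :
    (critProg P n T i j).Ensures K y (fun _ => True) 16 := by
  unfold critProg
  iterate 15 refine ensures_step rfl ?_
  split_ifs
  · exact ensures_pure trivial
  · exact ensures_exec_true _

/-- A bound for the number of steps of a local test with half window `w`. -/
def testCost (w : ℕ) : ℕ := 76 * w + 84

theorem ensures_localTestProg (P : Params) (n : ℕ) (T : Tuning) (i j : ℕ) :
    (localTestProg P n T i j).Ensures K y (fun _ => True) (testCost T.halfWidth) := by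
  unfold localTestProg
  refine (ensures_bind (ensures_lpeProg _ _ _ _) fun _ _ => ensures_bind (ensures_lpeProg _ _ _ _)
    fun _ _ => ensures_step rfl <| ensures_bind (ensures_critProg P n T i j)
    fun _ _ => ensures_exec_true _).mono (fun _ h => h) ?_
  unfold testCost; omega

/-- A bound for the number of steps of the search around one design point. -/
noncomputable def searchCost (n inner w : ℕ) : ℕ :=
  inner * ((⌈Real.log n / Real.log 2⌉₊ + 1) * (testCost w + 5) + 2) + 6

theorem ensures_searchProg (T : Tuning) {m n : ℕ} (hm : m ≤ n) {test : ℕ → Prog Bool}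
    (ht : ∀ J, (test J).Ensures K y (fun _ => True) (testCost T.halfWidth + 1)) :
    (searchProg T m test).Ensures K y (fun _ => True) (searchCost n T.inner T.halfWidth) := by
  unfold searchProg searchCost
  iterate 5 refine ensures_step rfl ?_
  refine (ensures_anyLoop (fun _ => ensures_anyLoop (B := testCost T.halfWidth + 4) (fun k => ?_)
    _ _) _ _).mono (fun _ h => h) ?_
  · refine ensures_step rfl (ensures_step rfl (ensures_bind (a := 1) (ensures_exec_true _) fun _ _ => ht _))
  · have : ⌈Real.log m / Real.log 2⌉₊ ≤ ⌈Real.log n / Real.log 2⌉₊ := by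
      apply Nat.ceil_le_ceil
      rcases Nat.eq_zero_or_pos m with rfl | h0
      · simpa using div_nonneg (Real.log_natCast_nonneg n) (Real.log_nonneg one_le_two)
      · gcongr
    have := Nat.mul_le_mul_left T.inner (Nat.add_le_add_right
      (Nat.mul_le_mul_right (testCost T.halfWidth + 5) (Nat.add_le_add_right this 1)) 2)
    simpa [add_assoc] using this

theorem ensures_roundProg (P : Params) (n : ℕ) (T : Tuning) :
    (roundProg P n T).Ensures K y (fun _ => True)
      (2 * searchCost n T.inner T.halfWidth + 6) := by
  unfold roundProg
  refine (ensures_bind (Q := fun I => I ≤ n) (a := 1)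
    (b := 2 * searchCost n T.inner T.halfWidth + 5) (ensures_exec ?_) fun I hI => ensures_step rfl <|
    ensures_step rfl ?_)
  · intro a ha
    simp only [Instr.result] at ha
    split_ifs at ha with hne
    · simp at ha; exact ha.2
    · simp at ha; omega
  split_ifs
  swap
  · exact ensures_pure trivial
  refine ensures_step rfl ((ensures_bind (Q := fun _ => True) (ensures_searchProg T (Nat.sub_le n I)
    fun J => ensures_step rfl (ensures_localTestProg P n T _ _)) fun b _ =>
    (?_ : Prog.Ensures K y _ _ (searchCost n T.inner T.halfWidth + 2))).mono (fun _ h => h)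
    (by omega))
  split_ifs
  · exact ensures_pure trivial
  refine ensures_step rfl ?_
  split_ifs
  · exact ensures_step rfl (ensures_searchProg T (by omega) fun J =>
      ensures_step rfl (ensures_localTestProg P n T _ _))
  · exact ensures_pure trivial

theorem ensures_fomt (P : Params) (α : ℝ) (n : ℕ) :
    (fomt P α n).Ensures K y (fun _ => True)
      (⌈P.numReps n α⌉₊ * (2 * searchCost n ⌈20 * Real.log n⌉₊ ⌊(n : ℝ) * P.bandwidth n⌋₊ + 7)
        + 27) := by
  unfold fomt setupProg
  iterate 26 refine ensures_step rfl ?_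
  exact ensures_anyLoop (fun _ => ensures_roundProg P n _) _ _

end Ensures

/-! ### Detection probabilities of programs -/

/-- The probability that the program `p` outputs `false`. -/
noncomputable def Prog.failProb (K : ℝ → ℝ) (y : ℕ → ℝ) (p : Prog Bool) : ℝ≥0∞ :=
  (p.run K y).toOuterMeasure {r | r.1 = false}

section FailProb

variable {K : ℝ → ℝ} {y : ℕ → ℝ} {ω τ : Type}

theorem _root_.PMF.toOuterMeasure_apply_le_one {α : Type*} (p : PMF α) (s : Set α) :
    p.toOuterMeasure s ≤ 1 := by
  rw [← (PMF.toOuterMeasure_apply_eq_one_iff p (s := Set.univ)).2 (Set.subset_univ _)]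
  exact p.toOuterMeasure.mono (Set.subset_univ _)

theorem failProb_le_one (p : Prog Bool) : p.failProb K y ≤ 1 :=
  PMF.toOuterMeasure_apply_le_one _ _

theorem failProb_bind (p : Prog ω) (q : ω → Prog Bool) :
    (p >>= q).failProb K y = ∑' r, p.run K y r * (q r.1).failProb K y := by
  rw [Prog.failProb, run_bind, PMF.toOuterMeasure_bind_apply]
  refine tsum_congr fun r => ?_
  rw [PMF.toOuterMeasure_map_apply]
  rfl

theorem failProb_pure (b : Bool) : (pure b : Prog Bool).failProb K y = if b then 0 else 1 := by
  rw [Prog.failProb]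
  change (PMF.pure (b, 0)).toOuterMeasure _ = _
  rw [PMF.toOuterMeasure_pure_apply]
  cases b <;> simp

theorem failProb_computes_bind {p : Prog ω} {a : ω} (hp : p.Computes K y a) (q : ω → Prog Bool) :
    (p >>= q).failProb K y = (q a).failProb K y := by
  obtain ⟨s, hs⟩ := hp
  rw [failProb_bind, hs, tsum_eq_single (a, s)]
  · simp
  · intro b hb
    simp [PMF.pure_apply, hb]

theorem failProb_exec_bind {i : Instr τ} {a : τ} (hi : i.result K y = PMF.pure a)
    (q : τ → Prog Bool) : (exec i >>= q).failProb K y = (q a).failProb K y :=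
  failProb_computes_bind (computes_exec hi) q

theorem Prog.Computes.failProb {p : Prog Bool} {b : Bool} (hp : p.Computes K y b) :
    p.failProb K y = if b then 0 else 1 := by
  obtain ⟨s, hs⟩ := hp
  rw [Prog.failProb, hs, PMF.toOuterMeasure_pure_apply]
  cases b <;> simp

theorem failProb_orElse (p q : Prog Bool) :
    (p >>= fun b => if b = true then pure true else q).failProb K y =
      p.failProb K y * q.failProb K y := by
  rw [failProb_bind, Prog.failProb, PMF.toOuterMeasure_apply, ← ENNReal.tsum_mul_right]
  refine tsum_congr fun r => ?_
  rcases r with ⟨_ | _, s⟩ <;> simp [failProb_pure]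

theorem failProb_unif_bind {m : ℕ} (hm : 1 ≤ m) (q : ℕ → Prog Bool) :
    (exec (.unif m) >>= q).failProb K y =
      ∑ J ∈ Finset.Icc 1 m, (m : ℝ≥0∞)⁻¹ * (q J).failProb K y := by
  have hne : (Finset.Icc 1 m).Nonempty := ⟨1, by simp [hm]⟩
  have hrun : ((exec (.unif m)).run K y) =
      (PMF.uniformOfFinset (Finset.Icc 1 m) hne).map fun a => (a, 1) := by
    simp only [exec, Prog.run, Instr.result, dif_pos hne, PMF.pure_map, zero_add]
    rfl
  rw [Prog.failProb, run_bind, hrun, PMF.bind_map, PMF.toOuterMeasure_bind_apply,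
    tsum_eq_sum (s := Finset.Icc 1 m)]
  · refine Finset.sum_congr rfl fun J hJ => ?_
    rw [PMF.uniformOfFinset_apply_of_mem _ hJ, Nat.card_Icc, Nat.add_sub_cancel,
      Function.comp_apply, PMF.toOuterMeasure_map_apply]
    rfl
  · intro J hJ
    rw [PMF.uniformOfFinset_apply_of_notMem _ hJ, zero_mul]

/-- If a proportion of at least `p` of the draws makes the continuation fail with probability at
most `c`, then the total failure probability is at most `1 - p + p c`. -/
theorem failProb_unif_bind_le {m : ℕ} (hm : 1 ≤ m) (q : ℕ → Prog Bool) (S : Finset ℕ)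
    (hS : S ⊆ Finset.Icc 1 m) {c : ℝ} (hc : 0 ≤ c)
    (h : ∀ J ∈ S, (q J).failProb K y ≤ ENNReal.ofReal c) :
    (exec (.unif m) >>= q).failProb K y ≤ ENNReal.ofReal (1 - (S.card : ℝ) / m * (1 - c)) := by
  have hm0 : (0 : ℝ) < m := by exact_mod_cast hm
  have hcard : S.card ≤ m := by simpa using Finset.card_le_card hS
  rw [failProb_unif_bind hm, ← Finset.mul_sum, ← Finset.sum_sdiff hS]
  have h1 : ∑ J ∈ Finset.Icc 1 m \ S, (q J).failProb K y ≤ ((m - S.card : ℕ) : ℝ≥0∞) := by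
    refine (Finset.sum_le_card_nsmul _ _ 1 fun J _ => failProb_le_one _).trans ?_
    rw [Finset.card_sdiff_of_subset hS]
    simp
  have h2 : ∑ J ∈ S, (q J).failProb K y ≤ ENNReal.ofReal (S.card * c) := by
    refine (Finset.sum_le_card_nsmul _ _ _ h).trans ?_
    rw [nsmul_eq_mul, ENNReal.ofReal_mul (by positivity), ENNReal.ofReal_natCast]
  calc _ ≤ (m : ℝ≥0∞)⁻¹ * (((m - S.card : ℕ) : ℝ≥0∞) + ENNReal.ofReal (S.card * c)) := by gcongr
    _ = ENNReal.ofReal ((m : ℝ)⁻¹ * ((m - S.card : ℕ) + S.card * c)) := by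
        rw [ENNReal.ofReal_mul (p := (m : ℝ)⁻¹) (by positivity), ENNReal.ofReal_add (by positivity) (by positivity),
          ENNReal.ofReal_inv_of_pos hm0, ENNReal.ofReal_natCast, ENNReal.ofReal_natCast]
    _ = _ := by
        congr 1
        rw [Nat.cast_sub hcard]
        field_simp
        ring

theorem failProb_anyLoop_succ (body : ℕ → Prog Bool) (c start : ℕ) :
    (anyLoop body (c + 1) start).failProb K y =
      (body start).failProb K y * (anyLoop body c (start + 1)).failProb K y := by
  rw [anyLoop, failProb_exec_bind (a := ()) rfl, failProb_orElse]

theorem failProb_anyLoop_le_pow {body : ℕ → Prog Bool} {q : ℝ≥0∞}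
    (h : ∀ k, (body k).failProb K y ≤ q) (c start : ℕ) :
    (anyLoop body c start).failProb K y ≤ q ^ c := by
  induction c generalizing start with
  | zero => simpa using failProb_le_one _
  | succ c ih =>
    rw [failProb_anyLoop_succ, pow_succ']
    exact mul_le_mul' (h _) (ih _)

theorem failProb_anyLoop_le {body : ℕ → Prog Bool} {q : ℝ≥0∞} {c start k : ℕ} (hk : start ≤ k)
    (hk' : k < start + c) (h : (body k).failProb K y ≤ q) :
    (anyLoop body c start).failProb K y ≤ q := by
  induction c generalizing start with
  | zero => omega
  | succ c ih =>
    rw [failProb_anyLoop_succ]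
    rcases hk.eq_or_lt with rfl | hlt
    · exact (mul_le_mul' h (failProb_le_one _)).trans_eq (mul_one q)
    · exact (mul_le_mul' (failProb_le_one _) (ih hlt (by omega))).trans_eq (one_mul q)

/-- Within the first `m` passes of a loop whose passes take at most `B` steps and fail with
probability at most `q`, a success occurs with probability at least `1 - q ^ m`. -/
theorem anyLoop_budget {body : ℕ → Prog Bool} {q : ℝ≥0∞} {B : ℕ}
    (hB : ∀ k, (body k).Ensures K y (fun _ => True) B)
    (h : ∀ k, (body k).failProb K y ≤ q) {m c : ℕ} (hmc : m ≤ c) (start : ℕ) :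
    ((anyLoop body c start).run K y).toOuterMeasure
      {r | ¬ (r.1 = true ∧ r.2 ≤ m * (B + 1))} ≤ q ^ m := by
  induction m generalizing c start with
  | zero => simpa using PMF.toOuterMeasure_apply_le_one _ _
  | succ m ih =>
    obtain ⟨c, rfl⟩ : ∃ c', c = c' + 1 := ⟨c - 1, by omega⟩
    have hloop : (exec .loop).run K y = PMF.pure ((), 1) := by
      simp [exec, Prog.run, Instr.result, PMF.pure_map, PMF.pure_bind]
    rw [anyLoop, run_bind, hloop, PMF.pure_bind, PMF.toOuterMeasure_map_apply, run_bind,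
      PMF.toOuterMeasure_bind_apply]
    calc _ ≤ ∑' r : Bool × ℕ, Set.indicator {r | r.1 = false} ((body start).run K y) r * q ^ m := by
          refine ENNReal.tsum_le_tsum fun r => ?_
          by_cases hr : r ∈ ((body start).run K y).support
          swap
          · rw [(PMF.apply_eq_zero_iff _ _).2 hr, zero_mul]; exact zero_le
          have hr2 := (hB start r hr).2
          rcases r with ⟨_ | _, s⟩
          · simp only [Set.mem_ofPred_eq, Set.indicator_of_mem]
            refine mul_le_mul_right ?_ _
            rw [PMF.toOuterMeasure_map_apply]
            refine le_trans (OuterMeasure.mono _ ?_) (ih (by omega : m ≤ c) (start + 1))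
            rintro ⟨b, t⟩ hbt
            simp only [Set.mem_preimage, Set.mem_ofPred_eq] at hbt ⊢
            intro hb
            refine hbt ⟨hb.1, ?_⟩
            have := hb.2
            have hs : s ≤ B := hr2
            rw [Nat.succ_mul]
            simp
            omega
          · rw [PMF.toOuterMeasure_map_apply]
            have : ((pure true : Prog Bool).run K y) = PMF.pure (true, 0) := rfl
            simp only [if_true, this]
            rw [PMF.toOuterMeasure_pure_apply, if_neg, mul_zero]
            · exact zero_le
            · simp only [Set.mem_preimage, Set.mem_ofPred_eq, not_not, true_and]
              have hs : s ≤ B := hr2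
              rw [Nat.succ_mul]
              omega
    _ = (body start).failProb K y * q ^ m := by
          rw [ENNReal.tsum_mul_right, Prog.failProb, PMF.toOuterMeasure_apply]
    _ ≤ q ^ (m + 1) := by
          rw [pow_succ']
          exact mul_le_mul_left (h _) _

end FailProb

/-! ### Detection probability of one round and of FOMT -/

/-- The tuning quantities computed at the beginning of FOMT. -/
noncomputable def Params.tuning (P : Params) (α : ℝ) (n : ℕ) : Tuning :=
  { h := P.bandwidth n, halfWidth := ⌊(n : ℝ) * P.bandwidth n⌋₊, outer := ⌈P.numReps n α⌉₊,
    inner := ⌈20 * Real.log n⌉₊, scale := P.critScale n α,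
    bias := P.biasConst * P.bandwidth n ^ P.β }

open Classical in
/-- In one of the dyadically growing ranges `{1, …, 2ʳ ∧ m}` that are searched, at least a quarter
of the numbers satisfies `R`. -/
def IsHeavy (R : ℕ → Prop) (m : ℕ) : Prop :=
  ∃ r ≤ ⌈Real.log m / Real.log 2⌉₊,
    2 ^ r ⊓ m ≤ 4 * ((Finset.Icc 1 (2 ^ r ⊓ m)).filter R).card

/-- The design point with index `I` is good, for the data `y`, if one of the two searches around it
is likely to find a rejecting local test. The index `n` is excluded, since a round that draws it
returns `false` without running any local test. -/
def IsGood (P : Params) (α : ℝ) (n : ℕ) (y : ℕ → ℝ) (I : ℕ) : Prop :=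
  1 ≤ I ∧ I + 1 ≤ n ∧ (IsHeavy (fun J => P.Rejects n α y I (I + J)) (n - I) ∨
    2 ≤ I ∧ IsHeavy (fun J => P.Rejects n α y (I - J) I) (I - 1))

open Classical in
theorem failProb_searchProg_le {K : ℝ → ℝ} {y : ℕ → ℝ} (T : Tuning) {m : ℕ} (hm : 1 ≤ m)
    {test : ℕ → Prog Bool} {R : ℕ → Prop} (ht : ∀ J, (test J).Computes K y (decide (R J)))
    (hR : IsHeavy R m) :
    (searchProg T m test).failProb K y ≤ ENNReal.ofReal (3 / 4) ^ T.inner := by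
  obtain ⟨r, hr, hcard⟩ := hR
  unfold searchProg
  iterate 5 rw [failProb_exec_bind rfl]
  refine failProb_anyLoop_le_pow (fun _ => failProb_anyLoop_le (k := r) (Nat.zero_le _) (by omega) ?_)
    _ _
  iterate 2 rw [failProb_exec_bind rfl]
  have hpos : 1 ≤ 2 ^ r ⊓ m := le_min Nat.one_le_two_pow hm
  refine (failProb_unif_bind_le hpos _ _ (Finset.filter_subset R _) le_rfl fun J hJ => ?_).trans ?_
  · rw [(ht J).failProb]
    simp [(Finset.mem_filter.1 hJ).2]
  · apply ENNReal.ofReal_le_ofReal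
    have h0 : (0 : ℝ) < (2 ^ r ⊓ m : ℕ) := by exact_mod_cast hpos
    have h1 : ((2 ^ r ⊓ m : ℕ) : ℝ) ≤
      4 * (((Finset.Icc 1 (2 ^ r ⊓ m)).filter R).card : ℝ) := by exact_mod_cast hcard
    have : (1 : ℝ) / 4 ≤ (((Finset.Icc 1 (2 ^ r ⊓ m)).filter R).card : ℝ) / (2 ^ r ⊓ m : ℕ) := by
      rw [div_le_div_iff₀ (by norm_num) h0]; linarith
    linarith

theorem failProb_roundProg_le (P : Params) (hK : ∀ u, 1 < |u| → P.K u = 0) (hβ2 : P.β ≤ 2)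
    (α : ℝ) {n : ℕ} (y : ℕ → ℝ) (hn : 0 < n) (hh : 0 < P.bandwidth n) (H : Finset ℕ)
    (hH : ∀ I ∈ H, IsGood P α n y I) :
    (roundProg P n (P.tuning α n)).failProb P.K y ≤
      ENNReal.ofReal (1 - (H.card : ℝ) / n * (1 - (3 / 4) ^ ⌈20 * Real.log n⌉₊)) := by
  have ht := fun i j : ℕ => computes_localTestProg P hK hβ2 α (i := i) (j := j) y hn hh
  unfold roundProg
  refine failProb_unif_bind_le hn _ H (fun I hI => ?_) (by positivity) fun I hI => ?_
  · have := hH I hI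
    exact Finset.mem_Icc.2 ⟨this.1, by have := this.2.1; omega⟩
  obtain ⟨h1, h2, h3⟩ := hH I hI
  rw [ENNReal.ofReal_pow (by norm_num), failProb_exec_bind rfl, failProb_exec_bind rfl,
    if_pos (by simp; omega), failProb_exec_bind rfl, failProb_orElse]
  rcases h3 with h3 | ⟨h3, h4⟩
  · refine (mul_le_mul' (failProb_searchProg_le (P.tuning α n) (by omega) (fun J => ?_) h3)
      (failProb_le_one _)).trans_eq (mul_one _)
    exact computes_bind (computes_exec rfl) (ht _ _)
  · refine (mul_le_mul' (failProb_le_one _) ?_).trans_eq (one_mul _)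
    rw [failProb_exec_bind rfl, if_pos (by simpa using h3), failProb_exec_bind rfl]
    refine failProb_searchProg_le (P.tuning α n) (by omega) (fun J => ?_) h4
    exact computes_bind (computes_exec rfl) (ht _ _)

/-- A bound for the number of steps of `m` rounds, including the computation of the tuning
quantities. -/
noncomputable def roundsCost (P : Params) (n m : ℕ) : ℕ :=
  m * (2 * searchCost n ⌈20 * Real.log n⌉₊ ⌊(n : ℝ) * P.bandwidth n⌋₊ + 7) + 26

theorem run_setupProg (P : Params) (α : ℝ) (n : ℕ) (K : ℝ → ℝ) (y : ℕ → ℝ) :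
    ∃ s ≤ 26, (setupProg P α n).run K y = PMF.pure (P.tuning α n, s) := by
  obtain ⟨s, hs⟩ := computes_setupProg P α n K y
  refine ⟨s, ?_, hs⟩
  have : (setupProg P α n).Ensures K y (fun _ => True) 26 := by
    unfold setupProg
    iterate 26 refine ensures_step rfl ?_
    exact ensures_pure trivial
  exact (this (P.tuning α n, s) (by rw [hs]; exact (PMF.mem_support_pure_iff _ _).2 rfl)).2

/-- If at least `p n` design points are good, then `m` rounds fail to detect a violation with
probability at most `(1 - p (1 - η)) ^ m`, where `η` is the failure probability of a search. -/
theorem fomt_fail_le (P : Params) (hK : ∀ u, 1 < |u| → P.K u = 0) (hβ2 : P.β ≤ 2)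
    (α : ℝ) {n m : ℕ} (y : Finset.Icc 1 n → ℝ) (hn : 0 < n) (hh : 0 < P.bandwidth n) (H : Finset ℕ)
    (hH : ∀ I ∈ H, IsGood P α n (obs y) I) (hm : m ≤ ⌈P.numReps n α⌉₊) :
    (fomtLaw P α n y).toOuterMeasure {r | ¬ (r.1 = true ∧ r.2 ≤ roundsCost P n m)} ≤
      ENNReal.ofReal (1 - (H.card : ℝ) / n * (1 - (3 / 4) ^ ⌈20 * Real.log n⌉₊)) ^ m := by
  obtain ⟨s, hs, hrun⟩ := run_setupProg P α n P.K (obs y)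
  rw [fomtLaw, fomt, run_bind, hrun, PMF.pure_bind, PMF.toOuterMeasure_map_apply]
  refine le_trans (OuterMeasure.mono _ ?_) (anyLoop_budget (fun _ => ensures_roundProg P n _)
    (fun _ => failProb_roundProg_le P hK hβ2 α (obs y) hn hh H hH) hm 0)
  rintro ⟨b, t⟩ hbt
  simp only [Set.mem_preimage, Set.mem_ofPred_eq] at hbt ⊢
  refine fun hb => hbt ⟨hb.1, ?_⟩
  have : t ≤ m * (2 * searchCost n ⌈20 * Real.log n⌉₊ ⌊(n : ℝ) * P.bandwidth n⌋₊ + 7) := hb.2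
  unfold roundsCost
  omega

theorem one_sub_le_fomtLaw (P : Params) (hK : ∀ u, 1 < |u| → P.K u = 0) (hβ2 : P.β ≤ 2)
    (α : ℝ) {n m : ℕ} (y : Finset.Icc 1 n → ℝ) (hn : 0 < n) (hh : 0 < P.bandwidth n) (H : Finset ℕ)
    (hH : ∀ I ∈ H, IsGood P α n (obs y) I) (hm : m ≤ ⌈P.numReps n α⌉₊) {b : ℝ}
    (hb : (roundsCost P n m : ℝ) ≤ b) :
    1 - ENNReal.ofReal (1 - (H.card : ℝ) / n * (1 - (3 / 4) ^ ⌈20 * Real.log n⌉₊)) ^ m ≤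
      (fomtLaw P α n y).toMeasure {r : Bool × ℕ | r.1 = true ∧ (r.2 : ℝ) ≤ b} := by
  set A : Set (Bool × ℕ) := {r | r.1 = true ∧ (r.2 : ℝ) ≤ b} with hA
  have hle : (fomtLaw P α n y).toMeasure Aᶜ ≤ _ :=
    le_trans (by
      rw [PMF.toMeasure_apply_eq_toOuterMeasure]
      refine OuterMeasure.mono _ fun r hr => ?_
      intro h
      exact hr ⟨h.1, le_trans (by exact_mod_cast h.2) hb⟩)
      (fomt_fail_le P hK hβ2 α y hn hh H hH hm)
  have hAm : MeasurableSet A := MeasurableSet.of_discrete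
  have := prob_add_prob_compl (μ := (fomtLaw P α n y).toMeasure) hAm
  rw [tsub_le_iff_right]
  rw [← this]
  gcongr

/-! ### Gaussian noise -/

instance (n : ℕ) (σ : ℝ) (f : ℝ → ℝ) : IsProbabilityMeasure (dataLaw n σ f) := by
  unfold dataLaw; infer_instance

theorem hasSubgaussianMGF_coord (n : ℕ) (σ : ℝ) (f : ℝ → ℝ) (i : Finset.Icc 1 n) :
    HasSubgaussianMGF (fun y : Finset.Icc 1 n → ℝ => y i - f ((i.1 : ℝ) / n))
      (Real.toNNReal (σ ^ 2)) (dataLaw n σ f) := by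
  have hg : HasSubgaussianMGF (fun x : ℝ => x - f ((i.1 : ℝ) / n)) (Real.toNNReal (σ ^ 2))
      (gaussianReal (f ((i.1 : ℝ) / n)) (Real.toNNReal (σ ^ 2))) := by
    have h0 : HasSubgaussianMGF id (Real.toNNReal (σ ^ 2)) (gaussianReal 0 (Real.toNNReal (σ ^ 2))) :=
      ⟨fun t => integrable_exp_mul_gaussianReal t, fun t => by
        rw [mgf_gaussianReal (Measure.map_id)]; simp⟩
    have hmap := gaussianReal_map_sub_const (μ := f ((i.1 : ℝ) / n)) (v := Real.toNNReal (σ ^ 2))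
      (f ((i.1 : ℝ) / n))
    rw [sub_self] at hmap
    rw [← hmap] at h0
    exact HasSubgaussianMGF.of_map (by fun_prop) h0
  have hm : (dataLaw n σ f).map (fun y => y i) =
      gaussianReal (f ((i.1 : ℝ) / n)) (Real.toNNReal (σ ^ 2)) :=
    (measurePreserving_eval _ i).map_eq
  rw [← hm] at hg
  exact HasSubgaussianMGF.of_map (X := fun x : ℝ => x - f ((i.1 : ℝ) / n))
    (Y := fun y : Finset.Icc 1 n → ℝ => y i) (measurable_pi_apply i).aemeasurable hg

/-- Tail bound for a linear combination of the noise variables. -/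
theorem noise_tail (n : ℕ) (σ : ℝ) (f : ℝ → ℝ) (a : ℕ → ℝ) {V t : ℝ} (ht : 0 ≤ t)
    (hσ : σ ≠ 0) (ha : ∑ i ∈ Finset.Icc 1 n, a i ^ 2 ≤ V) :
    (dataLaw n σ f) {y | t < ∑ i ∈ Finset.Icc 1 n, a i * (obs y i - f ((i : ℝ) / n))} ≤
      ENNReal.ofReal (Real.exp (-(t ^ 2 / (2 * σ ^ 2 * V)))) := by
  have hsum : ∀ g : ℕ → ℝ, ∑ i : Finset.Icc 1 n, g i = ∑ i ∈ Finset.Icc 1 n, g i :=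
    fun g => Finset.sum_coe_sort _ _
  rcases (Finset.sum_nonneg fun i _ => sq_nonneg (a i) :
    0 ≤ ∑ i ∈ Finset.Icc 1 n, a i ^ 2).eq_or_lt with h0 | h0
  · have : ∀ i ∈ Finset.Icc 1 n, a i = 0 := fun i hi => by
      simpa using (Finset.sum_eq_zero_iff_of_nonneg fun i _ => sq_nonneg (a i)).1 h0.symm i hi
    have he : {y : Finset.Icc 1 n → ℝ |
        t < ∑ i ∈ Finset.Icc 1 n, a i * (obs y i - f ((i : ℝ) / n))} = ∅ := by
      ext y
      simp only [Set.mem_ofPred_eq, Set.mem_empty_iff_false, iff_false, not_lt]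
      rw [Finset.sum_eq_zero fun i hi => by rw [this i hi, zero_mul]]
      exact ht
    rw [he, measure_empty]
    exact zero_le
  have hind : iIndepFun (fun (i : Finset.Icc 1 n) (y : Finset.Icc 1 n → ℝ) =>
      a i * (y i - f ((i.1 : ℝ) / n))) (dataLaw n σ f) :=
    iIndepFun_pi (X := fun (i : Finset.Icc 1 n) (x : ℝ) => a i * (x - f ((i.1 : ℝ) / n)))
      fun i => by fun_prop
  have key := HasSubgaussianMGF.measure_sum_ge_le_of_iIndepFun hind (s := Finset.univ)
    (fun i _ => (hasSubgaussianMGF_coord n σ f i).const_mul (a i)) ht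
  have hv : ((∑ i : Finset.Icc 1 n, (⟨a i ^ 2, sq_nonneg _⟩ * Real.toNNReal (σ ^ 2) : NNReal) :
      NNReal) : ℝ) = σ ^ 2 * ∑ i ∈ Finset.Icc 1 n, a i ^ 2 := by
    rw [NNReal.coe_sum, ← hsum, Finset.mul_sum]
    refine Finset.sum_congr rfl fun i _ => ?_
    change a i ^ 2 * (Real.toNNReal (σ ^ 2) : ℝ) = _
    rw [Real.coe_toNNReal _ (sq_nonneg σ), mul_comm]
  rw [hv] at key
  have hσ2 : 0 < σ ^ 2 := by positivity
  calc _ ≤ (dataLaw n σ f) {y | t ≤ ∑ i : Finset.Icc 1 n, a i * (y i - f ((i.1 : ℝ) / n))} := by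
        refine measure_mono fun y hy => ?_
        simp only [Set.mem_ofPred_eq] at hy ⊢
        refine hy.le.trans_eq ?_
        rw [← hsum]
        exact Finset.sum_congr rfl fun i _ => by rw [obs, dif_pos i.2]
    _ ≤ _ := by
        rw [← ENNReal.ofReal_toReal (measure_ne_top (dataLaw n σ f) _)]
        refine ENNReal.ofReal_le_ofReal (key.trans (Real.exp_le_exp.2 ?_))
        rw [neg_div, neg_le_neg_iff, ← mul_assoc]
        gcongr

/-- Union bound over a finite family of linear combinations of the noise variables. -/
theorem noise_tail_iUnion (n : ℕ) (σ : ℝ) (f : ℝ → ℝ) {ι : Type*} (S : Finset ι) (a : ι → ℕ → ℝ)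
    {V t : ℝ} (ht : 0 ≤ t) (hσ : σ ≠ 0)
    (ha : ∀ s ∈ S, ∑ i ∈ Finset.Icc 1 n, a s i ^ 2 ≤ V) :
    (dataLaw n σ f) {y | ∃ s ∈ S, t < ∑ i ∈ Finset.Icc 1 n, a s i * (obs y i - f ((i : ℝ) / n))} ≤
      S.card * ENNReal.ofReal (Real.exp (-(t ^ 2 / (2 * σ ^ 2 * V)))) := by
  have : {y : Finset.Icc 1 n → ℝ |
      ∃ s ∈ S, t < ∑ i ∈ Finset.Icc 1 n, a s i * (obs y i - f ((i : ℝ) / n))} =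
      ⋃ s ∈ S, {y | t < ∑ i ∈ Finset.Icc 1 n, a s i * (obs y i - f ((i : ℝ) / n))} := by
    ext y; simp
  rw [this]
  refine (measure_biUnion_finset_le _ _).trans ?_
  refine (Finset.sum_le_card_nsmul _ _ _ fun s hs => noise_tail n σ f (a s) ht hσ (ha s hs)).trans ?_
  rw [nsmul_eq_mul]

/-! ### The smallest eigenvalue of the local design matrix -/

theorem gram_quadForm (K : ℝ → ℝ) (k n : ℕ) (h x : ℝ) (v : Fin (k + 1) → ℝ) :
    v ⬝ᵥ (gram K k n h x).mulVec v = 1 / ((n : ℝ) * h) * ∑ i ∈ Finset.Icc 1 n,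
      K (((i : ℝ) / n - x) / h) * (v ⬝ᵥ basisVec k (((i : ℝ) / n - x) / h)) ^ 2 := by
  rw [gram, Matrix.smul_mulVec, dotProduct_smul, Matrix.sum_mulVec, dotProduct_sum, smul_eq_mul]
  congr 1
  refine Finset.sum_congr rfl fun i _ => ?_
  rw [Matrix.smul_mulVec, dotProduct_smul, Matrix.vecMulVec_mulVec, smul_eq_mul]
  simp [dotProduct_comm v, pow_two]

theorem gram_isHermitian (K : ℝ → ℝ) (k n : ℕ) (h x : ℝ) : (gram K k n h x).IsHermitian := by
  ext a b
  simp [gram, Matrix.sum_apply, Matrix.vecMulVec_apply, mul_comm]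

/-- A polynomial of degree at most one is controlled by its values at two distant points. -/
theorem basisVec_two_points {k : ℕ} (hk : k = 0 ∨ k = 1) (v : Fin (k + 1) → ℝ) {a b : ℝ}
    (ha : |a| ≤ 1) (hb : |b| ≤ 1) :
    (b - a) ^ 2 / 4 * (v ⬝ᵥ v) ≤ (v ⬝ᵥ basisVec k a) ^ 2 + (v ⬝ᵥ basisVec k b) ^ 2 := by
  rw [abs_le] at ha hb
  have ha2 : a ^ 2 ≤ 1 := by nlinarith
  have hb2 : b ^ 2 ≤ 1 := by nlinarith
  rcases hk with rfl | rfl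
  · have hU : ∀ c, v ⬝ᵥ basisVec 0 c = v 0 := fun c =>
      (Fin.sum_univ_one fun j => v j * basisVec 0 c j).trans (by simp [basisVec])
    have hv : v ⬝ᵥ v = v 0 * v 0 := Fin.sum_univ_one fun j => v j * v j
    rw [hU, hU, hv]
    nlinarith [mul_nonneg (sq_nonneg (v 0)) (sub_nonneg.2 ha2),
      mul_nonneg (sq_nonneg (v 0)) (sub_nonneg.2 hb2), mul_nonneg (sq_nonneg (v 0)) (sq_nonneg (b + a))]
  · have hU : ∀ c, v ⬝ᵥ basisVec 1 c = v 0 + v 1 * c := fun c =>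
      (Fin.sum_univ_two fun j => v j * basisVec 1 c j).trans (by simp [basisVec])
    have hv : v ⬝ᵥ v = v 0 * v 0 + v 1 * v 1 := Fin.sum_univ_two fun j => v j * v j
    rw [hU, hU, hv]
    generalize v 0 = p
    generalize v 1 = q
    have e1 : (q * (b - a)) ^ 2 ≤ 2 * ((p + q * a) ^ 2 + (p + q * b) ^ 2) := by
      nlinarith [sq_nonneg ((p + q * a) + (p + q * b))]
    have e2 : (p * (b - a)) ^ 2 ≤ 2 * ((p + q * a) ^ 2 + (p + q * b) ^ 2) := by
      have : p * (b - a) = b * (p + q * a) - a * (p + q * b) := by ring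
      rw [this]
      nlinarith [sq_nonneg (b * (p + q * a) + a * (p + q * b)),
        mul_nonneg (sub_nonneg.2 hb2) (sq_nonneg (p + q * a)),
        mul_nonneg (sub_nonneg.2 ha2) (sq_nonneg (p + q * b))]
    nlinarith

theorem sum_range_le_sum_Icc {F : ℕ → ℝ} {n m : ℕ} (hF : ∀ i ∈ Finset.Icc 1 n, 0 ≤ F i) {A : ℕ → ℕ}
    (hA : Set.InjOn A (Finset.range m)) (hAn : ∀ t < m, A t ∈ Finset.Icc 1 n) :
    ∑ t ∈ Finset.range m, F (A t) ≤ ∑ i ∈ Finset.Icc 1 n, F i := by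
  rw [← Finset.sum_image (f := F) hA]
  refine Finset.sum_le_sum_of_subset_of_nonneg ?_ fun i hi _ => hF i hi
  intro i hi
  obtain ⟨t, ht, rfl⟩ := Finset.mem_image.1 hi
  exact hAn t (Finset.mem_range.1 ht)

/-- Lower bound for the design matrix from `m` pairs of design points in the window, the two points
of a pair being at rescaled distance at least `d`. -/
theorem gram_posSemidef_of_pairs {K : ℝ → ℝ} {Kmin D d : ℝ} {k n m : ℕ} {h x lam : ℝ}
    (hk : k = 0 ∨ k = 1) (hK0 : ∀ u, 0 ≤ K u) (hKmin : 0 < Kmin) (hD1 : D ≤ 1)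
    (hlow : ∀ u, |u| ≤ D → Kmin ≤ K u) (hN : 0 < (n : ℝ) * h) (hd : 0 ≤ d) (A B : ℕ → ℕ)
    (hA : Set.InjOn A (Finset.range m)) (hB : Set.InjOn B (Finset.range m))
    (hAn : ∀ t < m, A t ∈ Finset.Icc 1 n) (hBn : ∀ t < m, B t ∈ Finset.Icc 1 n)
    (hAD : ∀ t < m, |((A t : ℝ) / n - x) / h| ≤ D) (hBD : ∀ t < m, |((B t : ℝ) / n - x) / h| ≤ D)
    (hAB : ∀ t < m, d ≤ |((B t : ℝ) / n - x) / h - ((A t : ℝ) / n - x) / h|)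
    (hlam : lam * ((n : ℝ) * h) ≤ m * (Kmin * d ^ 2 / 8)) :
    (gram K k n h x - lam • (1 : Matrix (Fin (k + 1)) (Fin (k + 1)) ℝ)).PosSemidef := by
  refine Matrix.PosSemidef.of_dotProduct_mulVec_nonneg ?_ fun v => ?_
  · exact (gram_isHermitian K k n h x).sub (Matrix.isHermitian_one.smul (by simp [IsSelfAdjoint]))
  · rw [star_trivial, Matrix.sub_mulVec, dotProduct_sub, gram_quadForm, Matrix.smul_mulVec,
      Matrix.one_mulVec, dotProduct_smul, smul_eq_mul, sub_nonneg, one_div]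
    set F : ℕ → ℝ := fun i =>
      K (((i : ℝ) / n - x) / h) * (v ⬝ᵥ basisVec k (((i : ℝ) / n - x) / h)) ^ 2 with hF
    have hF0 : ∀ i ∈ Finset.Icc 1 n, 0 ≤ F i := fun i _ => mul_nonneg (hK0 _) (sq_nonneg _)
    have h1 := sum_range_le_sum_Icc hF0 hA hAn
    have h2 := sum_range_le_sum_Icc hF0 hB hBn
    have hvv : 0 ≤ v ⬝ᵥ v := Finset.sum_nonneg fun i _ => mul_self_nonneg (v i)
    have h3 : (m : ℝ) * (Kmin * d ^ 2 / 4 * (v ⬝ᵥ v)) ≤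
        ∑ t ∈ Finset.range m, F (A t) + ∑ t ∈ Finset.range m, F (B t) := by
      rw [← Finset.sum_add_distrib]
      have := Finset.card_nsmul_le_sum (Finset.range m) (fun t => F (A t) + F (B t))
        (Kmin * d ^ 2 / 4 * (v ⬝ᵥ v)) fun t ht => ?_
      · simpa using this
      have ht := Finset.mem_range.1 ht
      have hp := basisVec_two_points hk v ((hAD t ht).trans hD1) ((hBD t ht).trans hD1)
      have hdd : d ^ 2 ≤ (((B t : ℝ) / n - x) / h - ((A t : ℝ) / n - x) / h) ^ 2 := by
        rw [← sq_abs (((B t : ℝ) / n - x) / h - _)]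
        exact pow_le_pow_left₀ hd (hAB t ht) 2
      have e1 : Kmin * (v ⬝ᵥ basisVec k (((A t : ℝ) / n - x) / h)) ^ 2 ≤ F (A t) :=
        mul_le_mul_of_nonneg_right (hlow _ (hAD t ht)) (sq_nonneg _)
      have e2 : Kmin * (v ⬝ᵥ basisVec k (((B t : ℝ) / n - x) / h)) ^ 2 ≤ F (B t) :=
        mul_le_mul_of_nonneg_right (hlow _ (hBD t ht)) (sq_nonneg _)
      have e3 : d ^ 2 / 4 * (v ⬝ᵥ v) ≤ (v ⬝ᵥ basisVec k (((A t : ℝ) / n - x) / h)) ^ 2 +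
          (v ⬝ᵥ basisVec k (((B t : ℝ) / n - x) / h)) ^ 2 :=
        le_trans (by gcongr) hp
      have e4 := mul_le_mul_of_nonneg_left e3 hKmin.le
      linarith
    rw [inv_mul_eq_div, le_div_iff₀ hN]
    have := mul_le_mul_of_nonneg_right hlam hvv
    linarith

theorem exists_isEigenBound {K : ℝ → ℝ} {Kmin Kmax Δ LK : ℝ} (hK : IsKernel K Kmin Kmax Δ LK)
    {k : ℕ} (hk : k = 0 ∨ k = 1) : ∃ lam0, IsEigenBound K k lam0 := by
  set D := min Δ 1 with hD
  have hD0 : 0 < D := lt_min hK.Δ_pos one_pos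
  have hD1 : D ≤ 1 := min_le_right _ _
  have hKm := hK.Kmin_pos
  refine ⟨D / 8 * (Kmin * (D / 4) ^ 2 / 8), by positivity, fun h hh hnh => ?_⟩
  have ev1 := hh.eventually_lt_const (by norm_num : (0 : ℝ) < 1 / 2)
  have ev2 := hnh.eventually_ge_atTop (8 / D)
  obtain ⟨n₀, hn₀⟩ := eventually_atTop.1 ((ev1.and ev2).and (eventually_ge_atTop 16))
  refine ⟨n₀, fun n hn x hx => ?_⟩
  obtain ⟨⟨h1, h2⟩, h3⟩ := hn₀ n hn
  have hn16 : (16 : ℝ) ≤ n := by exact_mod_cast h3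
  have hn0 : (0 : ℝ) < n := by linarith
  set N := (n : ℝ) * h n with hN
  have hDN : 8 ≤ D * N := by rwa [div_le_iff₀' hD0] at h2
  have hN0 : 0 < N := by nlinarith
  have hN2 : N ≤ n / 2 := by
    rw [hN]; nlinarith
  have hDN2 : D * N ≤ n / 2 := by nlinarith
  set m := ⌊D * N / 4⌋₊ with hm
  have hm1 : (m : ℝ) ≤ D * N / 4 := Nat.floor_le (by positivity)
  have hm2 : D * N / 4 < m + 1 := Nat.lt_floor_add_one _
  have hu : ∀ i : ℕ, ((i : ℝ) / n - x) / h n = (i - n * x) / N := fun i => by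
    rw [hN]; field_simp
  have hlam : D / 8 * (Kmin * (D / 4) ^ 2 / 8) * N ≤ m * (Kmin * (D / 4) ^ 2 / 8) := by
    have : D / 8 * N ≤ m := by linarith
    calc _ = D / 8 * N * (Kmin * (D / 4) ^ 2 / 8) := by ring
      _ ≤ _ := by gcongr
  have hdist : D / 4 ≤ 2 * m / N := by
    rw [le_div_iff₀ hN0]; linarith
  have hlow : ∀ u, |u| ≤ D → Kmin ≤ K u := fun u hu => hK.lower u (hu.trans (min_le_left _ _))
  have hx0 : 0 ≤ (n : ℝ) * x := mul_nonneg hn0.le hx.1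
  have hnx : (n : ℝ) * x ≤ n := by nlinarith [hx.2]
  -- the pairs are taken on the side of `x` that is farther away from the boundary
  rcases le_total x (1 / 2) with hx2 | hx2
  · have hc1 := Nat.le_ceil ((n : ℝ) * x)
    have hc2 := Nat.ceil_lt_add_one hx0
    set i₀ := ⌈(n : ℝ) * x⌉₊
    have hnx2 : (n : ℝ) * x ≤ n / 2 := by nlinarith
    have hi : i₀ + 3 * m ≤ n := by
      have : ((i₀ + 3 * m : ℕ) : ℝ) ≤ n := by push_cast; linarith
      exact_mod_cast this
    refine gram_posSemidef_of_pairs hk hK.nonneg hKm hD1 hlow hN0 (by positivity)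
      (fun t => i₀ + 1 + t) (fun t => i₀ + 1 + t + 2 * m) (fun a _ b _ hab => by simpa using hab)
      (fun a _ b _ hab => by simpa using hab) ?_ ?_ ?_ ?_ ?_ hlam
    · intro t ht; simp only [Finset.mem_Icc]; omega
    · intro t ht; simp only [Finset.mem_Icc]; omega
    · intro t ht
      have ht' : (t : ℝ) + 1 ≤ m := by exact_mod_cast ht
      rw [hu, abs_of_nonneg (div_nonneg (by push_cast; linarith [(Nat.cast_nonneg t : (0:ℝ) ≤ t)]) hN0.le),
        div_le_iff₀ hN0]
      push_cast; linarith
    · intro t ht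
      have ht' : (t : ℝ) + 1 ≤ m := by exact_mod_cast ht
      rw [hu, abs_of_nonneg (div_nonneg (by push_cast; linarith [(Nat.cast_nonneg t : (0:ℝ) ≤ t)]) hN0.le),
        div_le_iff₀ hN0]
      push_cast; linarith
    · intro t ht
      rw [hu, hu, ← sub_div]
      refine hdist.trans (le_trans (le_of_eq ?_) (le_abs_self _))
      push_cast; ring
  · have hc1 := Nat.floor_le hx0
    have hc2 := Nat.lt_floor_add_one ((n : ℝ) * x)
    set i₀ := ⌊(n : ℝ) * x⌋₊
    have hnx2 : (n : ℝ) / 2 ≤ n * x := by nlinarith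
    have hi : 3 * m + 1 ≤ i₀ := by
      have : ((3 * m : ℕ) : ℝ) < i₀ := by push_cast; linarith
      exact_mod_cast this
    have hi' : i₀ ≤ n := by
      have : (i₀ : ℝ) ≤ n := by linarith
      exact_mod_cast this
    refine gram_posSemidef_of_pairs hk hK.nonneg hKm hD1 hlow hN0 (by positivity)
      (fun t => i₀ - (1 + t)) (fun t => i₀ - (1 + t + 2 * m)) ?_ ?_ ?_ ?_ ?_ ?_ ?_ hlam
    · intro a ha b hb hab
      simp only [Finset.coe_range, Set.mem_Iio] at ha hb hab
      omega
    · intro a ha b hb hab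
      simp only [Finset.coe_range, Set.mem_Iio] at ha hb hab
      omega
    · intro t ht; simp only [Finset.mem_Icc]; omega
    · intro t ht; simp only [Finset.mem_Icc]; omega
    · intro t ht
      have ht' : (t : ℝ) + 1 ≤ m := by exact_mod_cast ht
      rw [hu, Nat.cast_sub (by omega), abs_of_nonpos (div_nonpos_of_nonpos_of_nonneg
        (by push_cast; linarith [(Nat.cast_nonneg t : (0:ℝ) ≤ t)]) hN0.le), ← neg_div,
        div_le_iff₀ hN0]
      push_cast; linarith
    · intro t ht
      have ht' : (t : ℝ) + 1 ≤ m := by exact_mod_cast ht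
      rw [hu, Nat.cast_sub (by omega), abs_of_nonpos (div_nonpos_of_nonpos_of_nonneg
        (by push_cast; linarith [(Nat.cast_nonneg t : (0:ℝ) ≤ t)]) hN0.le), ← neg_div,
        div_le_iff₀ hN0]
      push_cast; linarith
    · intro t ht
      rw [hu, hu, ← sub_div, Nat.cast_sub (by omega), Nat.cast_sub (by omega), ← abs_neg]
      refine hdist.trans (le_trans (le_of_eq ?_) (le_abs_self _))
      push_cast; ring

/-- The upper left entry of the local design matrix. -/
theorem kernelSum_ge {K : ℝ → ℝ} {k n : ℕ} {h x lam : ℝ} (hN : 0 < (n : ℝ) * h)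
    (hB : (gram K k n h x - lam • (1 : Matrix (Fin (k + 1)) (Fin (k + 1)) ℝ)).PosSemidef) :
    lam * ((n : ℝ) * h) ≤ ∑ i ∈ Finset.Icc 1 n, K (((i : ℝ) / n - x) / h) := by
  have := hB.diag_nonneg (i := 0)
  simp [gram, Matrix.sum_apply, Matrix.vecMulVec_apply, basisVec] at this
  rw [← mul_inv_rev, inv_mul_eq_div, le_div_iff₀ (by linarith)] at this
  linarith

theorem kernelSecondMoment_ge {K : ℝ → ℝ} {n : ℕ} {h x lam : ℝ} (hN : 0 < (n : ℝ) * h)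
    (hB : (gram K 1 n h x - lam • (1 : Matrix (Fin 2) (Fin 2) ℝ)).PosSemidef) :
    lam * ((n : ℝ) * h) ≤ ∑ i ∈ Finset.Icc 1 n,
      K (((i : ℝ) / n - x) / h) * (((i : ℝ) / n - x) / h) * (((i : ℝ) / n - x) / h) := by
  have := hB.diag_nonneg (i := 1)
  simp only [gram, Matrix.sub_apply, Matrix.smul_apply, Matrix.sum_apply, Matrix.vecMulVec_apply,
    basisVec, Fin.val_one, Nat.factorial_one, pow_one, Nat.cast_one, div_one, smul_eq_mul,
    Matrix.one_apply_eq, mul_one] at this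
  rw [sub_nonneg, one_div, inv_mul_eq_div, le_div_iff₀ hN] at this
  simpa only [mul_assoc] using this

/-! ### Bandwidth and constants -/

/-- The assumptions on the parameters of the test. -/
structure Params.Valid (P : Params) : Prop where
  kernel : ∃ Kmin Δ, IsKernel P.K Kmin P.Kmax Δ P.LK
  β_pos : 0 < P.β
  β_le : P.β ≤ 2
  L_pos : 0 < P.L
  σ_pos : 0 < P.σ
  eigenBound : IsEigenBound P.K P.order P.lam0

namespace Params.Valid

variable {P : Params}

theorem K_nonneg (hP : P.Valid) (u : ℝ) : 0 ≤ P.K u := by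
  obtain ⟨_, _, h⟩ := hP.kernel; exact h.nonneg u

theorem K_support (hP : P.Valid) (u : ℝ) (hu : 1 < |u|) : P.K u = 0 := by
  obtain ⟨_, _, h⟩ := hP.kernel; exact h.support u hu

theorem K_le (hP : P.Valid) (u : ℝ) : P.K u ≤ P.Kmax := by
  obtain ⟨_, _, h⟩ := hP.kernel; exact h.upper u

theorem K_lipschitz (hP : P.Valid) (u v : ℝ) : |P.K u - P.K v| ≤ P.LK * |u - v| := by
  obtain ⟨_, _, h⟩ := hP.kernel; exact h.lipschitz u v

theorem K_symm (hP : P.Valid) (u : ℝ) : P.K (-u) = P.K u := by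
  obtain ⟨_, _, h⟩ := hP.kernel; exact h.symm u

theorem LK_pos (hP : P.Valid) : 0 < P.LK := by
  obtain ⟨_, _, h⟩ := hP.kernel; exact h.LK_pos

theorem K_zero_pos (hP : P.Valid) : 0 < P.K 0 := by
  obtain ⟨_, _, h⟩ := hP.kernel
  exact h.Kmin_pos.trans_le (h.lower 0 (by simpa using h.Δ_pos.le))

theorem Kmax_pos (hP : P.Valid) : 0 < P.Kmax := hP.K_zero_pos.trans_le (hP.K_le 0)

theorem lam0_pos (hP : P.Valid) : 0 < P.lam0 := hP.eigenBound.1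

theorem integral_sq_pos (hP : P.Valid) : 0 < ∫ u, P.K u ^ 2 := by
  have hc : Continuous P.K :=
    (LipschitzWith.of_dist_le_mul (K := ⟨P.LK, hP.LK_pos.le⟩) fun u v =>
      hP.K_lipschitz u v).continuous
  refine Continuous.integral_pos_of_hasCompactSupport_nonneg_nonzero (x := 0) (by fun_prop) ?_
    (fun u => sq_nonneg _) (pow_ne_zero _ hP.K_zero_pos.ne')
  refine HasCompactSupport.intro (isCompact_Icc (a := (-1 : ℝ)) (b := 1)) fun u hu => ?_
  rw [hP.K_support u, zero_pow two_ne_zero]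
  rw [Set.mem_Icc, ← abs_le] at hu
  exact not_le.1 hu

theorem one_le_ceil (hP : P.Valid) : 1 ≤ ⌈P.β⌉₊ := Nat.one_le_ceil_iff.2 hP.β_pos

theorem ceil_eq_one (hP : P.Valid) (h : P.β ≤ 1) : ⌈P.β⌉₊ = 1 :=
  le_antisymm (Nat.ceil_le.2 (by exact_mod_cast h)) hP.one_le_ceil

theorem ceil_eq_two (hP : P.Valid) (h : 1 < P.β) : ⌈P.β⌉₊ = 2 :=
  le_antisymm (Nat.ceil_le.2 (by exact_mod_cast hP.β_le)) (Nat.lt_ceil.2 (by exact_mod_cast h))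

theorem frac_of_le (hP : P.Valid) (h : P.β ≤ 1) : P.frac = P.β := by
  rw [Params.frac, hP.ceil_eq_one h]; simp

theorem frac_of_lt (hP : P.Valid) (h : 1 < P.β) : P.frac = P.β - 1 := by
  rw [Params.frac, hP.ceil_eq_two h]; push_cast; ring

theorem Cstar_pos (hP : P.Valid) : 0 < P.Cstar := by
  have := hP.Kmax_pos; have := hP.lam0_pos
  unfold Params.Cstar; positivity

theorem Ch_pos (hP : P.Valid) : 0 < P.Ch := by
  have h1 := hP.Cstar_pos
  have h2 := hP.L_pos
  have h3 := hP.β_pos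
  have h4 := hP.σ_pos
  have h5 := hP.lam0_pos
  have h6 := hP.integral_sq_pos
  have h7 : (0 : ℝ) < ⌈P.β⌉₊ := by exact_mod_cast hP.one_le_ceil
  unfold Params.Ch Params.q1 Params.q2
  positivity

theorem W_ge (P : Params) : 4 * P.Cstar ^ 2 ≤ P.W := le_max_left _ _

theorem W_pos (hP : P.Valid) : 0 < P.W :=
  lt_of_lt_of_le (by have := hP.Cstar_pos; positivity) (W_ge P)

theorem L2_pos (hP : P.Valid) : 0 < P.L2 := by
  have h1 := hP.Kmax_pos
  have h2 := hP.LK_pos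
  have h3 : (0 : ℝ) < ⌈P.β⌉₊ := by exact_mod_cast hP.one_le_ceil
  unfold Params.L2; positivity

theorem exponent_pos (hP : P.Valid) : 0 < 1 / (2 * P.β + 1) := by
  have := hP.β_pos; positivity

theorem exponent_lt_one (hP : P.Valid) : 1 / (2 * P.β + 1) < 1 := by
  have := hP.β_pos
  rw [div_lt_one (by positivity)]; linarith

theorem bandwidth_pos (hP : P.Valid) {n : ℕ} (hn : 2 ≤ n) : 0 < P.bandwidth n := by
  have h1 : (1 : ℝ) < n := by exact_mod_cast hn
  have h2 := Real.log_pos h1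
  have := hP.Ch_pos
  unfold Params.bandwidth
  positivity

theorem tendsto_log_div : Tendsto (fun n : ℕ => Real.log n / n) atTop (𝓝 0) :=
  (Real.isLittleO_log_id_atTop.tendsto_div_nhds_zero).comp tendsto_natCast_atTop_atTop

theorem tendsto_bandwidth (hP : P.Valid) : Tendsto P.bandwidth atTop (𝓝 0) := by
  have := (tendsto_log_div.rpow_const (Or.inr hP.exponent_pos.le)).const_mul P.Ch
  rwa [Real.zero_rpow hP.exponent_pos.ne', mul_zero] at this

theorem tendsto_mul_bandwidth (hP : P.Valid) :
    Tendsto (fun n : ℕ => (n : ℝ) * P.bandwidth n) atTop atTop := by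
  have h1 : Tendsto (fun n : ℕ => P.Ch * (n : ℝ) ^ (1 - 1 / (2 * P.β + 1))) atTop atTop :=
    (((tendsto_rpow_atTop (sub_pos.2 hP.exponent_lt_one)).comp
      tendsto_natCast_atTop_atTop)).const_mul_atTop hP.Ch_pos
  refine tendsto_atTop_mono' _ ?_ h1
  filter_upwards [eventually_ge_atTop 3] with n hn
  have hn3 : (3 : ℝ) ≤ n := by exact_mod_cast hn
  have hn0 : (0 : ℝ) < n := by linarith
  have hlog : 1 ≤ Real.log n := by
    rw [Real.le_log_iff_exp_le hn0]
    linarith [Real.exp_one_lt_d9]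
  unfold Params.bandwidth
  rw [Real.rpow_sub hn0, Real.rpow_one, Real.div_rpow (by linarith) hn0.le]
  have : 1 ≤ Real.log n ^ (1 / (2 * P.β + 1)) := Real.one_le_rpow hlog hP.exponent_pos.le
  have h3 : 0 < (n : ℝ) ^ (1 / (2 * P.β + 1)) := by positivity
  have hC := hP.Ch_pos
  calc P.Ch * (n / (n : ℝ) ^ (1 / (2 * P.β + 1)))
      = n * (P.Ch * (1 / (n : ℝ) ^ (1 / (2 * P.β + 1)))) := by ring
    _ ≤ _ := by gcongr

theorem bandwidth_rpow (hP : P.Valid) {n : ℕ} (hn : 2 ≤ n) :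
    P.bandwidth n ^ (2 * P.β + 1) = P.Ch ^ (2 * P.β + 1) * (Real.log n / n) := by
  have h1 : (1 : ℝ) < n := by exact_mod_cast hn
  have h2 := Real.log_pos h1
  have := hP.β_pos
  unfold Params.bandwidth
  rw [Real.mul_rpow hP.Ch_pos.le (by positivity), ← Real.rpow_mul (by positivity),
    one_div_mul_cancel (by positivity), Real.rpow_one]

/-- `C Δ_{β,n} = (2 C_β + 2 L) h_n ^ ϱ`. -/
theorem sepConst_mul_sepRate (hP : P.Valid) {n : ℕ} (hn : 2 ≤ n) :
    P.sepConst * P.sepRate n = (2 * P.Cβ + 2 * P.L) * P.bandwidth n ^ P.frac := by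
  have h1 : (1 : ℝ) < n := by exact_mod_cast hn
  have h2 := Real.log_pos h1
  unfold Params.sepConst Params.sepRate Params.bandwidth
  rw [Real.mul_rpow hP.Ch_pos.le (by positivity), ← Real.rpow_mul (by positivity), mul_assoc,
    one_div_mul_eq_div]

theorem eventually_scale_le (hP : P.Valid) {α : ℝ} (hα : 0 < α) (hα1 : α < 1) :
    ∀ᶠ n : ℕ in atTop, 0 ≤ P.critScale n α ∧ P.critScale n α ≤
      P.σ * √(4 * P.W / P.Ch ^ (2 * P.β + 1)) * P.bandwidth n ^ (P.β - 1) := by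
  set c : ℝ := 40 / Real.log 2 * (-2 * Real.log (α / 2)) / α with hc
  have hlog2 := Real.log_pos one_lt_two
  have hlogα : Real.log (α / 2) < 0 := Real.log_neg (by positivity) (by linarith)
  have hc0 : 0 < c := by
    have : 0 < -2 * Real.log (α / 2) := by linarith
    positivity
  have hlim : ∀ᶠ n : ℕ in atTop, c * Real.log n ^ 2 ≤ n := by
    have h := (isLittleO_log_rpow_atTop (r := 1 / 2) (by norm_num)).bound
      (c := 1 / (Real.sqrt c + 1)) (by positivity)
    have h' := tendsto_natCast_atTop_atTop (R := ℝ) |>.eventually h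
    filter_upwards [h', eventually_ge_atTop 2] with n hn hn2
    have h1 : (1 : ℝ) < n := by exact_mod_cast hn2
    have hl := Real.log_pos h1
    rw [Real.norm_of_nonneg hl.le, Real.norm_of_nonneg (by positivity), ← Real.sqrt_eq_rpow,
      one_div, inv_mul_eq_div, le_div_iff₀ (by positivity)] at hn
    have h2 : √c * Real.log n ≤ √n := by nlinarith [Real.sqrt_nonneg c]
    have h3 := pow_le_pow_left₀ (by positivity) h2 2
    rwa [mul_pow, Real.sq_sqrt hc0.le, Real.sq_sqrt (by linarith)] at h3
  filter_upwards [hlim, eventually_ge_atTop 2, hP.tendsto_mul_bandwidth.eventually_ge_atTop 1]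
    with n h1 hn hnh
  have hn1 : (1 : ℝ) < n := by exact_mod_cast hn
  have hn0 : (0 : ℝ) < n := by linarith
  have hl := Real.log_pos hn1
  have hh := hP.bandwidth_pos hn
  have hσ := hP.σ_pos
  have hW := hP.W_pos
  have hCh := hP.Ch_pos
  refine ⟨by unfold Params.critScale; positivity, ?_⟩
  have hN : P.Nmax n α / α = c * Real.log n ^ 2 / P.bandwidth n := by
    unfold Params.Nmax Params.numReps
    rw [hc]; ring
  have hN2 : P.Nmax n α / α ≤ (n : ℝ) ^ 2 := by
    rw [hN, div_le_iff₀ hh]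
    nlinarith
  have hlog : -2 * Real.log (α / P.Nmax n α) * P.W ≤ 4 * P.W * Real.log n := by
    have : Real.log (P.Nmax n α / α) ≤ 2 * Real.log n := by
      rw [← Real.log_rpow hn0]
      refine Real.log_le_log (by rw [hN]; positivity) ?_
      exact_mod_cast hN2
    rw [← inv_div, Real.log_inv]
    nlinarith
  have hpow : Real.log n = (P.bandwidth n ^ (P.β + 1 / 2)) ^ 2 / P.Ch ^ (2 * P.β + 1) * n := by
    rw [← Real.rpow_natCast, ← Real.rpow_mul hh.le]
    have : (P.β + 1 / 2) * ((2 : ℕ) : ℝ) = 2 * P.β + 1 := by push_cast; ring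
    rw [this, hP.bandwidth_rpow hn]
    field_simp
  unfold Params.critScale
  calc _ ≤ P.σ * √(4 * P.W * Real.log n) * (n : ℝ) ^ (-1 / 2 : ℝ) *
        P.bandwidth n ^ (-3 / 2 : ℝ) := by gcongr
    _ = P.σ * (√(4 * P.W / P.Ch ^ (2 * P.β + 1)) * P.bandwidth n ^ (P.β + 1 / 2) * √n) *
        (n : ℝ) ^ (-1 / 2 : ℝ) * P.bandwidth n ^ (-3 / 2 : ℝ) := by
        have : 4 * P.W * Real.log n = 4 * P.W / P.Ch ^ (2 * P.β + 1) *
          (P.bandwidth n ^ (P.β + 1 / 2)) ^ 2 * n := by rw [hpow]; ring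
        rw [this, Real.sqrt_mul (by positivity), Real.sqrt_mul (by positivity),
          Real.sqrt_sq (by positivity)]
    _ = P.σ * √(4 * P.W / P.Ch ^ (2 * P.β + 1)) *
        (P.bandwidth n ^ (P.β + 1 / 2) * P.bandwidth n ^ (-3 / 2 : ℝ)) *
        (√n * (n : ℝ) ^ (-1 / 2 : ℝ)) := by ring
    _ = _ := by
        have e1 : √(n : ℝ) * (n : ℝ) ^ (-1 / 2 : ℝ) = 1 := by
          rw [Real.sqrt_eq_rpow, ← Real.rpow_add hn0]; norm_num
        rw [← Real.rpow_add hh, e1, mul_one]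
        congr 2
        ring

end Params.Valid

/-! ### Computational cost -/

namespace Params.Valid

variable {P : Params}

theorem half_le_log {n : ℕ} (hn : 2 ≤ n) : 1 / 2 ≤ Real.log n := by
  have : Real.log 2 ≤ Real.log n := Real.log_le_log (by norm_num) (by exact_mod_cast hn)
  linarith [Real.log_two_gt_d9]

theorem log_div_le_one {n : ℕ} (hn : 2 ≤ n) : Real.log n / n ≤ 1 := by
  have h1 : (0 : ℝ) < n := by positivity
  rw [div_le_one h1]
  linarith [Real.log_le_sub_one_of_pos h1]

theorem bandwidth_le (hP : P.Valid) {n : ℕ} (hn : 2 ≤ n) : P.bandwidth n ≤ P.Ch := by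
  have h1 := half_le_log hn
  have h2 := log_div_le_one hn
  have h3 : 0 ≤ Real.log n / n := by positivity
  have := Real.rpow_le_one h3 h2 hP.exponent_pos.le
  have hC := hP.Ch_pos
  unfold Params.bandwidth
  nlinarith

theorem mul_bandwidth_ge (hP : P.Valid) {n : ℕ} (hn : 2 ≤ n) :
    P.Ch / 2 ≤ n * P.bandwidth n := by
  have h1 := half_le_log hn
  have h2 := log_div_le_one hn
  have hn0 : (0 : ℝ) < n := by positivity
  have h3 : 0 < Real.log n / n := by positivity
  have h4 := Real.rpow_le_rpow_of_exponent_ge h3 h2 hP.exponent_lt_one.le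
  rw [Real.rpow_one] at h4
  have hC := hP.Ch_pos
  calc P.Ch / 2 ≤ P.Ch * Real.log n := by nlinarith
    _ = n * (P.Ch * (Real.log n / n)) := by field_simp
    _ ≤ _ := by unfold Params.bandwidth; gcongr

/-- One round takes `O(n h_n log² n)` steps. -/
theorem exists_roundCost_le (hP : P.Valid) : ∃ B : ℝ, 0 < B ∧ ∀ n : ℕ, 2 ≤ n →
    ((2 * searchCost n ⌈20 * Real.log n⌉₊ ⌊(n : ℝ) * P.bandwidth n⌋₊ + 7 : ℕ) : ℝ) ≤
      B * (n * P.bandwidth n * Real.log n ^ 2) ∧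
    27 ≤ B * (n * P.bandwidth n * Real.log n ^ 2) := by
  have hC := hP.Ch_pos
  refine ⟨264 * (76 + 178 / P.Ch) + 504 / P.Ch, by positivity, fun n hn => ?_⟩
  have hl := half_le_log hn
  have hN := hP.mul_bandwidth_ge hn
  set l := Real.log n
  set N := (n : ℝ) * P.bandwidth n
  have hN0 : 0 < N := by linarith [half_pos hC]
  have h1N : 1 ≤ 2 / P.Ch * N := by
    rw [div_mul_eq_mul_div, one_le_div hC]; linarith
  have hi : (⌈20 * l⌉₊ : ℝ) ≤ 22 * l := by
    linarith [Nat.ceil_lt_add_one (show (0 : ℝ) ≤ 20 * l by linarith)]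
  have hκ : (⌈l / Real.log 2⌉₊ : ℝ) + 1 ≤ 6 * l := by
    have h2 := Real.log_two_gt_d9
    have : l / Real.log 2 ≤ 2 * l := by
      rw [div_le_iff₀ (by linarith)]; nlinarith
    linarith [Nat.ceil_lt_add_one (show (0 : ℝ) ≤ l / Real.log 2 by positivity)]
  have hw : 76 * (⌊N⌋₊ : ℝ) + 89 ≤ (76 + 178 / P.Ch) * N := by
    have := Nat.floor_le hN0.le
    have e : (76 + 178 / P.Ch) * N = 76 * N + 89 * (2 / P.Ch * N) := by ring
    rw [e]; linarith
  have hll : 2 * l ≤ 4 * l ^ 2 := by nlinarith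
  have hl2 : 1 ≤ 4 * l ^ 2 := by nlinarith
  have hlN : l ^ 2 ≤ 2 / P.Ch * N * l ^ 2 := le_mul_of_one_le_left (sq_nonneg l) h1N
  have e2 : (264 * (76 + 178 / P.Ch) + 504 / P.Ch) * (N * l ^ 2) =
      264 * (76 + 178 / P.Ch) * N * l ^ 2 + 252 * (2 / P.Ch * N * l ^ 2) := by ring
  have hpos : 0 ≤ 264 * (76 + 178 / P.Ch) * N * l ^ 2 := by positivity
  constructor
  · unfold searchCost testCost
    push_cast
    calc 2 * ((⌈20 * l⌉₊ : ℝ) * (((⌈l / Real.log 2⌉₊ : ℝ) + 1) * (76 * ⌊N⌋₊ + 84 + 5) + 2) + 6) + 7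
        ≤ 2 * (22 * l * (6 * l * ((76 + 178 / P.Ch) * N) + 2) + 6) + 7 := by
          have : 76 * (⌊N⌋₊ : ℝ) + 84 + 5 ≤ (76 + 178 / P.Ch) * N := by linarith
          gcongr
      _ = 264 * (76 + 178 / P.Ch) * N * l ^ 2 + 88 * l + 19 := by ring
      _ ≤ 264 * (76 + 178 / P.Ch) * N * l ^ 2 + 252 * l ^ 2 := by nlinarith
      _ ≤ _ := by rw [e2]; linarith
  · rw [e2]; linarith

theorem exists_roundsCost_le (hP : P.Valid) : ∃ B : ℝ, 0 < B ∧ ∀ n m : ℕ, 2 ≤ n →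
    ((m * (2 * searchCost n ⌈20 * Real.log n⌉₊ ⌊(n : ℝ) * P.bandwidth n⌋₊ + 7) + 27 : ℕ) : ℝ) ≤
      (m + 1) * (B * (n * P.bandwidth n * Real.log n ^ 2)) := by
  obtain ⟨B, hB, h⟩ := hP.exists_roundCost_le
  refine ⟨B, hB, fun n m hn => ?_⟩
  obtain ⟨h1, h2⟩ := h n hn
  rw [Nat.cast_add, Nat.cast_mul, add_mul, one_mul]
  push_cast at h1 ⊢
  gcongr

theorem numReps_eq (P : Params) (n : ℕ) (α : ℝ) :
    P.numReps n α = 2 * Real.log (2 / α) / P.bandwidth n := by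
  unfold Params.numReps
  rw [← inv_div α 2, Real.log_inv]; ring

theorem log_two_div_pos {α : ℝ} (hα : 0 < α) (hα1 : α < 1) : 0 < Real.log (2 / α) := by
  apply Real.log_pos
  rw [lt_div_iff₀ hα]; linarith

theorem exists_worstCase (hP : P.Valid) {α : ℝ} (hα : 0 < α) (hα1 : α < 1) :
    ∃ A : ℝ, 0 < A ∧ ∀ n : ℕ, 2 ≤ n → ∀ y : Finset.Icc 1 n → ℝ,
      ∀ r ∈ (fomtLaw P α n y).support, (r.2 : ℝ) ≤ A * (n * Real.log n ^ 2) := by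
  obtain ⟨B, hB, h⟩ := hP.exists_roundsCost_le
  have hc := log_two_div_pos hα hα1
  have hC := hP.Ch_pos
  refine ⟨B * (2 * Real.log (2 / α) + 2 * P.Ch), by positivity, fun n hn y r hr => ?_⟩
  have h1 := (ensures_fomt P α n r hr).2
  have h2 := h n ⌈P.numReps n α⌉₊ hn
  have hh := hP.bandwidth_pos hn
  have hl := half_le_log hn
  have hle := hP.bandwidth_le hn
  have hm : (⌈P.numReps n α⌉₊ : ℝ) ≤ 2 * Real.log (2 / α) / P.bandwidth n + 1 := by
    rw [← numReps_eq]
    refine (Nat.ceil_lt_add_one ?_).le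
    rw [numReps_eq]; positivity
  calc (r.2 : ℝ) ≤ _ := by exact_mod_cast h1
    _ ≤ _ := h2
    _ ≤ (2 * Real.log (2 / α) / P.bandwidth n + 1 + 1) *
        (B * (n * P.bandwidth n * Real.log n ^ 2)) := by gcongr
    _ = B * (2 * Real.log (2 / α) + 2 * P.bandwidth n) * (n * Real.log n ^ 2) := by
        field_simp; ring
    _ ≤ _ := by gcongr

/-- The cost of the `⌈2 log (2 / α) / ε⌉` rounds that detect a violation with probability
`1 - α / 2` if a proportion `ε / 2` of the rounds is successful. -/
theorem exists_detectionCost (hP : P.Valid) {α : ℝ} (hα : 0 < α) (hα1 : α < 1) :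
    ∃ A : ℝ, 0 < A ∧ ∀ n : ℕ, 2 ≤ n → ∀ ε : ℝ, 0 < ε → ε ≤ 1 →
      (roundsCost P n ⌈2 * Real.log (2 / α) / ε⌉₊ : ℝ) ≤
        A * (ε⁻¹ * (n : ℝ) ^ (2 * P.β / (2 * P.β + 1)) *
          Real.log n ^ ((4 * P.β + 3) / (2 * P.β + 1))) := by
  obtain ⟨B, hB, h⟩ := hP.exists_roundsCost_le
  have hc := log_two_div_pos hα hα1
  have hC := hP.Ch_pos
  have hβ := hP.β_pos
  refine ⟨(2 * Real.log (2 / α) + 2) * (B * P.Ch), by positivity, fun n hn ε hε hε1 => ?_⟩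
  have h2 := h n ⌈2 * Real.log (2 / α) / ε⌉₊ hn
  have hl := half_le_log hn
  have hl0 : 0 < Real.log n := by linarith
  have hn0 : (0 : ℝ) < n := by positivity
  have hm : (⌈2 * Real.log (2 / α) / ε⌉₊ : ℝ) ≤ 2 * Real.log (2 / α) / ε + 1 :=
    (Nat.ceil_lt_add_one (by positivity)).le
  have h1ε : 1 ≤ 1 / ε := (one_le_div hε).2 hε1
  have hm' : (⌈2 * Real.log (2 / α) / ε⌉₊ : ℝ) + 1 ≤ (2 * Real.log (2 / α) + 2) * ε⁻¹ := by
    have : (2 * Real.log (2 / α) + 2) * ε⁻¹ = 2 * Real.log (2 / α) / ε + 2 * (1 / ε) := by ring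
    linarith
  have hcost : n * P.bandwidth n * Real.log n ^ 2 = P.Ch * ((n : ℝ) ^ (2 * P.β / (2 * P.β + 1)) *
      Real.log n ^ ((4 * P.β + 3) / (2 * P.β + 1))) := by
    have e1 : 2 * P.β / (2 * P.β + 1) = 1 - 1 / (2 * P.β + 1) := by field_simp; ring
    have e2 : (4 * P.β + 3) / (2 * P.β + 1) = 1 / (2 * P.β + 1) + 2 := by field_simp; ring
    rw [e1, e2, Real.rpow_sub hn0, Real.rpow_one, Real.rpow_add hl0, Real.rpow_two]
    unfold Params.bandwidth
    rw [Real.div_rpow hl0.le hn0.le]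
    ring
  calc (roundsCost P n ⌈2 * Real.log (2 / α) / ε⌉₊ : ℝ) ≤ _ :=
        Nat.cast_le.2 (by unfold roundsCost; omega)
    _ ≤ _ := h2
    _ ≤ ((2 * Real.log (2 / α) + 2) * ε⁻¹) * (B * (n * P.bandwidth n * Real.log n ^ 2)) := by
        have := hP.bandwidth_pos hn
        gcongr
    _ = _ := by rw [hcost]; ring

end Params.Valid

/-! ### From good design points to detection -/

theorem mul_one_sub_le_lintegral {Ω : Type*} [MeasurableSpace Ω] (μ : Measure Ω)
    [IsProbabilityMeasure μ] {F : Ω → ℝ≥0∞} {c δ : ℝ≥0∞} {G : Set Ω} (hF : ∀ y ∈ G, c ≤ F y)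
    (hG : μ Gᶜ ≤ δ) : c * (1 - δ) ≤ ∫⁻ y, F y ∂μ := by
  set G' := (toMeasurable μ Gᶜ)ᶜ
  have hG' : MeasurableSet G' := (measurableSet_toMeasurable _ _).compl
  have hsub : G' ⊆ G := by
    rw [← Set.compl_subset_compl, compl_compl]
    exact subset_toMeasurable _ _
  calc c * (1 - δ) ≤ c * μ G' := by
        gcongr
        rw [prob_compl_eq_one_sub (measurableSet_toMeasurable _ _), measure_toMeasurable]
        gcongr
    _ = ∫⁻ y, G'.indicator (fun _ => c) y ∂μ := (lintegral_indicator_const hG' c).symm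
    _ ≤ _ := by
        refine lintegral_mono fun y => ?_
        by_cases hy : y ∈ G'
        · rw [Set.indicator_of_mem hy]; exact hF y (hsub hy)
        · rw [Set.indicator_of_notMem hy]; exact zero_le

open Classical in
/-- The design points that are good for the data `y`. -/
noncomputable def goodSet (P : Params) (α : ℝ) (n : ℕ) (y : ℕ → ℝ) : Finset ℕ :=
  (Finset.Icc 1 n).filter (IsGood P α n y)

theorem mem_goodSet {P : Params} {α : ℝ} {n : ℕ} {y : ℕ → ℝ} {I : ℕ} :
    I ∈ goodSet P α n y ↔ IsGood P α n y I := by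
  simp only [goodSet, Finset.mem_filter, and_iff_right_iff_imp, Finset.mem_Icc]
  exact fun h => ⟨h.1, by have := h.2.1; omega⟩

/-- If with high probability the proportion of good design points is at least `3 ε / 5`, then FOMT
detects a violation within `⌈2 log (2 / α) / ε⌉` rounds with probability at least `1 - α`. -/
theorem Params.Valid.detectProb_ge {P : Params} (hP : P.Valid) {α : ℝ} (hα : 0 < α) (hα1 : α < 1)
    {n : ℕ} (hn : 2 ≤ n) (f : ℝ → ℝ) {ε b : ℝ} (hε : P.bandwidth n ≤ ε)
    (hη : (3 / 4 : ℝ) ^ ⌈20 * Real.log n⌉₊ ≤ 1 / 6)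
    (hb : (roundsCost P n ⌈2 * Real.log (2 / α) / ε⌉₊ : ℝ) ≤ b)
    (hprob : dataLaw n P.σ f {y | 3 / 5 * ε * n ≤ ((goodSet P α n (obs y)).card : ℝ)}ᶜ ≤
      ENNReal.ofReal (α / 2)) :
    ENNReal.ofReal (1 - α) ≤ detectProb P α n f b := by
  have hh := hP.bandwidth_pos hn
  have hε0 : 0 < ε := hh.trans_le hε
  have hn0 : (0 : ℝ) < n := by positivity
  have hlog := Params.Valid.log_two_div_pos hα hα1
  have hm : ⌈2 * Real.log (2 / α) / ε⌉₊ ≤ ⌈P.numReps n α⌉₊ := by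
    apply Nat.ceil_le_ceil
    rw [Params.Valid.numReps_eq]
    gcongr
  have key : ∀ y ∈ {y : Finset.Icc 1 n → ℝ | 3 / 5 * ε * n ≤ ((goodSet P α n (obs y)).card : ℝ)},
      ENNReal.ofReal (1 - α / 2) ≤
        (fomtLaw P α n y).toMeasure {r : Bool × ℕ | r.1 = true ∧ (r.2 : ℝ) ≤ b} := by
    intro y hy
    refine le_trans ?_ (one_sub_le_fomtLaw P hP.K_support hP.β_le α y (by omega) hh
      (goodSet P α n (obs y)) (fun I hI => mem_goodSet.1 hI) hm hb)
    have hle : 1 - ((goodSet P α n (obs y)).card : ℝ) / n * (1 - (3 / 4) ^ ⌈20 * Real.log n⌉₊) ≤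
        Real.exp (-(ε / 2)) := by
      have h1 : 3 / 5 * ε ≤ ((goodSet P α n (obs y)).card : ℝ) / n := by
        rw [le_div_iff₀ hn0]; exact hy
      have h2 := Real.add_one_le_exp (-(ε / 2))
      nlinarith
    have hpow : ENNReal.ofReal (1 - ((goodSet P α n (obs y)).card : ℝ) / n *
        (1 - (3 / 4) ^ ⌈20 * Real.log n⌉₊)) ^ ⌈2 * Real.log (2 / α) / ε⌉₊ ≤
        ENNReal.ofReal (α / 2) := by
      refine (pow_le_pow_left' (ENNReal.ofReal_le_ofReal hle) _).trans ?_
      rw [← ENNReal.ofReal_pow (Real.exp_pos _).le, ← Real.exp_nat_mul]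
      refine ENNReal.ofReal_le_ofReal ?_
      rw [← Real.exp_log (show 0 < α / 2 by positivity), Real.exp_le_exp]
      have h3 := Nat.le_ceil (2 * Real.log (2 / α) / ε)
      rw [div_le_iff₀ hε0] at h3
      rw [← inv_div 2 α, Real.log_inv]
      linarith
    rw [ENNReal.ofReal_sub _ (by positivity), ENNReal.ofReal_one]
    gcongr
  refine le_trans ?_ (mul_one_sub_le_lintegral _ key hprob)
  rw [← ENNReal.ofReal_one, ← ENNReal.ofReal_sub _ (by positivity),
    ← ENNReal.ofReal_mul (by linarith)]
  apply ENNReal.ofReal_le_ofReal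
  nlinarith [sq_nonneg α]

theorem eventually_search_fail : ∀ᶠ n : ℕ in atTop, (3 / 4 : ℝ) ^ ⌈20 * Real.log n⌉₊ ≤ 1 / 6 := by
  have h : Tendsto (fun n : ℕ => ⌈20 * Real.log n⌉₊) atTop atTop :=
    tendsto_nat_ceil_atTop.comp
      ((Real.tendsto_log_atTop.comp tendsto_natCast_atTop_atTop).const_mul_atTop (by norm_num))
  exact (((tendsto_pow_atTop_nhds_zero_of_lt_one (by norm_num) (by norm_num)).comp
    h).eventually_lt_const (by norm_num : (0 : ℝ) < 1 / 6)).mono fun n hn => le_of_lt hn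

/-! ### Counting violations -/

open Classical in
/-- If `R` holds for half of the numbers in `{1, …, d}`, then it holds for a quarter of the numbers
in a searched range of length comparable to `d`. -/
theorem isHeavy_of_half {R : ℕ → Prop} {d m : ℕ} (hd : 1 ≤ d) (hdm : d ≤ m)
    (h : d ≤ 2 * ((Finset.Icc 1 d).filter R).card) : IsHeavy R m := by
  refine ⟨Nat.clog 2 d, ?_, ?_⟩
  · rcases hd.eq_or_lt with rfl | hd2
    · simp
    have hlt := Nat.pow_pred_clog_lt_self one_lt_two hd2
    have hpos := Nat.clog_pos one_lt_two hd2
    have h1 : (2 : ℝ) ^ (Nat.clog 2 d).pred < m := by exact_mod_cast hlt.trans_le hdm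
    have h2 := Real.log_lt_log (by positivity) h1
    rw [Real.log_pow, ← lt_div_iff₀ (Real.log_pos one_lt_two)] at h2
    have h3 : (Nat.clog 2 d).pred < ⌈Real.log m / Real.log 2⌉₊ := Nat.lt_ceil.2 h2
    have := Nat.pred_eq_sub_one (n := Nat.clog 2 d)
    omega
  · have h1 : d ≤ 2 ^ Nat.clog 2 d ⊓ m := le_min (Nat.le_pow_clog one_lt_two d) hdm
    have h2 : 2 ^ Nat.clog 2 d ≤ 2 * d := by
      rcases hd.eq_or_lt with rfl | hd2
      · simp
      have hlt := Nat.pow_pred_clog_lt_self one_lt_two hd2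
      have hpos := Nat.clog_pos one_lt_two hd2
      obtain ⟨s, hs⟩ := Nat.exists_eq_succ_of_ne_zero hpos.ne'
      rw [hs] at hlt ⊢
      rw [Nat.pred_succ] at hlt
      rw [pow_succ]; omega
    have h3 : ((Finset.Icc 1 d).filter R).card ≤
        ((Finset.Icc 1 (2 ^ Nat.clog 2 d ⊓ m)).filter R).card :=
      Finset.card_le_card (Finset.filter_subset_filter _ (Finset.Icc_subset_Icc_right h1))
    have := min_le_left (2 ^ Nat.clog 2 d) m
    omega

/-- If every index between `i` and `j` forms a violating pair with `i` or with `j`, then one of `i`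
and `j` forms violating pairs with half of these indices. -/
theorem isHeavy_or_isHeavy {R : ℕ → ℕ → Prop} {i j n : ℕ} (hi : 1 ≤ i) (hij : i < j) (hj : j ≤ n)
    (hR : R i j) (h : ∀ k, i < k → k < j → R i k ∨ R k j) :
    IsHeavy (fun J => R i (i + J)) (n - i) ∨ IsHeavy (fun J => R (j - J) j) (j - 1) := by
  classical
  set d := j - i with hd
  set A := (Finset.Icc 1 d).filter fun J => R i (i + J) with hA
  set B := (Finset.Icc 1 d).filter fun J => R (j - J) j with hB
  have hsub : Finset.Icc 1 d ⊆ A ∪ B.image (d - ·) := by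
    intro J hJ
    rw [Finset.mem_Icc] at hJ
    rw [Finset.mem_union, Finset.mem_image]
    rcases hJ.2.eq_or_lt with h1 | h1
    · left
      rw [hA, Finset.mem_filter, Finset.mem_Icc]
      refine ⟨hJ, ?_⟩
      have : i + J = j := by omega
      rwa [this]
    · rcases h (i + J) (by omega) (by omega) with h2 | h2
      · exact Or.inl (by rw [hA, Finset.mem_filter, Finset.mem_Icc]; exact ⟨hJ, h2⟩)
      · refine Or.inr ⟨d - J, ?_, by omega⟩
        rw [hB, Finset.mem_filter, Finset.mem_Icc]
        refine ⟨by omega, ?_⟩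
        have : j - (d - J) = i + J := by omega
        rwa [this]
  have hcard : d ≤ A.card + B.card := by
    calc d = (Finset.Icc 1 d).card := by simp
      _ ≤ (A ∪ B.image (d - ·)).card := Finset.card_le_card hsub
      _ ≤ A.card + (B.image (d - ·)).card := Finset.card_union_le _ _
      _ ≤ _ := Nat.add_le_add_left Finset.card_image_le _
  rcases le_total B.card A.card with h1 | h1
  · left
    exact isHeavy_of_half (d := d) (by omega) (by omega) (by rw [← hA]; omega)
  · right
    exact isHeavy_of_half (d := d) (by omega) (by omega) (by rw [← hB]; omega)

/-! ### Exceedance fractions -/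

/-- The cells `((i - 1) / n, i / n]` with `i ∈ H` have total length `|H| / n`. -/
theorem volume_le_of_ceil_mem {n : ℕ} (hn : 0 < n) (H : Finset ℕ) {s : Set ℝ}
    (hs : ∀ x ∈ s, 0 ≤ x ∧ (0 < x → ⌈(n : ℝ) * x⌉₊ ∈ H)) :
    volume s ≤ ENNReal.ofReal ((H.card : ℝ) / n) := by
  have hn0 : (0 : ℝ) < n := by exact_mod_cast hn
  have hcover : s ⊆ {0} ∪ ⋃ i ∈ H, Set.Ioc (((i : ℝ) - 1) / n) (i / n) := by
    intro x hx
    obtain ⟨h0, h1⟩ := hs x hx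
    rcases h0.eq_or_lt with rfl | h0
    · exact Or.inl rfl
    · refine Or.inr (Set.mem_biUnion (h1 h0) ⟨?_, ?_⟩)
      · rw [div_lt_iff₀ hn0]
        have := Nat.ceil_lt_add_one (mul_pos hn0 h0).le
        linarith
      · rw [le_div_iff₀ hn0]
        have := Nat.le_ceil ((n : ℝ) * x)
        linarith
  calc volume s ≤ volume ({0} ∪ ⋃ i ∈ H, Set.Ioc (((i : ℝ) - 1) / n) (i / n)) :=
        measure_mono hcover
    _ ≤ volume {(0 : ℝ)} + ∑ i ∈ H, volume (Set.Ioc (((i : ℝ) - 1) / n) (i / n)) :=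
        (measure_union_le _ _).trans (by gcongr; exact measure_biUnion_finset_le _ _)
    _ = H.card * ENNReal.ofReal (1 / n) := by
        rw [Real.volume_singleton, zero_add, Finset.sum_congr rfl (g := fun _ =>
          ENNReal.ofReal (1 / n)) fun i _ => ?_, Finset.sum_const, nsmul_eq_mul]
        rw [Real.volume_Ioc]; congr 1; ring
    _ = _ := by
        rw [div_eq_mul_one_div (H.card : ℝ), ENNReal.ofReal_mul (by positivity), ENNReal.ofReal_natCast]

theorem exceedanceZero_le_one (γ : ℝ) (f : ℝ → ℝ) : exceedanceZero γ f ≤ 1 := by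
  refine (iInf_le _ ⟨fun _ => 0, monotoneOn_const⟩).trans ?_
  calc _ ≤ volume (Set.Icc (0 : ℝ) 1) := measure_mono fun x hx => hx.1
    _ = 1 := by simp

theorem exceedanceOne_le_one (γ : ℝ) (f : ℝ → ℝ) : exceedanceOne γ f ≤ 1 :=
  calc _ ≤ volume (Set.Icc (0 : ℝ) 1) := measure_mono fun x hx => hx.1
    _ = 1 := by simp

/-- If deleting the cells with indices in `H` leaves no drop of more than `2 γ`, then `f` is within
`γ` of a monotone function outside these cells: the running maximum of `f - γ` over the remaining
points. -/
theorem exceedanceZero_le_of_hitting {n : ℕ} (hn : 0 < n) (H : Finset ℕ) {f : ℝ → ℝ} {γ c : ℝ}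
    (hγ : 0 ≤ γ)
    (hosc : ∀ x ∈ Set.Icc (0 : ℝ) 1, ∀ y ∈ Set.Icc (0 : ℝ) 1, f x - f y ≤ c)
    (hH : ∀ x y : ℝ, 0 < x → x < y → y ≤ 1 → ⌈(n : ℝ) * x⌉₊ ∉ H → ⌈(n : ℝ) * y⌉₊ ∉ H →
      f x - f y ≤ 2 * γ) :
    exceedanceZero γ f ≤ ENNReal.ofReal ((H.card : ℝ) / n) := by
  set Q : Set ℝ := {y | 0 < y ∧ y ≤ 1 ∧ ⌈(n : ℝ) * y⌉₊ ∉ H} with hQ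
  have h0 : (0 : ℝ) ∈ Set.Icc (0 : ℝ) 1 := by simp
  set A : ℝ → Set ℝ := fun x => insert (f 0 - c - γ) ((fun y => f y - γ) '' (Q ∩ Set.Iic x)) with hA
  have hbdd : ∀ x, BddAbove (A x) := by
    refine fun x => BddAbove.insert _ ⟨f 0 + c - γ, ?_⟩
    rintro _ ⟨y, ⟨hy, -⟩, rfl⟩
    have := hosc y ⟨hy.1.le, hy.2.1⟩ 0 h0
    change f y - γ ≤ _
    linarith
  have hmono : Monotone fun x => sSup (A x) := fun x x' hxx =>
    csSup_le_csSup (hbdd x') (Set.insert_nonempty _ _)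
      (Set.insert_subset_insert (Set.image_mono (Set.inter_subset_inter_right _
        (Set.Iic_subset_Iic.2 hxx))))
  refine (iInf_le _ ⟨fun x => sSup (A x), hmono.monotoneOn _⟩).trans
    (volume_le_of_ceil_mem hn H ?_)
  rintro x ⟨hx, hxγ⟩
  refine ⟨hx.1, fun hx0 => by_contra fun hxH => ?_⟩
  have hxQ : x ∈ Q := ⟨hx0, hx.2, hxH⟩
  have h1 : f x - γ ≤ sSup (A x) :=
    le_csSup (hbdd x) (Set.mem_insert_of_mem _ ⟨x, ⟨hxQ, Set.mem_Iic.2 le_rfl⟩, rfl⟩)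
  have h2 : sSup (A x) ≤ f x + γ := by
    refine csSup_le (Set.insert_nonempty _ _) ?_
    rintro _ (rfl | ⟨y, ⟨hy, hyx⟩, rfl⟩)
    · have := hosc 0 h0 x hx
      linarith
    · change f y - γ ≤ _
      rcases (Set.mem_Iic.1 hyx).eq_or_lt with rfl | hlt
      · linarith
      · have := hH y x hy.1 hlt hx.2 hy.2.2 hxH
        linarith
  have h3 : |f x - sSup (A x)| ≤ γ := abs_le.2 ⟨by linarith, by linarith⟩
  exact absurd hxγ (not_lt.2 h3)

/-- If `f (a + t) - f (b - t) > 2 γ` for all `t ∈ [0, h)`, then of any two points `a + t`, `b - t`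
at least one is far from a given monotone function. -/
theorem le_exceedanceZero {f : ℝ → ℝ} {γ a b h : ℝ} (ha : 0 ≤ a) (hb : b ≤ 1) (hab : 2 * h < b - a)
    (hf : ∀ t, 0 ≤ t → t < h → 2 * γ < f (a + t) - f (b - t)) :
    ENNReal.ofReal h ≤ exceedanceZero γ f := by
  refine le_iInf fun ⟨g, hg⟩ => ?_
  set E : Set ℝ := {x | x ∈ Set.Icc (0 : ℝ) 1 ∧ γ < |f x - g x|}
  have hsub : Set.Ico 0 h ⊆ (fun t => a + t) ⁻¹' (E ∩ Set.Ico a (a + h)) ∪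
      (fun t => b - t) ⁻¹' (E \ Set.Ico a (a + h)) := by
    intro t ht
    by_contra hcon
    rw [Set.mem_union, not_or] at hcon
    obtain ⟨h1, h2⟩ := hcon
    have hm1 : a + t ∈ Set.Icc (0 : ℝ) 1 := ⟨by linarith [ht.1], by linarith [ht.1, ht.2]⟩
    have hm2 : b - t ∈ Set.Icc (0 : ℝ) 1 := ⟨by linarith [ht.1, ht.2], by linarith [ht.1]⟩
    have e1 : |f (a + t) - g (a + t)| ≤ γ := by
      by_contra hlt
      exact h1 ⟨⟨hm1, not_le.1 hlt⟩, by linarith [ht.1], by linarith [ht.2]⟩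
    have e2 : |f (b - t) - g (b - t)| ≤ γ := by
      by_contra hlt
      exact h2 ⟨⟨hm2, not_le.1 hlt⟩, fun hmem => by linarith [ht.1, ht.2, hmem.2]⟩
    have e3 := hg hm1 hm2 (by linarith [ht.1, ht.2])
    have e4 := hf t ht.1 ht.2
    rw [abs_le] at e1 e2
    linarith [e1.2, e2.1]
  calc ENNReal.ofReal h = volume (Set.Ico 0 h) := by rw [Real.volume_Ico, sub_zero]
    _ ≤ volume ((fun t => a + t) ⁻¹' (E ∩ Set.Ico a (a + h))) +
        volume ((fun t => b - t) ⁻¹' (E \ Set.Ico a (a + h))) :=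
        (measure_mono hsub).trans (measure_union_le _ _)
    _ = volume (E ∩ Set.Ico a (a + h)) + volume (E \ Set.Ico a (a + h)) := by
        rw [measure_preimage_add]
        congr 1
        exact (Measure.measurePreserving_sub_left volume b).measure_preimage_equiv
          (f := MeasurableEquiv.subLeft b) _
    _ = volume E := measure_inter_add_sdiff _ measurableSet_Ico

/-! ### Large sample sizes -/

/-- The properties of a sufficiently large sample size `n` that the analysis uses. -/
structure Params.Large (P : Params) (α : ℝ) (n : ℕ) : Prop where
  two_le : 2 ≤ n
  bandwidth_le : P.bandwidth n ≤ 1 / 100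
  le_mul_bandwidth : 100 ≤ n * P.bandwidth n
  gram : ∀ x ∈ Set.Icc (0 : ℝ) 1, (gram P.K P.order n (P.bandwidth n) x -
    P.lam0 • (1 : Matrix (Fin (P.order + 1)) (Fin (P.order + 1)) ℝ)).PosSemidef
  scale_nonneg : 0 ≤ P.critScale n α
  scale_le : P.critScale n α ≤
    P.σ * √(4 * P.W / P.Ch ^ (2 * P.β + 1)) * P.bandwidth n ^ (P.β - 1)
  search : (3 / 4 : ℝ) ^ ⌈20 * Real.log n⌉₊ ≤ 1 / 6
  two_div_le : 2 / (n : ℝ) ≤ α / 2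

theorem Params.Valid.eventually_large {P : Params} (hP : P.Valid) {α : ℝ} (hα : 0 < α)
    (hα1 : α < 1) : ∀ᶠ n : ℕ in atTop, P.Large α n := by
  obtain ⟨n₀, hn₀⟩ := hP.eigenBound.2 P.bandwidth hP.tendsto_bandwidth hP.tendsto_mul_bandwidth
  have h4 : ∀ᶠ n : ℕ in atTop, 2 / (n : ℝ) ≤ α / 2 :=
    ((tendsto_const_div_atTop_nhds_zero_nat 2).eventually_lt_const (half_pos hα)).mono
      fun n hn => le_of_lt hn
  filter_upwards [eventually_ge_atTop 2,
    hP.tendsto_bandwidth.eventually_lt_const (by norm_num : (0 : ℝ) < 1 / 100),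
    hP.tendsto_mul_bandwidth.eventually_ge_atTop 100, eventually_ge_atTop n₀,
    hP.eventually_scale_le hα hα1, eventually_search_fail, h4] with n h1 h2 h3 h4 h5 h6 h7
  exact ⟨h1, h2.le, h3, fun x hx => hn₀ n h4 x hx, h5.1, h5.2, h6, h7⟩

theorem kernelSum_le {K : ℝ → ℝ} {Kmax : ℝ} (hK : ∀ u, 1 < |u| → K u = 0) (hKmax : ∀ u, K u ≤ Kmax)
    (hK0 : 0 ≤ Kmax) {n i : ℕ} {h : ℝ} (hn : 0 < n) (hh : 0 < h) :
    ∑ l ∈ Finset.Icc 1 n, K (((l : ℝ) / n - (i : ℝ) / n) / h) ≤ (2 * (n * h) + 1) * Kmax := by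
  have h1 := sum_window (i := i) hK hn hh fun _ => 1
  simp only [mul_one] at h1
  rw [← h1]
  refine (Finset.sum_le_card_nsmul _ _ Kmax fun l _ => hKmax _).trans ?_
  rw [nsmul_eq_mul, Nat.card_Ico]
  refine mul_le_mul_of_nonneg_right ?_ hK0
  have h2 := Nat.floor_le (show 0 ≤ (n : ℝ) * h by positivity)
  have h3 : (1 ⊔ (i - ⌊(n : ℝ) * h⌋₊)) + ((n ⊓ (i + ⌊(n : ℝ) * h⌋₊)) + 1 -
      (1 ⊔ (i - ⌊(n : ℝ) * h⌋₊))) - (1 ⊔ (i - ⌊(n : ℝ) * h⌋₊)) ≤ 2 * ⌊(n : ℝ) * h⌋₊ + 1 := by omega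
  have h4 : ((2 * ⌊(n : ℝ) * h⌋₊ + 1 : ℕ) : ℝ) ≤ 2 * (n * h) + 1 := by push_cast; linarith
  exact (Nat.cast_le.2 h3).trans h4

theorem div_mem_Icc {n i : ℕ} (hi : i ∈ Finset.Icc 1 n) : (i : ℝ) / n ∈ Set.Icc (0 : ℝ) 1 := by
  rw [Finset.mem_Icc] at hi
  have : (0 : ℝ) < n := by exact_mod_cast (by omega : 0 < n)
  exact ⟨by positivity, (div_le_one this).2 (by exact_mod_cast hi.2)⟩

namespace Params.Large

variable {P : Params} {α : ℝ} {n : ℕ}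

theorem natCast_pos (hL : P.Large α n) : (0 : ℝ) < n := by
  exact_mod_cast lt_of_lt_of_le two_pos hL.two_le

theorem kernelSum_ge (hL : P.Large α n) {x : ℝ} (hx : x ∈ Set.Icc (0 : ℝ) 1) :
    P.lam0 * (n * P.bandwidth n) ≤ ∑ l ∈ Finset.Icc 1 n, P.K (((l : ℝ) / n - x) / P.bandwidth n) :=
  FOMT.kernelSum_ge (by linarith [hL.le_mul_bandwidth]) (hL.gram x hx)

theorem lam0_le (hL : P.Large α n) (hP : P.Valid) : P.lam0 ≤ 3 * P.Kmax := by
  have hn : 0 < n := by have := hL.two_le; omega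
  have h1 := hL.kernelSum_ge (div_mem_Icc (n := n) (i := 1) (by simp; omega))
  have h2 := kernelSum_le (i := 1) hP.K_support hP.K_le hP.Kmax_pos.le hn
    (hP.bandwidth_pos hL.two_le)
  have h3 := hL.le_mul_bandwidth
  have h4 := hP.Kmax_pos
  by_contra hlt
  rw [not_le] at hlt
  nlinarith

/-- `W ≥ 256 (Kmax / λ₀)²`, and `Kmax / λ₀ ≥ 1 / 3`. -/
theorem W_ge (hL : P.Large α n) (hP : P.Valid) : 256 / 3 * (P.Kmax / P.lam0) ≤ P.W := by
  have h1 := hL.lam0_le hP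
  have h2 := hP.lam0_pos
  have h3 : 1 / 3 ≤ P.Kmax / P.lam0 := by rw [le_div_iff₀ h2]; linarith
  refine le_trans ?_ (Params.Valid.W_ge P)
  have : P.Cstar = 8 * (P.Kmax / P.lam0) := by unfold Params.Cstar; ring
  rw [this]
  nlinarith

theorem twentyeight_le_W (hL : P.Large α n) (hP : P.Valid) : 28 ≤ P.W := by
  have h1 := hL.lam0_le hP
  have h2 := hP.lam0_pos
  have h3 : 1 / 3 ≤ P.Kmax / P.lam0 := by rw [le_div_iff₀ h2]; linarith
  linarith [hL.W_ge hP]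

/-- The relation between bandwidth and sample size: `h_n ^ (2 β) / C_h ^ (2 β + 1) = log n / (n h_n)`. -/
theorem bandwidth_sq (hL : P.Large α n) (hP : P.Valid) :
    (P.bandwidth n ^ P.β) ^ 2 / P.Ch ^ (2 * P.β + 1) = Real.log n / (n * P.bandwidth n) := by
  have hh := hP.bandwidth_pos hL.two_le
  have hn := hL.natCast_pos
  have h1 := hP.bandwidth_rpow hL.two_le
  rw [Real.rpow_add hh, Real.rpow_one, mul_comm 2 P.β, Real.rpow_mul hh.le, Real.rpow_two,
    mul_comm P.β 2] at h1
  have hC : 0 < P.Ch ^ (2 * P.β + 1) := Real.rpow_pos_of_pos hP.Ch_pos _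
  rw [div_eq_div_iff hC.ne' (by positivity)]
  field_simp at h1
  linear_combination h1

theorem sqrt_mul_bandwidth_sq (hL : P.Large α n) (hP : P.Valid) {c : ℝ} (hc : 0 ≤ c) :
    (√(c * P.W / P.Ch ^ (2 * P.β + 1)) * P.bandwidth n ^ P.β) ^ 2 =
      c * P.W * (Real.log n / (n * P.bandwidth n)) := by
  have hW := hP.W_pos
  have hC : 0 < P.Ch ^ (2 * P.β + 1) := Real.rpow_pos_of_pos hP.Ch_pos _
  rw [mul_pow, Real.sq_sqrt (by positivity), ← hL.bandwidth_sq hP]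
  ring

end Params.Large

theorem exp_neg_le_inv_sq {n : ℕ} (hn : 0 < n) {x : ℝ} (hx : 2 * Real.log n ≤ x) :
    Real.exp (-x) ≤ 1 / (n : ℝ) ^ 2 := by
  have hn0 : (0 : ℝ) < n := by exact_mod_cast hn
  rw [← Real.exp_log (show (0 : ℝ) < 1 / (n : ℝ) ^ 2 by positivity), Real.exp_le_exp, one_div,
    Real.log_inv, Real.log_pow]
  push_cast
  linarith

/-! ### Smoothness at most one: the local constant estimator -/

namespace Params.Large

variable {P : Params} {α : ℝ} {n : ℕ}

theorem holder_of_le (hP : P.Valid) (hβ : P.β ≤ 1) {f : ℝ → ℝ} (hf : f ∈ holderClass P.β P.L)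
    {x y : ℝ} (hx : x ∈ Set.Icc (0 : ℝ) 1) (hy : y ∈ Set.Icc (0 : ℝ) 1) :
    |f x - f y| ≤ P.L * |x - y| ^ P.β := by
  have h := hf.2 x hx y hy
  rw [hP.ceil_eq_one hβ] at h
  simpa using h

theorem biasConst_nonneg (hP : P.Valid) : 0 ≤ P.biasConst :=
  mul_nonneg ((zero_le_two).trans (le_max_right _ _)) hP.L_pos.le

theorem Cβ_of_le (P : Params) (hβ : P.β ≤ 1) : P.Cβ = P.biasConst + 4 * P.L +
    P.σ * (√(4 * P.W / P.Ch ^ (2 * P.β + 1)) + √(6 * P.W / P.Ch ^ (2 * P.β + 1))) := by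
  rw [Params.Cβ, if_pos hβ, Params.biasConst]; ring

theorem four_L_le_Cβ_of_le (hP : P.Valid) (hβ : P.β ≤ 1) : 4 * P.L ≤ P.Cβ := by
  rw [Cβ_of_le P hβ]
  have := biasConst_nonneg hP
  have := hP.σ_pos
  have : 0 ≤ P.σ * (√(4 * P.W / P.Ch ^ (2 * P.β + 1)) + √(6 * P.W / P.Ch ^ (2 * P.β + 1))) := by
    positivity
  linarith

/-- The weights of the local constant estimator at the design point with index `i`. -/
noncomputable def weight (P : Params) (n i l : ℕ) : ℝ :=
  P.K (((l : ℝ) / n - (i : ℝ) / n) / P.bandwidth n) /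
    ∑ l ∈ Finset.Icc 1 n, P.K (((l : ℝ) / n - (i : ℝ) / n) / P.bandwidth n)

theorem kernelSum_pos (hL : P.Large α n) (hP : P.Valid) {x : ℝ} (hx : x ∈ Set.Icc (0 : ℝ) 1) :
    0 < ∑ l ∈ Finset.Icc 1 n, P.K (((l : ℝ) / n - x) / P.bandwidth n) := by
  have h1 := hL.kernelSum_ge hx
  have h2 := hL.le_mul_bandwidth
  have h3 := hP.lam0_pos
  refine lt_of_lt_of_le ?_ h1
  have : 0 < n * P.bandwidth n := by linarith
  positivity

theorem weight_nonneg (hP : P.Valid) (i l : ℕ) : 0 ≤ weight P n i l :=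
  div_nonneg (hP.K_nonneg _) (Finset.sum_nonneg fun _ _ => hP.K_nonneg _)

theorem sum_weight (hL : P.Large α n) (hP : P.Valid) {i : ℕ} (hi : i ∈ Finset.Icc 1 n) :
    ∑ l ∈ Finset.Icc 1 n, weight P n i l = 1 := by
  unfold weight
  rw [← Finset.sum_div, div_self (hL.kernelSum_pos hP (div_mem_Icc hi)).ne']

theorem sum_weight_sq_le (hL : P.Large α n) (hP : P.Valid) {i : ℕ} (hi : i ∈ Finset.Icc 1 n) :
    ∑ l ∈ Finset.Icc 1 n, weight P n i l ^ 2 ≤ P.Kmax / (P.lam0 * (n * P.bandwidth n)) := by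
  have hS := hL.kernelSum_pos hP (div_mem_Icc hi)
  have hS' := hL.kernelSum_ge (div_mem_Icc hi)
  have hle : ∀ l, weight P n i l ≤ P.Kmax / (P.lam0 * (n * P.bandwidth n)) := fun l => by
    have h2 := hL.le_mul_bandwidth
    have h3 := hP.lam0_pos
    have h4 := hP.Kmax_pos
    have : 0 < n * P.bandwidth n := by linarith
    exact div_le_div₀ h4.le (hP.K_le _) (by positivity) hS'
  calc ∑ l ∈ Finset.Icc 1 n, weight P n i l ^ 2
      ≤ ∑ l ∈ Finset.Icc 1 n, P.Kmax / (P.lam0 * (n * P.bandwidth n)) * weight P n i l := by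
        refine Finset.sum_le_sum fun l _ => ?_
        rw [pow_two]
        exact mul_le_mul_of_nonneg_right (hle l) (weight_nonneg hP i l)
    _ = _ := by rw [← Finset.mul_sum, hL.sum_weight hP hi, mul_one]

theorem lpe_eq_sum_weight (hL : P.Large α n) (hP : P.Valid) (hβ : P.β ≤ 1) (y : ℕ → ℝ) (i : ℕ) :
    lpe P.K P.order n (P.bandwidth n) y ((i : ℝ) / n) =
      ∑ l ∈ Finset.Icc 1 n, weight P n i l * y l := by
  have ho : P.order = 0 := by rw [Params.order, hP.ceil_eq_one hβ]
  rw [ho, lpe_zero _ _ _ _ _ (by linarith [hL.le_mul_bandwidth]), Finset.sum_div]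
  exact Finset.sum_congr rfl fun l _ => by rw [weight]; ring

theorem weight_bias_le (hL : P.Large α n) (hP : P.Valid) (hβ : P.β ≤ 1) {f : ℝ → ℝ}
    (hf : f ∈ holderClass P.β P.L) {i : ℕ} (hi : i ∈ Finset.Icc 1 n) :
    |∑ l ∈ Finset.Icc 1 n, weight P n i l * f ((l : ℝ) / n) - f ((i : ℝ) / n)| ≤
      P.L * P.bandwidth n ^ P.β := by
  have hh := hP.bandwidth_pos hL.two_le
  have h1 : ∑ l ∈ Finset.Icc 1 n, weight P n i l * f ((l : ℝ) / n) - f ((i : ℝ) / n) =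
      ∑ l ∈ Finset.Icc 1 n, weight P n i l * (f ((l : ℝ) / n) - f ((i : ℝ) / n)) := by
    simp only [mul_sub, Finset.sum_sub_distrib, ← Finset.sum_mul, hL.sum_weight hP hi, one_mul]
  rw [h1]
  calc _ ≤ ∑ l ∈ Finset.Icc 1 n, |weight P n i l * (f ((l : ℝ) / n) - f ((i : ℝ) / n))| :=
        Finset.abs_sum_le_sum_abs _ _
    _ ≤ ∑ l ∈ Finset.Icc 1 n, weight P n i l * (P.L * P.bandwidth n ^ P.β) := by
        refine Finset.sum_le_sum fun l hl => ?_
        rw [abs_mul, abs_of_nonneg (weight_nonneg hP i l)]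
        by_cases hu : 1 < |((l : ℝ) / n - (i : ℝ) / n) / P.bandwidth n|
        · simp [weight, hP.K_support _ hu]
        · rw [not_lt, abs_div, abs_of_pos hh, div_le_one hh] at hu
          refine mul_le_mul_of_nonneg_left ?_ (weight_nonneg hP i l)
          refine (holder_of_le hP hβ hf (div_mem_Icc hl) (div_mem_Icc hi)).trans ?_
          have := hP.L_pos
          have := hP.β_pos
          gcongr
    _ = _ := by rw [← Finset.sum_mul, hL.sum_weight hP hi, one_mul]

/-- The bound for the noise of the local constant estimator that holds uniformly over the design
points with high probability. -/
noncomputable def noiseLevel (P : Params) (n : ℕ) : ℝ :=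
  P.σ * √(6 * P.W / P.Ch ^ (2 * P.β + 1)) * P.bandwidth n ^ P.β / 2

theorem noise_le (hL : P.Large α n) (hP : P.Valid) (f : ℝ → ℝ) :
    dataLaw n P.σ f {y | ∀ i ∈ Finset.Icc 1 n, |∑ l ∈ Finset.Icc 1 n,
      weight P n i l * (obs y l - f ((l : ℝ) / n))| ≤ noiseLevel P n}ᶜ ≤
      ENNReal.ofReal (α / 2) := by
  have hh := hP.bandwidth_pos hL.two_le
  have hn := hL.natCast_pos
  have hn' : 0 < n := by exact_mod_cast hn
  have hlam := hP.lam0_pos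
  have hKm := hP.Kmax_pos
  have hσ := hP.σ_pos
  have hN : 0 < n * P.bandwidth n := by positivity
  set V := P.Kmax / (P.lam0 * (n * P.bandwidth n)) with hV
  have ht : 0 ≤ noiseLevel P n := by unfold noiseLevel; positivity
  have key := noise_tail_iUnion n P.σ f (Finset.Icc 1 n ×ˢ ({1, -1} : Finset ℝ))
    (fun s l => s.2 * weight P n s.1 l) (V := V) ht hσ.ne' fun s hs => by
      rw [Finset.mem_product] at hs
      have : s.2 ^ 2 = 1 := by
        rcases Finset.mem_insert.1 hs.2 with h | h
        · rw [h]; norm_num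
        · rw [Finset.mem_singleton.1 h]; norm_num
      simp only [mul_pow, this, one_mul]
      exact hL.sum_weight_sq_le hP hs.1
  have hexp : Real.exp (-(noiseLevel P n ^ 2 / (2 * P.σ ^ 2 * V))) ≤ 1 / (n : ℝ) ^ 2 := by
    refine exp_neg_le_inv_sq hn' ?_
    have h1 : noiseLevel P n ^ 2 =
        P.σ ^ 2 / 4 * (6 * P.W * (Real.log n / (n * P.bandwidth n))) := by
      rw [← hL.sqrt_mul_bandwidth_sq hP (by norm_num : (0 : ℝ) ≤ 6), noiseLevel]; ring
    rw [h1, hV, le_div_iff₀ (by positivity)]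
    have h2 := hL.W_ge hP
    have h3 : 0 ≤ Real.log n := Real.log_natCast_nonneg n
    have h4 : 2 * Real.log n * (2 * P.σ ^ 2 * (P.Kmax / (P.lam0 * (n * P.bandwidth n)))) =
        P.σ ^ 2 * (Real.log n / (n * P.bandwidth n)) * (4 * (P.Kmax / P.lam0)) := by
      field_simp; ring
    have h5 : P.σ ^ 2 / 4 * (6 * P.W * (Real.log n / (n * P.bandwidth n))) =
        P.σ ^ 2 * (Real.log n / (n * P.bandwidth n)) * (6 / 4 * P.W) := by ring
    rw [h4, h5]
    have h6 : 0 < P.Kmax / P.lam0 := by positivity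
    exact mul_le_mul_of_nonneg_left (by linarith) (by positivity)
  refine (measure_mono ?_).trans (key.trans ?_)
  · intro y hy
    simp only [Set.mem_compl_iff, Set.mem_ofPred_eq, not_forall, not_le] at hy
    obtain ⟨i, hi, hlt⟩ := hy
    simp only [Set.mem_ofPred_eq]
    rcases lt_abs.1 hlt with h | h
    · exact ⟨(i, 1), by simpa using hi, by simpa using h⟩
    · refine ⟨(i, -1), by simpa using hi, ?_⟩
      simpa [Finset.sum_neg_distrib] using h
  · rw [Finset.card_product, Nat.card_Icc, Finset.card_pair (by norm_num), Nat.add_sub_cancel,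
      ← ENNReal.ofReal_natCast, ← ENNReal.ofReal_mul (by positivity)]
    refine ENNReal.ofReal_le_ofReal (le_trans ?_ hL.two_div_le)
    calc ((n * 2 : ℕ) : ℝ) * Real.exp (-(noiseLevel P n ^ 2 / (2 * P.σ ^ 2 * V)))
        ≤ ((n * 2 : ℕ) : ℝ) * (1 / (n : ℝ) ^ 2) := by gcongr
      _ = _ := by push_cast; field_simp

/-- Unless the noise is exceptionally large, the local test rejects if `f` drops by at least
`(C_β - 2 L) h ^ β`. -/
theorem rejects_of_drop (hL : P.Large α n) (hP : P.Valid) (hβ : P.β ≤ 1) {f : ℝ → ℝ}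
    (hf : f ∈ holderClass P.β P.L) {y : ℕ → ℝ}
    (hy : ∀ i ∈ Finset.Icc 1 n, |∑ l ∈ Finset.Icc 1 n,
      weight P n i l * (y l - f ((l : ℝ) / n))| ≤ noiseLevel P n) {i j : ℕ}
    (hi : i ∈ Finset.Icc 1 n) (hj : j ∈ Finset.Icc 1 n)
    (hd : (P.Cβ - 2 * P.L) * P.bandwidth n ^ P.β ≤ f ((i : ℝ) / n) - f ((j : ℝ) / n)) :
    P.Rejects n α y i j := by
  have hh := hP.bandwidth_pos hL.two_le
  have hest : ∀ i ∈ Finset.Icc 1 n, |lpe P.K P.order n (P.bandwidth n) y ((i : ℝ) / n) -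
      f ((i : ℝ) / n)| ≤ P.L * P.bandwidth n ^ P.β + noiseLevel P n := by
    intro i hi
    have h1 := hL.weight_bias_le hP hβ hf hi
    have h2 := hy i hi
    rw [hL.lpe_eq_sum_weight hP hβ]
    simp only [mul_sub, Finset.sum_sub_distrib] at h2
    rw [abs_le] at h1 h2 ⊢
    constructor <;> linarith [h1.1, h1.2, h2.1, h2.2]
  have e1 := hest i hi
  have e2 := hest j hj
  have hnoise : P.critNoise n α i j ≤
      P.σ * √(4 * P.W / P.Ch ^ (2 * P.β + 1)) * P.bandwidth n ^ P.β := by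
    have hpow : P.bandwidth n ^ P.β = P.bandwidth n ^ (P.β - 1) * P.bandwidth n := by
      rw [Real.rpow_sub_one hh.ne', div_mul_cancel₀ _ hh.ne']
    unfold Params.critNoise
    calc _ ≤ P.critScale n α * P.bandwidth n := by
          gcongr
          · exact hL.scale_nonneg
          · exact min_le_right _ _
      _ ≤ P.σ * √(4 * P.W / P.Ch ^ (2 * P.β + 1)) * P.bandwidth n ^ (P.β - 1) *
          P.bandwidth n := by gcongr; exact hL.scale_le
      _ = _ := by rw [hpow]; ring
  have hbias : P.critBias n i j ≤ P.biasConst * P.bandwidth n ^ P.β := by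
    unfold Params.critBias
    split_ifs
    · have := biasConst_nonneg hP; positivity
    · exact le_rfl
  rw [Params.Rejects, Params.critValue, Params.statistic]
  rw [Cβ_of_le P hβ] at hd
  unfold noiseLevel at e1 e2
  rw [abs_le] at e1 e2
  linarith [e1.1, e2.2]

/-- A drop of more than twice the detectable size makes the left design point right-heavy or the
right design point left-heavy. -/
theorem isGood_of_drop (hL : P.Large α n) (hP : P.Valid) (hβ : P.β ≤ 1) {f : ℝ → ℝ}
    (hf : f ∈ holderClass P.β P.L) {y : ℕ → ℝ}
    (hy : ∀ i ∈ Finset.Icc 1 n, |∑ l ∈ Finset.Icc 1 n,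
      weight P n i l * (y l - f ((l : ℝ) / n))| ≤ noiseLevel P n) {i j : ℕ}
    (hi : 1 ≤ i) (hij : i < j) (hj : j ≤ n)
    (hd : 2 * ((P.Cβ - 2 * P.L) * P.bandwidth n ^ P.β) < f ((i : ℝ) / n) - f ((j : ℝ) / n)) :
    IsGood P α n y i ∨ IsGood P α n y j ∨ j = n := by
  have hh := hP.bandwidth_pos hL.two_le
  have hpos : 0 ≤ (P.Cβ - 2 * P.L) * P.bandwidth n ^ P.β := by
    have := four_L_le_Cβ_of_le hP hβ
    have := hP.L_pos
    exact mul_nonneg (by linarith) (by positivity)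
  have hmem : ∀ k, i ≤ k → k ≤ j → k ∈ Finset.Icc 1 n := fun k h1 h2 =>
    Finset.mem_Icc.2 ⟨by omega, by omega⟩
  have hrej := fun {a b : ℕ} ha hb => hL.rejects_of_drop hP hβ hf hy (i := a) (j := b) ha hb
  rcases isHeavy_or_isHeavy (R := P.Rejects n α y) hi hij hj
    (hrej (hmem i le_rfl hij.le) (hmem j hij.le le_rfl) (by linarith)) fun k hk1 hk2 => by
      by_cases hk : (P.Cβ - 2 * P.L) * P.bandwidth n ^ P.β ≤ f ((i : ℝ) / n) - f ((k : ℝ) / n)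
      · exact Or.inl (hrej (hmem i le_rfl hij.le) (hmem k hk1.le hk2.le) hk)
      · exact Or.inr (hrej (hmem k hk1.le hk2.le) (hmem j hij.le le_rfl) (by linarith)) with h | h
  · exact Or.inl ⟨hi, by omega, Or.inl h⟩
  · rcases hj.eq_or_lt with rfl | hlt
    · exact Or.inr (Or.inr rfl)
    · exact Or.inr (Or.inl ⟨by omega, by omega, Or.inr ⟨by omega, h⟩⟩)

theorem exceedanceZero_le_goodSet (hL : P.Large α n) (hP : P.Valid) (hβ : P.β ≤ 1) {f : ℝ → ℝ}
    (hf : f ∈ holderClass P.β P.L) {y : ℕ → ℝ}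
    (hy : ∀ i ∈ Finset.Icc 1 n, |∑ l ∈ Finset.Icc 1 n,
      weight P n i l * (y l - f ((l : ℝ) / n))| ≤ noiseLevel P n) :
    exceedanceZero (P.γ n) f ≤ ENNReal.ofReal ((((goodSet P α n y).card : ℝ) + 1) / n) := by
  have hh := hP.bandwidth_pos hL.two_le
  have hn := hL.natCast_pos
  have hn' : 0 < n := by exact_mod_cast hn
  have hC := four_L_le_Cβ_of_le hP hβ
  have hLp := hP.L_pos
  have hβ0 := hP.β_pos
  have hhβ : 0 < P.bandwidth n ^ P.β := by positivity
  have hγ : P.γ n = P.Cβ * P.bandwidth n ^ P.β := by rw [Params.γ, hP.frac_of_le hβ]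
  have hcell : ∀ x : ℝ, 0 < x → x ≤ 1 → ⌈(n : ℝ) * x⌉₊ ∈ Finset.Icc 1 n ∧
      |f ((⌈(n : ℝ) * x⌉₊ : ℝ) / n) - f x| ≤ P.L * P.bandwidth n ^ P.β := by
    intro x hx0 hx1
    have hmem : ⌈(n : ℝ) * x⌉₊ ∈ Finset.Icc 1 n := by
      rw [Finset.mem_Icc]
      exact ⟨Nat.one_le_ceil_iff.2 (by positivity), Nat.ceil_le.2 (by nlinarith)⟩
    refine ⟨hmem, (holder_of_le hP hβ hf (div_mem_Icc hmem) ⟨hx0.le, hx1⟩).trans ?_⟩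
    have h1 := Nat.le_ceil ((n : ℝ) * x)
    have h2 := Nat.ceil_lt_add_one (show 0 ≤ (n : ℝ) * x by positivity)
    have : |(⌈(n : ℝ) * x⌉₊ : ℝ) / n - x| ≤ P.bandwidth n := by
      have e : (⌈(n : ℝ) * x⌉₊ : ℝ) / n - x = ((⌈(n : ℝ) * x⌉₊ : ℝ) - n * x) / n := by field_simp
      rw [e, abs_of_nonneg (div_nonneg (by linarith) hn.le), div_le_iff₀ hn]
      linarith [hL.le_mul_bandwidth, mul_comm (n : ℝ) (P.bandwidth n)]
    gcongr
  have hcard : ((insert n (goodSet P α n y)).card : ℝ) ≤ (goodSet P α n y).card + 1 := by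
    exact_mod_cast Finset.card_insert_le _ _
  refine le_trans (exceedanceZero_le_of_hitting hn' (insert n (goodSet P α n y)) (c := P.L) ?_ ?_ ?_)
    (ENNReal.ofReal_le_ofReal (by gcongr))
  · rw [hγ]; exact mul_nonneg (by linarith) hhβ.le
  · intro x hx z hz
    refine (le_abs_self _).trans ((holder_of_le hP hβ hf hx hz).trans ?_)
    have h1 : |x - z| ≤ 1 := abs_le.2 ⟨by linarith [hx.1, hz.2], by linarith [hx.2, hz.1]⟩
    have := Real.rpow_le_one (abs_nonneg _) h1 hβ0.le
    nlinarith
  · intro x z hx hxz hz hxH hzH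
    by_contra hlt
    rw [not_le, hγ] at hlt
    obtain ⟨m1, e1⟩ := hcell x hx (hxz.le.trans hz)
    obtain ⟨m2, e2⟩ := hcell z (hx.trans hxz) hz
    rw [abs_le] at e1 e2
    have hdrop : 2 * ((P.Cβ - 2 * P.L) * P.bandwidth n ^ P.β) <
        f ((⌈(n : ℝ) * x⌉₊ : ℝ) / n) - f ((⌈(n : ℝ) * z⌉₊ : ℝ) / n) := by
      nlinarith [e1.1, e2.2]
    have hle : ⌈(n : ℝ) * x⌉₊ ≤ ⌈(n : ℝ) * z⌉₊ := Nat.ceil_le_ceil (by gcongr)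
    rcases hle.eq_or_lt with heq | hlt'
    · rw [heq, sub_self] at hdrop
      have : 0 ≤ (P.Cβ - 2 * P.L) * P.bandwidth n ^ P.β := mul_nonneg (by linarith) hhβ.le
      linarith
    · rw [Finset.mem_insert, not_or] at hxH hzH
      rw [Finset.mem_Icc] at m1 m2
      rcases hL.isGood_of_drop hP hβ hf hy m1.1 hlt' m2.2 hdrop with h | h | h
      · exact hxH.2 (mem_goodSet.2 h)
      · exact hzH.2 (mem_goodSet.2 h)
      · exact hzH.1 h

theorem bandwidth_le_exceedanceZero (hL : P.Large α n) (hP : P.Valid) (hβ : P.β ≤ 1) {f : ℝ → ℝ}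
    (hf : f ∈ alternatives P.β P.L (P.sepConst * P.sepRate n)) :
    ENNReal.ofReal (P.bandwidth n) ≤ exceedanceZero (P.γ n) f := by
  obtain ⟨hf, hdrop⟩ := hf
  rw [if_pos hβ, hP.sepConst_mul_sepRate hL.two_le, hP.frac_of_le hβ] at hdrop
  obtain ⟨a, b, ha, hab, hb, hd⟩ := hdrop
  have hh := hP.bandwidth_pos hL.two_le
  have hC := four_L_le_Cβ_of_le hP hβ
  have hLp := hP.L_pos
  have hβ0 := hP.β_pos
  have hhβ : 0 < P.bandwidth n ^ P.β := by positivity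
  have hab2 : 2 * P.bandwidth n < b - a := by
    by_contra hle
    rw [not_lt] at hle
    have h1 := (le_abs_self _).trans (holder_of_le hP hβ hf (x := a) (y := b)
      ⟨ha, by linarith⟩ ⟨by linarith, hb⟩)
    rw [abs_sub_comm, abs_of_pos (by linarith)] at h1
    have h2 : (b - a) ^ P.β ≤ 2 * P.bandwidth n ^ P.β := by
      calc (b - a) ^ P.β ≤ (2 * P.bandwidth n) ^ P.β :=
            Real.rpow_le_rpow (by linarith) hle hβ0.le
        _ = 2 ^ P.β * P.bandwidth n ^ P.β := Real.mul_rpow (by norm_num) hh.le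
        _ ≤ 2 ^ (1 : ℝ) * P.bandwidth n ^ P.β := by
            gcongr
            norm_num
        _ = _ := by rw [Real.rpow_one]
    have h3 : P.L * (b - a) ^ P.β ≤ P.L * (2 * P.bandwidth n ^ P.β) := by gcongr
    nlinarith
  refine le_exceedanceZero ha hb hab2 fun t ht0 hth => ?_
  have e1 := holder_of_le hP hβ hf (x := a + t) (y := a) ⟨by linarith, by linarith⟩
    ⟨ha, by linarith⟩
  have e2 := holder_of_le hP hβ hf (x := b - t) (y := b) ⟨by linarith, by linarith⟩
    ⟨by linarith, hb⟩
  have ht : t ^ P.β < P.bandwidth n ^ P.β := Real.rpow_lt_rpow ht0 hth hβ0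
  rw [add_sub_cancel_left, abs_of_nonneg ht0] at e1
  rw [sub_sub_cancel_left, abs_neg, abs_of_nonneg ht0] at e2
  rw [abs_le] at e1 e2
  have ht' : P.L * t ^ P.β < P.L * P.bandwidth n ^ P.β := by gcongr
  have hγ : P.γ n = P.Cβ * P.bandwidth n ^ P.β := by rw [Params.γ, hP.frac_of_le hβ]
  rw [hγ]
  linarith [e1.1, e2.2]

/-- With high probability, a proportion of almost `ε` of the design points is good. -/
theorem goodSet_of_le (hL : P.Large α n) (hP : P.Valid) (hβ : P.β ≤ 1) {f : ℝ → ℝ}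
    (hf : f ∈ alternatives P.β P.L (P.sepConst * P.sepRate n)) :
    dataLaw n P.σ f {y | 3 / 5 * (exceedanceZero (P.γ n) f).toReal * n ≤
      ((goodSet P α n (obs y)).card : ℝ)}ᶜ ≤ ENNReal.ofReal (α / 2) := by
  refine (measure_mono (Set.compl_subset_compl.2 fun y hy => ?_)).trans (hL.noise_le hP f)
  have hn := hL.natCast_pos
  have h1 := hL.exceedanceZero_le_goodSet hP hβ hf.1 hy
  have h2 := ENNReal.toReal_mono ENNReal.ofReal_ne_top h1
  rw [ENNReal.toReal_ofReal (by positivity), le_div_iff₀ hn] at h2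
  have h3 := ENNReal.toReal_mono (ne_top_of_le_ne_top ENNReal.one_ne_top
    (exceedanceZero_le_one _ _)) (hL.bandwidth_le_exceedanceZero hP hβ hf)
  rw [ENNReal.toReal_ofReal (hP.bandwidth_pos hL.two_le).le] at h3
  have h4 := hL.le_mul_bandwidth
  simp only [Set.mem_ofPred_eq]
  have h5 : n * P.bandwidth n ≤ (exceedanceZero (P.γ n) f).toReal * n := by
    rw [mul_comm]; gcongr
  -- the excluded index `n` costs at most `1 ≤ n ε / 100`
  linarith

end Params.Large

/-! ### Smoothness above one: the local linear estimator -/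

/-- At an interior design point the window is symmetric, so the first kernel moment vanishes. -/
theorem kernelFirstMoment_eq_zero {K : ℝ → ℝ} (hK : ∀ u, 1 < |u| → K u = 0)
    (hsymm : ∀ u, K (-u) = K u) {n i : ℕ} {h : ℝ} (hn : 0 < n) (hh : 0 < h)
    (h1 : (n : ℝ) * h < i) (h2 : i + (n : ℝ) * h ≤ n) :
    ∑ l ∈ Finset.Icc 1 n, K (((l : ℝ) / n - (i : ℝ) / n) / h) *
      (((l : ℝ) / n - (i : ℝ) / n) / h) = 0 := by
  have hn0 : (0 : ℝ) < n := by exact_mod_cast hn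
  set u : ℕ → ℝ := fun l => ((l : ℝ) / n - (i : ℝ) / n) / h with hu
  have hu' : ∀ l, u l = ((l : ℝ) - i) / (n * h) := fun l => by rw [hu]; field_simp
  have hN : 0 < n * h := by positivity
  have hwin : ∀ l, K (u l) ≠ 0 → (i : ℝ) - n * h ≤ l ∧ (l : ℝ) ≤ i + n * h := by
    intro l hl
    have : |u l| ≤ 1 := not_lt.1 fun hlt => hl (hK _ hlt)
    rw [hu', abs_div, abs_of_pos hN, div_le_one hN, abs_le] at this
    constructor <;> linarith [this.1, this.2]
  have hrefl : ∀ l, l ≤ 2 * i → u (2 * i - l) = -u l := by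
    intro l hl
    rw [hu', hu', Nat.cast_sub hl]
    push_cast; ring
  have hle : ∀ l, K (u l) ≠ 0 → l < 2 * i := fun l hl => by
    have := (hwin l hl).2
    have : (l : ℝ) < (2 * i : ℕ) := by push_cast; linarith
    exact_mod_cast this
  classical
  rw [← Finset.sum_filter_add_sum_filter_not _ (fun l => K (u l) ≠ 0),
    Finset.sum_eq_zero (s := (Finset.Icc 1 n).filter fun l => ¬ K (u l) ≠ 0) (fun l hl => by
      have := not_not.1 (Finset.mem_filter.1 hl).2
      rw [hu] at this
      simp only at this
      rw [this, zero_mul]), add_zero]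
  refine Finset.sum_involution (fun l _ => 2 * i - l) ?_ ?_ ?_ ?_
  · intro l hl
    have hl' := (Finset.mem_filter.1 hl).2
    change K (u l) * u l + K (u (2 * i - l)) * u (2 * i - l) = 0
    rw [hrefl l (hle l hl').le, hsymm]; ring
  · intro l hl hne heq
    apply hne
    have hl' := (Finset.mem_filter.1 hl).2
    have : l = i := by have := hle l hl'; omega
    change K (u l) * u l = 0
    rw [hu' l, this, sub_self, zero_div, mul_zero]
  · intro l hl
    have hl' := (Finset.mem_filter.1 hl).2
    have hK' : K (u (2 * i - l)) ≠ 0 := by rw [hrefl l (hle l hl').le, hsymm]; exact hl'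
    rw [Finset.mem_filter, Finset.mem_Icc]
    refine ⟨⟨by have := hle l hl'; omega, ?_⟩, hK'⟩
    have := (hwin _ hK').2
    exact_mod_cast this.trans h2
  · intro l hl
    have hl' := (Finset.mem_filter.1 hl).2
    have := hle l hl'
    omega

/-- Away from the boundary, moving the estimation point by one design point is the same as shifting
the data. -/
theorem kernelSum_shift {K : ℝ → ℝ} (hK : ∀ u, 1 < |u| → K u = 0) {n i : ℕ} {h : ℝ} (hn : 0 < n)
    (hh : 0 < h) (h1 : (n : ℝ) * h < i) (h2 : i + (n : ℝ) * h < n) (g : ℕ → ℝ) :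
    ∑ l ∈ Finset.Icc 1 n, K (((l : ℝ) / n - ((i + 1 : ℕ) : ℝ) / n) / h) * g l =
      ∑ l ∈ Finset.Icc 1 n, K (((l : ℝ) / n - (i : ℝ) / n) / h) * g (l + 1) := by
  have hn0 : (0 : ℝ) < n := by exact_mod_cast hn
  have hN : 0 < n * h := by positivity
  set G : ℕ → ℝ := fun l => K (((l : ℝ) / n - (i : ℝ) / n) / h) * g (l + 1) with hG
  have hu : ∀ l : ℝ, (l / n - (i : ℝ) / n) / h = (l - i) / (n * h) := fun l => by field_simp
  have hI : ∀ F : ℕ → ℝ, ∑ l ∈ Finset.Icc 1 n, F l = ∑ l ∈ Finset.range n, F (l + 1) := by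
    intro F
    rw [Finset.range_eq_Ico, Finset.sum_Ico_add' F 0 n 1, zero_add]
    rfl
  have hG0 : G 0 = 0 := by
    simp only [hG]
    rw [hu, hK, zero_mul]
    rw [abs_div, abs_of_pos hN, lt_div_iff₀ hN, one_mul, Nat.cast_zero, zero_sub, abs_neg,
      Nat.abs_cast]
    exact h1
  have hGn : G n = 0 := by
    simp only [hG]
    rw [hu, hK, zero_mul]
    rw [abs_div, abs_of_pos hN, lt_div_iff₀ hN, one_mul]
    exact lt_of_lt_of_le (by linarith) (le_abs_self _)
  rw [hI, hI]
  have h3 : ∑ l ∈ Finset.range n, G (l + 1) = ∑ l ∈ Finset.range n, G l := by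
    have e1 := Finset.sum_range_succ G n
    have e2 := Finset.sum_range_succ' G n
    linarith
  change _ = ∑ l ∈ Finset.range n, G (l + 1)
  rw [h3]
  refine Finset.sum_congr rfl fun l _ => ?_
  simp only [hG]
  congr 2
  push_cast
  ring

namespace Params.Large

variable {P : Params} {α : ℝ} {n : ℕ}

/-- The coefficient of the observation with index `l` in the difference of the estimates at the
design points with indices `i` and `i + 1`, for `i` away from the boundary. -/
noncomputable def diffWeight (P : Params) (n i l : ℕ) : ℝ :=
  (P.K (((l : ℝ) / n - (i : ℝ) / n) / P.bandwidth n) -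
    P.K (((l : ℝ) / n - ((i + 1 : ℕ) : ℝ) / n) / P.bandwidth n)) /
    ∑ l ∈ Finset.Icc 1 n, P.K (((l : ℝ) / n - (i : ℝ) / n) / P.bandwidth n)

theorem order_of_lt (hP : P.Valid) (hβ : 1 < P.β) : P.order = 1 := by
  rw [Params.order, hP.ceil_eq_two hβ]

theorem lpe_interior (hL : P.Large α n) (hP : P.Valid) (hβ : 1 < P.β) (y : ℕ → ℝ) {i : ℕ}
    (h1 : (n : ℝ) * P.bandwidth n < i) (h2 : i + (n : ℝ) * P.bandwidth n ≤ n) :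
    lpe P.K P.order n (P.bandwidth n) y ((i : ℝ) / n) =
      (∑ l ∈ Finset.Icc 1 n, P.K (((l : ℝ) / n - (i : ℝ) / n) / P.bandwidth n) * y l) /
      ∑ l ∈ Finset.Icc 1 n, P.K (((l : ℝ) / n - (i : ℝ) / n) / P.bandwidth n) := by
  have hh := hP.bandwidth_pos hL.two_le
  have hn := hL.natCast_pos
  have hN := hL.le_mul_bandwidth
  have hi : i ∈ Finset.Icc 1 n := by
    rw [Finset.mem_Icc]
    have a1 : (0 : ℝ) < i := by linarith
    have a2 : (i : ℝ) ≤ n := by linarith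
    exact ⟨by exact_mod_cast a1, by exact_mod_cast a2⟩
  have hgram := hL.gram _ (div_mem_Icc hi)
  rw [order_of_lt hP hβ] at hgram ⊢
  have hs2 := kernelSecondMoment_ge (by linarith) hgram
  have hs2' : 0 < ∑ l ∈ Finset.Icc 1 n, P.K (((l : ℝ) / n - (i : ℝ) / n) / P.bandwidth n) *
      (((l : ℝ) / n - (i : ℝ) / n) / P.bandwidth n) *
      (((l : ℝ) / n - (i : ℝ) / n) / P.bandwidth n) :=
    lt_of_lt_of_le (mul_pos hP.lam0_pos (by linarith)) hs2
  have hs1 := kernelFirstMoment_eq_zero hP.K_support hP.K_symm (by exact_mod_cast hn) hh h1 h2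
  have := lpe_one P.K n (P.bandwidth n) ((i : ℝ) / n) y (by linarith)
  simp only at this
  rw [this, hs1, zero_mul, sub_zero, zero_mul, sub_zero, mul_comm, mul_div_mul_right _ _ hs2'.ne']

theorem statistic_eq (hL : P.Large α n) (hP : P.Valid) (hβ : 1 < P.β) (y : ℕ → ℝ) {i : ℕ}
    (h1 : (n : ℝ) * P.bandwidth n < i) (h2 : i + 1 + (n : ℝ) * P.bandwidth n ≤ n) :
    P.statistic n y i (i + 1) = ∑ l ∈ Finset.Icc 1 n, diffWeight P n i l * y l := by
  have hh := hP.bandwidth_pos hL.two_le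
  have hn : 0 < n := by exact_mod_cast hL.natCast_pos
  rw [Params.statistic, hL.lpe_interior hP hβ y h1 (by linarith),
    hL.lpe_interior hP hβ y (by push_cast; linarith) (by push_cast; linarith)]
  have hS := kernelSum_shift hP.K_support hn hh h1 (by linarith) fun _ => 1
  simp only [mul_one] at hS
  rw [hS, ← sub_div, ← Finset.sum_sub_distrib, Finset.sum_div]
  exact Finset.sum_congr rfl fun l _ => by rw [diffWeight]; ring

theorem sum_diffWeight_mul (hL : P.Large α n) (hP : P.Valid) (g : ℕ → ℝ) {i : ℕ}
    (h1 : (n : ℝ) * P.bandwidth n < i) (h2 : i + (n : ℝ) * P.bandwidth n < n) :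
    ∑ l ∈ Finset.Icc 1 n, diffWeight P n i l * g l =
      ∑ l ∈ Finset.Icc 1 n, weight P n i l * (g l - g (l + 1)) := by
  have hh := hP.bandwidth_pos hL.two_le
  have hn : 0 < n := by exact_mod_cast hL.natCast_pos
  have hS := kernelSum_shift hP.K_support hn hh h1 h2 g
  simp only [diffWeight, weight, div_mul_eq_mul_div, ← Finset.sum_div, sub_mul, mul_sub,
    Finset.sum_sub_distrib, hS]
  rw [sub_div]

theorem sum_diffWeight_sq_le (hL : P.Large α n) (hP : P.Valid) {i : ℕ} (hi : i ∈ Finset.Icc 1 n) :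
    ∑ l ∈ Finset.Icc 1 n, diffWeight P n i l ^ 2 ≤
      3 * P.LK ^ 2 / (P.lam0 ^ 2 * (n * P.bandwidth n) ^ 3) := by
  have hh := hP.bandwidth_pos hL.two_le
  have hn := hL.natCast_pos
  have hN := hL.le_mul_bandwidth
  have hlam := hP.lam0_pos
  have hLK := hP.LK_pos
  set N := n * P.bandwidth n with hNdef
  have hN0 : 0 < N := by linarith
  have hS := hL.kernelSum_ge (div_mem_Icc hi)
  set S := ∑ l ∈ Finset.Icc 1 n, P.K (((l : ℝ) / n - (i : ℝ) / n) / P.bandwidth n) with hSdef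
  have hu : ∀ l k : ℕ, ((l : ℝ) / n - (k : ℝ) / n) / P.bandwidth n = ((l : ℝ) - k) / N :=
    fun l k => by rw [hNdef]; field_simp
  set c := P.LK / N / (P.lam0 * N) with hc
  set T := Finset.Icc (i - ⌊N⌋₊) (i + 1 + ⌊N⌋₊) with hT
  have hzero : ∀ l, l ∉ T → diffWeight P n i l = 0 := by
    intro l hl
    rw [hT, Finset.mem_Icc, not_and_or] at hl
    have hfl := Nat.lt_floor_add_one N
    have hout : ∀ k : ℕ, (l + ⌊N⌋₊ + 1 ≤ k ∨ k + ⌊N⌋₊ + 1 ≤ l) → P.K (((l : ℝ) - k) / N) = 0 := by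
      intro k hk
      apply hP.K_support
      rw [abs_div, abs_of_pos hN0, lt_div_iff₀ hN0, one_mul, lt_abs]
      rcases hk with hk | hk
      · right
        have : (l : ℝ) + ⌊N⌋₊ + 1 ≤ k := by exact_mod_cast hk
        linarith
      · left
        have : (k : ℝ) + ⌊N⌋₊ + 1 ≤ l := by exact_mod_cast hk
        linarith
    rw [diffWeight, hu, hu, hout i (by omega), hout (i + 1) (by omega), sub_zero, zero_div]
  have hle : ∀ l, diffWeight P n i l ^ 2 ≤ c ^ 2 := by
    intro l
    rw [sq_le_sq, abs_of_pos (show 0 < c by positivity), diffWeight, abs_div, ← hSdef,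
      abs_of_pos (show 0 < S from lt_of_lt_of_le (by positivity) hS), hu, hu]
    refine div_le_div₀ (by positivity) ?_ (by positivity) hS
    refine (hP.K_lipschitz _ _).trans_eq ?_
    rw [← sub_div, abs_div, abs_of_pos hN0]
    push_cast
    rw [show (l : ℝ) - i - (l - (i + 1)) = 1 by ring, abs_one]
    ring
  have hcard : (T.card : ℝ) ≤ 3 * N := by
    have h1 : T.card ≤ 2 * ⌊N⌋₊ + 2 := by rw [hT, Nat.card_Icc]; omega
    have h2 := Nat.floor_le hN0.le
    have h3 : (T.card : ℝ) ≤ 2 * ⌊N⌋₊ + 2 := by exact_mod_cast h1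
    linarith
  calc ∑ l ∈ Finset.Icc 1 n, diffWeight P n i l ^ 2
      = ∑ l ∈ (Finset.Icc 1 n).filter (· ∈ T), diffWeight P n i l ^ 2 := by
        rw [Finset.sum_filter]
        refine Finset.sum_congr rfl fun l _ => ?_
        split_ifs with hl
        · rfl
        · rw [hzero l hl, zero_pow two_ne_zero]
    _ ≤ ∑ l ∈ T, diffWeight P n i l ^ 2 :=
        Finset.sum_le_sum_of_subset_of_nonneg (fun l hl => (Finset.mem_filter.1 hl).2)
          fun _ _ _ => sq_nonneg _
    _ ≤ T.card * c ^ 2 := by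
        simpa using Finset.sum_le_card_nsmul T _ (c ^ 2) fun l _ => hle l
    _ ≤ 3 * N * c ^ 2 := by gcongr
    _ = _ := by rw [hc]; field_simp

/-- The factor `8 L₂ σ / λ₀ √(4 W / C_h ^ (2 β + 1))` of the slopes detected by the test. -/
noncomputable def slopeConst (P : Params) : ℝ :=
  8 * P.L2 / P.lam0 * (P.σ * √(4 * P.W / P.Ch ^ (2 * P.β + 1)))

theorem slopeConst_nonneg (hP : P.Valid) : 0 ≤ slopeConst P := by
  have := hP.L2_pos
  have := hP.lam0_pos
  have := hP.σ_pos
  unfold slopeConst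
  positivity

theorem Cβ_of_lt (P : Params) (hβ : 1 < P.β) : P.Cβ = 4 * P.L + 2 * slopeConst P := by
  rw [Params.Cβ, if_neg (not_le.2 hβ), slopeConst]; ring

/-- The bound for the noise of the difference of neighbouring estimates that holds uniformly with
high probability. -/
noncomputable def diffNoiseLevel (P : Params) (n : ℕ) : ℝ :=
  slopeConst P * P.bandwidth n ^ (P.β - 1) / n

theorem diffNoise_le (hL : P.Large α n) (hP : P.Valid) (hβ : 1 < P.β) (f : ℝ → ℝ) :
    dataLaw n P.σ f {y | ∀ i ∈ Finset.Icc 1 n, -diffNoiseLevel P n ≤ ∑ l ∈ Finset.Icc 1 n,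
      diffWeight P n i l * (obs y l - f ((l : ℝ) / n))}ᶜ ≤ ENNReal.ofReal (α / 2) := by
  have hh := hP.bandwidth_pos hL.two_le
  have hn := hL.natCast_pos
  have hn' : 0 < n := by exact_mod_cast hn
  have hlam := hP.lam0_pos
  have hLK := hP.LK_pos
  have hσ := hP.σ_pos
  have hN : 0 < n * P.bandwidth n := by positivity
  set V := 3 * P.LK ^ 2 / (P.lam0 ^ 2 * (n * P.bandwidth n) ^ 3) with hV
  have ht : 0 ≤ diffNoiseLevel P n := by
    have := slopeConst_nonneg hP
    unfold diffNoiseLevel; positivity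
  have key := noise_tail_iUnion n P.σ f (Finset.Icc 1 n) (fun i l => -diffWeight P n i l) (V := V)
    ht hσ.ne' fun i hi => by
      simp only [neg_sq]
      exact hL.sum_diffWeight_sq_le hP hi
  have hexp : Real.exp (-(diffNoiseLevel P n ^ 2 / (2 * P.σ ^ 2 * V))) ≤ 1 / (n : ℝ) ^ 2 := by
    refine exp_neg_le_inv_sq hn' ?_
    have h1 : diffNoiseLevel P n ^ 2 = (8 * P.L2 / P.lam0) ^ 2 * P.σ ^ 2 *
        (4 * P.W * (Real.log n / (n * P.bandwidth n))) / (n * P.bandwidth n) ^ 2 := by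
      rw [← hL.sqrt_mul_bandwidth_sq hP (by norm_num : (0 : ℝ) ≤ 4), diffNoiseLevel, slopeConst,
        Real.rpow_sub_one hh.ne']
      field_simp
    rw [h1, hV, le_div_iff₀ (by positivity)]
    have h2 := hL.twentyeight_le_W hP
    have h3 : 0 ≤ Real.log n := Real.log_natCast_nonneg n
    have h4 : 2 * Real.log n * (2 * P.σ ^ 2 *
        (3 * P.LK ^ 2 / (P.lam0 ^ 2 * (n * P.bandwidth n) ^ 3))) =
        P.σ ^ 2 * (Real.log n / (n * P.bandwidth n)) / (n * P.bandwidth n) ^ 2 / P.lam0 ^ 2 *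
          (12 * P.LK ^ 2) := by
      field_simp; ring
    have h5 : (8 * P.L2 / P.lam0) ^ 2 * P.σ ^ 2 *
        (4 * P.W * (Real.log n / (n * P.bandwidth n))) / (n * P.bandwidth n) ^ 2 =
        P.σ ^ 2 * (Real.log n / (n * P.bandwidth n)) / (n * P.bandwidth n) ^ 2 / P.lam0 ^ 2 *
          (256 * P.L2 ^ 2 * P.W) := by
      field_simp; ring
    rw [h4, h5]
    have h6 : P.LK ≤ P.L2 := by
      have := hP.Kmax_pos
      unfold Params.L2
      rw [hP.ceil_eq_two hβ]
      push_cast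
      linarith
    have h7 : P.LK ^ 2 ≤ P.L2 ^ 2 := pow_le_pow_left₀ hLK.le h6 2
    refine mul_le_mul_of_nonneg_left ?_ (by positivity)
    nlinarith [sq_nonneg P.L2]
  refine (measure_mono ?_).trans (key.trans ?_)
  · intro y hy
    simp only [Set.mem_compl_iff, Set.mem_ofPred_eq, not_forall, not_le] at hy
    obtain ⟨i, hi, hlt⟩ := hy
    refine ⟨i, hi, ?_⟩
    simp only [neg_mul, Finset.sum_neg_distrib]
    linarith
  · rw [Nat.card_Icc, Nat.add_sub_cancel, ← ENNReal.ofReal_natCast,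
      ← ENNReal.ofReal_mul (by positivity)]
    refine ENNReal.ofReal_le_ofReal (le_trans ?_ hL.two_div_le)
    calc (n : ℝ) * Real.exp (-(diffNoiseLevel P n ^ 2 / (2 * P.σ ^ 2 * V)))
        ≤ (n : ℝ) * (1 / (n : ℝ) ^ 2) := by gcongr
      _ = 1 / n := by field_simp
      _ ≤ _ := by gcongr; norm_num

theorem holder_deriv (hP : P.Valid) (hβ : 1 < P.β) {f : ℝ → ℝ} (hf : f ∈ holderClass P.β P.L)
    {x y : ℝ} (hx : x ∈ Set.Icc (0 : ℝ) 1) (hy : y ∈ Set.Icc (0 : ℝ) 1) :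
    |derivWithin f (Set.Icc 0 1) x - derivWithin f (Set.Icc 0 1) y| ≤ P.L * |x - y| ^ (P.β - 1) := by
  have h := hf.2 x hx y hy
  rw [hP.ceil_eq_two hβ] at h
  have e : P.β + 1 - ((2 : ℕ) : ℝ) = P.β - 1 := by push_cast; ring
  rw [e] at h
  simpa [iteratedDerivWithin_one] using h

/-- The derivative at a point of distance at most `c h` exceeds that at `x` by at most
`c L h ^ (β - 1)`, if `c ≥ 1`. -/
theorem deriv_le (hP : P.Valid) (hβ : 1 < P.β) {f : ℝ → ℝ} (hf : f ∈ holderClass P.β P.L)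
    {x y h c : ℝ} (hh : 0 < h) (hc : 1 ≤ c) (hx : x ∈ Set.Icc (0 : ℝ) 1)
    (hy : y ∈ Set.Icc (0 : ℝ) 1) (hxy : |x - y| ≤ c * h) :
    derivWithin f (Set.Icc 0 1) y ≤ derivWithin f (Set.Icc 0 1) x + c * P.L * h ^ (P.β - 1) := by
  have h1 := (abs_le.1 (holder_deriv hP hβ hf hx hy)).1
  have h2 : |x - y| ^ (P.β - 1) ≤ c * h ^ (P.β - 1) := by
    calc |x - y| ^ (P.β - 1) ≤ (c * h) ^ (P.β - 1) :=
          Real.rpow_le_rpow (abs_nonneg _) hxy (by linarith)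
      _ = c ^ (P.β - 1) * h ^ (P.β - 1) := Real.mul_rpow (by linarith) hh.le
      _ ≤ c ^ (1 : ℝ) * h ^ (P.β - 1) := by
          have := hP.β_le
          gcongr
          linarith
      _ = _ := by rw [Real.rpow_one]
  have h3 := mul_le_mul_of_nonneg_left h2 hP.L_pos.le
  linarith

/-- Mean value inequality on an interval inside `(0, 1)`. -/
theorem sub_le_of_derivWithin_le {f : ℝ → ℝ} (hf : ContDiffOn ℝ 1 f (Set.Icc 0 1)) {a b c : ℝ}
    (ha : 0 ≤ a) (hab : a ≤ b) (hb : b ≤ 1)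
    (hd : ∀ x ∈ Set.Ioo a b, derivWithin f (Set.Icc 0 1) x ≤ c) : f b - f a ≤ c * (b - a) := by
  have hsub : Set.Icc a b ⊆ Set.Icc 0 1 := Set.Icc_subset_Icc ha hb
  have hnhds : ∀ x ∈ Set.Ioo a b, Set.Icc (0 : ℝ) 1 ∈ 𝓝 x := fun x hx =>
    Icc_mem_nhds (ha.trans_lt hx.1) (hx.2.trans_le hb)
  refine Convex.image_sub_le_mul_sub_of_deriv_le (convex_Icc a b) (hf.continuousOn.mono hsub) ?_ ?_
    a (Set.left_mem_Icc.2 hab) b (Set.right_mem_Icc.2 hab) hab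
  · intro x hx
    rw [interior_Icc] at hx
    exact ((hf.differentiableOn one_ne_zero x (hsub (Set.Ioo_subset_Icc_self hx))).differentiableAt
      (hnhds x hx)).differentiableWithinAt
  · intro x hx
    rw [interior_Icc] at hx
    rw [← derivWithin_of_mem_nhds (hnhds x hx)]
    exact hd x hx

theorem four_L_le_Cβ_of_lt (hP : P.Valid) (hβ : 1 < P.β) : 4 * P.L ≤ P.Cβ := by
  rw [Cβ_of_lt P hβ]
  linarith [slopeConst_nonneg hP]

/-- Next to an interior point where `f' ≤ -γ_n`, the local test for neighbouring design points
rejects, unless the noise is exceptionally large. -/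
theorem rejects_of_slope (hL : P.Large α n) (hP : P.Valid) (hβ : 1 < P.β) {f : ℝ → ℝ}
    (hf : f ∈ holderClass P.β P.L) {y : ℕ → ℝ}
    (hy : ∀ i ∈ Finset.Icc 1 n, -diffNoiseLevel P n ≤ ∑ l ∈ Finset.Icc 1 n,
      diffWeight P n i l * (y l - f ((l : ℝ) / n))) {x : ℝ}
    (hx : x ∈ Set.Icc (3 / 2 * P.bandwidth n) (1 - 3 / 2 * P.bandwidth n))
    (hd : derivWithin f (Set.Icc 0 1) x ≤ -P.γ n) :
    1 ≤ ⌈(n : ℝ) * x⌉₊ ∧ ⌈(n : ℝ) * x⌉₊ + 1 ≤ n ∧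
      P.Rejects n α y ⌈(n : ℝ) * x⌉₊ (⌈(n : ℝ) * x⌉₊ + 1) := by
  have hh := hP.bandwidth_pos hL.two_le
  have hn := hL.natCast_pos
  have hN := hL.le_mul_bandwidth
  have hx0 : 0 < x := by linarith [hx.1]
  have hx1 : x ∈ Set.Icc (0 : ℝ) 1 := ⟨hx0.le, by linarith [hx.2]⟩
  have hc1 := Nat.le_ceil ((n : ℝ) * x)
  have hc2 := Nat.ceil_lt_add_one (show 0 ≤ (n : ℝ) * x by positivity)
  set i := ⌈(n : ℝ) * x⌉₊ with hi
  set h := P.bandwidth n with hh'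
  have hnx1 : 3 / 2 * (n * h) ≤ n * x := by nlinarith [hx.1]
  have hnx2 : n * x ≤ n - 3 / 2 * (n * h) := by nlinarith [hx.2]
  have hi1 : (n : ℝ) * h < i := by linarith
  have hi2 : (i : ℝ) + 1 + n * h ≤ n := by linarith
  have himem : i ∈ Finset.Icc 1 n := by
    rw [Finset.mem_Icc]
    have a1 : (0 : ℝ) < i := by linarith
    have a2 : (i : ℝ) ≤ n := by linarith
    exact ⟨by exact_mod_cast a1, by exact_mod_cast a2⟩
  have hi3 : i + 1 ≤ n := by
    have : ((i + 1 : ℕ) : ℝ) ≤ n := by push_cast; linarith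
    exact_mod_cast this
  refine ⟨(Finset.mem_Icc.1 himem).1, hi3, ?_⟩
  have hγ : P.γ n = P.Cβ * h ^ (P.β - 1) := by rw [Params.γ, hP.frac_of_lt hβ]
  have hcont : ContDiffOn ℝ 1 f (Set.Icc 0 1) := by
    have := hf.1
    rw [hP.ceil_eq_two hβ] at this
    exact_mod_cast this
  -- the mean of the statistic
  have hsignal : (P.Cβ - 2 * P.L) * h ^ (P.β - 1) / n ≤
      ∑ l ∈ Finset.Icc 1 n, diffWeight P n i l * f ((l : ℝ) / n) := by
    rw [hL.sum_diffWeight_mul hP (fun l => f ((l : ℝ) / n)) hi1 (by linarith)]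
    calc (P.Cβ - 2 * P.L) * h ^ (P.β - 1) / n
        = ∑ l ∈ Finset.Icc 1 n, weight P n i l * ((P.Cβ - 2 * P.L) * h ^ (P.β - 1) / n) := by
          rw [← Finset.sum_mul, hL.sum_weight hP himem, one_mul]
      _ ≤ _ := by
          refine Finset.sum_le_sum fun l hl => ?_
          by_cases hu : 1 < |((l : ℝ) / n - (i : ℝ) / n) / h|
          · have hw : weight P n i l = 0 := by rw [weight, hP.K_support _ hu, zero_div]
            rw [hw, zero_mul, zero_mul]
          refine mul_le_mul_of_nonneg_left ?_ (weight_nonneg hP i l)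
          have e : ((l : ℝ) / n - (i : ℝ) / n) / h = ((l : ℝ) - i) / (n * h) := by field_simp
          rw [not_lt, e, abs_div, abs_of_pos (show 0 < n * h by positivity),
            div_le_one (by positivity), abs_le] at hu
          have hl0 : (0 : ℝ) ≤ (l : ℝ) / n := by positivity
          have hl1 : ((l + 1 : ℕ) : ℝ) / n ≤ 1 := by
            rw [div_le_one hn]; push_cast; linarith [hu.2]
          have hlen : ((l + 1 : ℕ) : ℝ) / n - (l : ℝ) / n = 1 / n := by push_cast; ring
          have hmv := sub_le_of_derivWithin_le hcont (a := (l : ℝ) / n)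
            (b := ((l + 1 : ℕ) : ℝ) / n) (c := -((P.Cβ - 2 * P.L) * h ^ (P.β - 1))) hl0
            (by rw [← sub_nonneg, hlen]; positivity) hl1 fun z hz => ?_
          · rw [hlen] at hmv
            have : (P.Cβ - 2 * P.L) * h ^ (P.β - 1) / n =
              -(-((P.Cβ - 2 * P.L) * h ^ (P.β - 1)) * (1 / n)) := by ring
            rw [this]
            linarith
          · have hz1 : (l : ℝ) < z * n := (div_lt_iff₀ hn).1 hz.1
            have hz2 : z * n < ((l + 1 : ℕ) : ℝ) := (lt_div_iff₀ hn).1 hz.2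
            push_cast at hz2
            have hxz : |x - z| ≤ 2 * h := by
              have : |n * (x - z)| ≤ n * (2 * h) := by
                rw [abs_le]
                constructor <;> linarith [hu.1, hu.2]
              rw [abs_mul, abs_of_pos hn] at this
              exact le_of_mul_le_mul_left this hn
            have := deriv_le hP hβ hf hh one_le_two hx1
              ⟨hl0.trans hz.1.le, hz.2.le.trans hl1⟩ hxz
            rw [hγ] at hd
            linarith
  have hnoise := hy i himem
  have hstat : (P.Cβ - 2 * P.L) * h ^ (P.β - 1) / n - diffNoiseLevel P n ≤
      P.statistic n y i (i + 1) := by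
    rw [hL.statistic_eq hP hβ y hi1 hi2]
    simp only [mul_sub, Finset.sum_sub_distrib] at hnoise
    linarith
  -- the critical value
  have hbias : P.critBias n i (i + 1) = 0 := by
    unfold Params.critBias
    rw [if_pos]
    refine ⟨⟨?_, ?_⟩, ?_, ?_⟩
    · rw [le_div_iff₀ hn]; linarith
    · rw [div_le_iff₀ hn]; linarith
    · rw [le_div_iff₀ hn]; push_cast; linarith
    · rw [div_le_iff₀ hn]; push_cast; linarith
  have hcrit : P.critNoise n α i (i + 1) ≤ slopeConst P * h ^ (P.β - 1) / n := by
    have hdist : |(i : ℝ) / n - ((i + 1 : ℕ) : ℝ) / n| = 1 / n := by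
      have : (i : ℝ) / n - ((i + 1 : ℕ) : ℝ) / n = -(1 / n) := by push_cast; ring
      rw [this, abs_neg, abs_of_pos (by positivity)]
    have hL2 := hP.L2_pos
    have hlam := hP.lam0_pos
    unfold Params.critNoise
    rw [hdist]
    calc _ ≤ P.critScale n α * (8 * P.L2 / P.lam0 * (1 / n)) :=
          mul_le_mul_of_nonneg_left (min_le_left _ _) hL.scale_nonneg
      _ ≤ P.σ * √(4 * P.W / P.Ch ^ (2 * P.β + 1)) * h ^ (P.β - 1) *
          (8 * P.L2 / P.lam0 * (1 / n)) := by gcongr; exact hL.scale_le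
      _ = _ := by rw [slopeConst]; ring
  rw [Params.Rejects, Params.critValue, hbias, add_zero]
  refine hcrit.trans (le_trans ?_ hstat)
  rw [Cβ_of_lt P hβ, diffNoiseLevel, ← sub_div]
  have hhβ : 0 < h ^ (P.β - 1) := by positivity
  have := hP.L_pos
  refine div_le_div_of_nonneg_right ?_ hn.le
  nlinarith

theorem isHeavy_of_one {R : ℕ → Prop} {m : ℕ} (hm : 1 ≤ m) (h : R 1) : IsHeavy R m := by
  classical
  exact isHeavy_of_half le_rfl hm (by simp [Finset.filter_singleton, h])

/-- The set where `f' ≤ -γ_n` contains an interval of length `6 h`, hence most of it lies away from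
the boundary. -/
theorem exceedanceOne_interior (hL : P.Large α n) (hP : P.Valid) (hβ : 1 < P.β) {f : ℝ → ℝ}
    (hf : f ∈ alternatives P.β P.L (P.sepConst * P.sepRate n)) :
    ∃ m : ℝ, volume ({x : ℝ | x ∈ Set.Icc (0 : ℝ) 1 ∧
        derivWithin f (Set.Icc 0 1) x ≤ -P.γ n} ∩
        Set.Icc (3 / 2 * P.bandwidth n) (1 - 3 / 2 * P.bandwidth n)) = ENNReal.ofReal m ∧
      P.bandwidth n ≤ (exceedanceOne (P.γ n) f).toReal ∧
      3 / 5 * (exceedanceOne (P.γ n) f).toReal ≤ m := by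
  obtain ⟨hf, hslope⟩ := hf
  rw [if_neg (not_le.2 hβ), hP.sepConst_mul_sepRate hL.two_le, hP.frac_of_lt hβ] at hslope
  obtain ⟨x₀, hx₀, hd⟩ := hslope
  have hh := hP.bandwidth_pos hL.two_le
  have hh1 := hL.bandwidth_le
  have hC := four_L_le_Cβ_of_lt hP hβ
  have hγ : P.γ n = P.Cβ * P.bandwidth n ^ (P.β - 1) := by rw [Params.γ, hP.frac_of_lt hβ]
  set h := P.bandwidth n with hh'
  have hhβ : 0 < h ^ (P.β - 1) := by positivity
  set E : Set ℝ := {x | x ∈ Set.Icc (0 : ℝ) 1 ∧ derivWithin f (Set.Icc 0 1) x ≤ -P.γ n} with hE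
  have hnear : ∀ z ∈ Set.Icc (0 : ℝ) 1, |x₀ - z| ≤ 6 * h → z ∈ E := by
    intro z hz hxz
    refine ⟨hz, ?_⟩
    have h1 := deriv_le hP hβ hf hh (by norm_num : (1 : ℝ) ≤ 6) hx₀ hz hxz
    rw [hγ]
    nlinarith
  have hfin : volume (E ∩ Set.Icc (3 / 2 * h) (1 - 3 / 2 * h)) ≠ ⊤ :=
    ne_top_of_le_ne_top (by simp : volume (Set.Icc (3 / 2 * h) (1 - 3 / 2 * h)) ≠ ⊤)
      (measure_mono Set.inter_subset_right)
  have hlow : ENNReal.ofReal (9 / 2 * h) ≤ volume (E ∩ Set.Icc (3 / 2 * h) (1 - 3 / 2 * h)) := by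
    have key : ∀ u : ℝ, Set.Icc u (u + 9 / 2 * h) ⊆ E ∩ Set.Icc (3 / 2 * h) (1 - 3 / 2 * h) →
        ENNReal.ofReal (9 / 2 * h) ≤ volume (E ∩ Set.Icc (3 / 2 * h) (1 - 3 / 2 * h)) := by
      intro u hu
      refine le_trans (le_of_eq ?_) (measure_mono hu)
      rw [Real.volume_Icc, add_sub_cancel_left]
    rcases le_total x₀ (1 / 2) with hx | hx
    · refine key (x₀ + 3 / 2 * h) fun z hz => ⟨hnear z ⟨?_, ?_⟩ (abs_le.2 ⟨?_, ?_⟩), ?_, ?_⟩ <;>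
        linarith [hz.1, hz.2, hx₀.1]
    · refine key (x₀ - 6 * h) fun z hz => ⟨hnear z ⟨?_, ?_⟩ (abs_le.2 ⟨?_, ?_⟩), ?_, ?_⟩ <;>
        linarith [hz.1, hz.2, hx₀.2]
  have hup : volume E ≤ volume (E ∩ Set.Icc (3 / 2 * h) (1 - 3 / 2 * h)) +
      ENNReal.ofReal (3 * h) := by
    have hcov : E ⊆ E ∩ Set.Icc (3 / 2 * h) (1 - 3 / 2 * h) ∪
        (Set.Icc 0 (3 / 2 * h) ∪ Set.Icc (1 - 3 / 2 * h) 1) := by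
      intro z hz
      rcases le_total z (3 / 2 * h) with h1 | h1
      · exact Or.inr (Or.inl ⟨hz.1.1, h1⟩)
      rcases le_total z (1 - 3 / 2 * h) with h2 | h2
      · exact Or.inl ⟨hz, h1, h2⟩
      · exact Or.inr (Or.inr ⟨h2, hz.1.2⟩)
    refine (measure_mono hcov).trans ((measure_union_le _ _).trans ?_)
    gcongr
    refine (measure_union_le _ _).trans ?_
    rw [Real.volume_Icc, Real.volume_Icc, ← ENNReal.ofReal_add (by linarith) (by linarith)]
    refine ENNReal.ofReal_le_ofReal ?_
    linarith
  refine ⟨(volume (E ∩ Set.Icc (3 / 2 * h) (1 - 3 / 2 * h))).toReal,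
    (ENNReal.ofReal_toReal hfin).symm, ?_⟩
  have h1 := ENNReal.toReal_mono hfin hlow
  rw [ENNReal.toReal_ofReal (by positivity)] at h1
  have h2 := ENNReal.toReal_mono (ENNReal.add_ne_top.2 ⟨hfin, ENNReal.ofReal_ne_top⟩) hup
  rw [ENNReal.toReal_add hfin ENNReal.ofReal_ne_top, ENNReal.toReal_ofReal (by positivity)] at h2
  have h3 : (volume (E ∩ Set.Icc (3 / 2 * h) (1 - 3 / 2 * h))).toReal ≤ (volume E).toReal :=
    ENNReal.toReal_mono (ne_top_of_le_ne_top ENNReal.one_ne_top (exceedanceOne_le_one (P.γ n) f))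
      (measure_mono Set.inter_subset_left)
  change h ≤ (volume E).toReal ∧ 3 / 5 * (volume E).toReal ≤ _
  constructor <;> linarith

/-- With high probability, a proportion of at least `3 ε / 5` of the design points is good. -/
theorem goodSet_of_lt (hL : P.Large α n) (hP : P.Valid) (hβ : 1 < P.β) {f : ℝ → ℝ}
    (hf : f ∈ alternatives P.β P.L (P.sepConst * P.sepRate n)) :
    dataLaw n P.σ f {y | 3 / 5 * (exceedanceOne (P.γ n) f).toReal * n ≤
      ((goodSet P α n (obs y)).card : ℝ)}ᶜ ≤ ENNReal.ofReal (α / 2) := by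
  refine (measure_mono (Set.compl_subset_compl.2 fun y hy => ?_)).trans (hL.diffNoise_le hP hβ f)
  have hn := hL.natCast_pos
  obtain ⟨m, hm, -, hm2⟩ := hL.exceedanceOne_interior hP hβ hf
  have hcov := volume_le_of_ceil_mem (n := n) (by exact_mod_cast hn) (goodSet P α n (obs y))
    (s := {x : ℝ | x ∈ Set.Icc (0 : ℝ) 1 ∧ derivWithin f (Set.Icc 0 1) x ≤ -P.γ n} ∩
        Set.Icc (3 / 2 * P.bandwidth n) (1 - 3 / 2 * P.bandwidth n)) fun x hx => by
      refine ⟨hx.1.1.1, fun _ => mem_goodSet.2 ?_⟩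
      obtain ⟨h1, h2, h3⟩ := hL.rejects_of_slope hP hβ hf.1 hy hx.2 hx.1.2
      exact ⟨h1, h2, Or.inl (isHeavy_of_one (by omega) h3)⟩
  rw [hm, ENNReal.ofReal_le_ofReal_iff (by positivity), le_div_iff₀ hn] at hcov
  exact le_trans (mul_le_mul_of_nonneg_right hm2 hn.le) hcov

/-! ### Detection for both ranges of smoothness -/

theorem exceedance_spec (hL : P.Large α n) (hP : P.Valid) {f : ℝ → ℝ}
    (hf : f ∈ alternatives P.β P.L (P.sepConst * P.sepRate n)) :
    P.bandwidth n ≤ exceedance (⌈P.β⌉₊ - 1) (P.γ n) f ∧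
      exceedance (⌈P.β⌉₊ - 1) (P.γ n) f ≤ 1 ∧
      dataLaw n P.σ f {y | 3 / 5 * exceedance (⌈P.β⌉₊ - 1) (P.γ n) f * n ≤
        ((goodSet P α n (obs y)).card : ℝ)}ᶜ ≤ ENNReal.ofReal (α / 2) := by
  rcases le_or_gt P.β 1 with hβ | hβ
  · have he : exceedance (⌈P.β⌉₊ - 1) (P.γ n) f = (exceedanceZero (P.γ n) f).toReal := by
      rw [exceedance, hP.ceil_eq_one hβ, if_pos rfl]
    rw [he]
    refine ⟨?_, ENNReal.toReal_le_of_le_ofReal zero_le_one (by simpa using exceedanceZero_le_one _ _),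
      hL.goodSet_of_le hP hβ hf⟩
    have h3 := ENNReal.toReal_mono (ne_top_of_le_ne_top ENNReal.one_ne_top
      (exceedanceZero_le_one _ _)) (hL.bandwidth_le_exceedanceZero hP hβ hf)
    rwa [ENNReal.toReal_ofReal (hP.bandwidth_pos hL.two_le).le] at h3
  · have he : exceedance (⌈P.β⌉₊ - 1) (P.γ n) f = (exceedanceOne (P.γ n) f).toReal := by
      rw [exceedance, hP.ceil_eq_two hβ, if_neg (by norm_num)]
    rw [he]
    obtain ⟨m, -, hm, -⟩ := hL.exceedanceOne_interior hP hβ hf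
    exact ⟨hm, ENNReal.toReal_le_of_le_ofReal zero_le_one (by simpa using exceedanceOne_le_one _ _),
      hL.goodSet_of_lt hP hβ hf⟩

end Params.Large

theorem Params.Valid.exists_detection {P : Params} (hP : P.Valid) {α : ℝ} (hα : 0 < α)
    (hα1 : α < 1) : ∃ A : ℝ, 0 < A ∧ ENNReal.ofReal (1 - α) ≤
      Filter.liminf (fun n : ℕ => ⨅ f ∈ alternatives P.β P.L (P.sepConst * P.sepRate n),
        detectProb P α n f (A * ((exceedance (⌈P.β⌉₊ - 1) (P.γ n) f)⁻¹ *
          (n : ℝ) ^ (2 * P.β / (2 * P.β + 1)) *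
          Real.log n ^ ((4 * P.β + 3) / (2 * P.β + 1))))) Filter.atTop := by
  obtain ⟨A, hA, hcost⟩ := hP.exists_detectionCost hα hα1
  refine ⟨A, hA, le_liminf_of_le (by isBoundedDefault) ?_⟩
  filter_upwards [hP.eventually_large hα hα1] with n hL
  refine le_iInf₂ fun f hf => ?_
  obtain ⟨h1, h2, h3⟩ := hL.exceedance_spec hP hf
  exact hP.detectProb_ge hα hα1 hL.two_le f h1 hL.search
    (hcost n hL.two_le _ ((hP.bandwidth_pos hL.two_le).trans_le h1) h2) h3

end FOMT

theorem mainTheorem4 (K : ℝ → ℝ) (Kmin Kmax Δ LK β L σ : ℝ)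
    (hK : FOMT.IsKernel K Kmin Kmax Δ LK)
    (hβ : 0 < β) (hβ2 : β ≤ 2) (hL : 0 < L) (hσ : 0 < σ) :
    -- the eigenvalue bound, which is a parameter of the test, exists
    (∃ lam0 : ℝ, FOMT.IsEigenBound K (⌈β⌉₊ - 1) lam0) ∧
    -- and for every choice of it:
    ∀ lam0 : ℝ, FOMT.IsEigenBound K (⌈β⌉₊ - 1) lam0 →
      ∀ P : FOMT.Params,
        P = { K := K, Kmax := Kmax, LK := LK, β := β, L := L, σ := σ, lam0 := lam0 } →
      ∀ α : ℝ, 0 < α → α < 1 →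
        -- worst case complexity
        (∃ A : ℝ, 0 < A ∧ ∀ n : ℕ, 2 ≤ n → ∀ y : Finset.Icc 1 n → ℝ,
          ∀ r ∈ (FOMT.fomtLaw P α n y).support, (r.2 : ℝ) ≤ A * (n * Real.log n ^ 2)) ∧
        -- complexity of detection
        (∃ A : ℝ, 0 < A ∧
          ENNReal.ofReal (1 - α) ≤
            Filter.liminf (fun n : ℕ =>
              ⨅ f ∈ FOMT.alternatives β L (P.sepConst * P.sepRate n),
                FOMT.detectProb P α n f
                  (A * ((FOMT.exceedance (⌈β⌉₊ - 1) (P.γ n) f)⁻¹ *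
                    (n : ℝ) ^ (2 * β / (2 * β + 1)) *
                    Real.log n ^ ((4 * β + 3) / (2 * β + 1))))) Filter.atTop) := by
  have hk : ⌈β⌉₊ - 1 = 0 ∨ ⌈β⌉₊ - 1 = 1 := by
    have : ⌈β⌉₊ ≤ 2 := Nat.ceil_le.2 (by exact_mod_cast hβ2)
    omega
  refine ⟨FOMT.exists_isEigenBound hK hk, fun lam0 hlam P hP α hα hα1 => ?_⟩
  subst hP
  have hV : FOMT.Params.Valid
      { K := K, Kmax := Kmax, LK := LK, β := β, L := L, σ := σ, lam0 := lam0 } :=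
    ⟨⟨Kmin, Δ, hK⟩, hβ, hβ2, hL, hσ, hlam⟩
  exact ⟨hV.exists_worstCase hα hα1, hV.exists_detection hα hα1⟩
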